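/- **Stabilizer money.** Let $n,m,l\ge 1$ be integers and $\epsilon\in[0,1]$. A *Pauli group operator* on $n$ qubits is an operator $(-1)^b A_1\otimes\cdots\otimes A_n$ with $b\in\{0,1\}$ and $A_k\in\{1,\sigma_x,\sigma_y,\sigma_z\}$. A *stabilizer state* is an $n$-qubit pure state fixed by exactly $2^n$ Pauli group operators, which form its *stabilizer group*. Independently for each register $i\in[l]$, the bank draws a uniformly random stabilizer state $|C_i\rangle$ and then, independently for $j\in[m]$, an operator $E_{ij}$: with probability $1-\epsilon$ a uniformly random Pauli group operator, and with probability $\epsilon$ a uniformly random element of the stabilizer group of $|C_i\rangle$. The table $E=(E_{ij})$ is public. To verify a state of $l$ registers of $n$ qubits each, the verifier draws $j(1),\dots,j(l)\in[m]$ independently and uniformly, measures $$Q=\frac1l\sum_{i=1}^{l} I^{\otimes (i-1)}\otimes E_{i,j(i)}\otimes I^{\otimes (l-i)},$$ and accepts if and only if the outcome is at least $\epsilon/2$. **Claim.** There are a quantum algorithm, which takes as input only $n,m,l$ and the table $E$, and runs for every input in time polynomial in $n+m+l$, and a constant $c>0$, with the following property. For every input the algorithm outputs a product state $\rho_1\otimes\cdots\otimes\rho_l$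 of $l$ registers of $n$ qubits ($\rho_i$ density matrices depending on the input). For every polynomial bound on $m$, that is, for every $d\in\mathbb N$, there are constants $C$ and $\alpha>0$ such that for all $n,m,l\ge1$ with $m\le n^d+d$ and all $0\le\epsilon\le\frac1{16\sqrt m}$, with probability at least $1-Ce^{-\alpha n}$ over the bank's table $E$, the verifier accepts the state $\rho_1\otimes\cdots\otimes\rho_l$ produced from $E$ with probability at least $1-e^{-c\,l/m}$. Here a quantum algorithm is a uniform family of quantum circuits: a single program of a classical random access machine (unit cost per instruction; addition and subtraction but no multiplication) prints, on the given input, a circuit of Hadamard, $T$, controlled-not and Toffoli gates; the circuit is run on $|0\cdots0\rangle$ and the first $ln$ qubits are the output. The running time is the number of steps of the machine, which bounds the number of gates. (Since $\epsilon\le\frac1{16\sqrt m}$ gives $l/m\ge 256\,\epsilon^2 l$, the bound $e^{-c\,l/m}$ is exponentially small in $\epsilon^2 l$, hence exponentially small in $n$ when, as stabilizer money requires, $\epsilon^2 l=\Omega(n)$.) -/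

import Mathlib

open scoped ComplexOrder

noncomputable section

namespace StabilizerMoney

/-! ### Pauli operators and tensor products -/

/-- The four one-qubit Pauli operators. -/
inductive Pauli where
  | I | X | Y | Z
  deriving DecidableEq

instance : Fintype Pauli :=
  ⟨{.I, .X, .Y, .Z}, fun a => by cases a <;> decide⟩

/-- The matrix of a one-qubit Pauli operator in the computational basis. -/
def Pauli.mat : Pauli → Matrix (Fin 2) (Fin 2) ℂ
  | .I => !![1, 0; 0, 1]
  | .X => !![0, 1; 1, 0]
  | .Y => !![0, -Complex.I; Complex.I, 0]
  | .Z => !![1, 0; 0, -1]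

/-- The tensor product `A 0 ⊗ A 1 ⊗ ⋯` of square matrices indexed by `α`, as a matrix indexed by
families of basis labels. -/
def tensor {k : ℕ} {α : Type*} (A : Fin k → Matrix α α ℂ) :
    Matrix (Fin k → α) (Fin k → α) ℂ :=
  Matrix.of fun x y => ∏ i, A i (x i) (y i)

/-- Labels of the computational basis of `n` qubits. -/
abbrev Basis (n : ℕ) : Type := Fin n → Fin 2

/-- An `n`-qubit Pauli group operator `(-1)^b A₁ ⊗ ⋯ ⊗ Aₙ`, stored as the pair `(b, A)`. -/
abbrev SignedPauli (n : ℕ) : Type := Fin 2 × (Fin n → Pauli)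

/-- The operator denoted by a signed Pauli string. -/
def SignedPauli.mat {n : ℕ} (P : SignedPauli n) : Matrix (Basis n) (Basis n) ℂ :=
  (-1 : ℂ) ^ (P.1 : ℕ) • tensor fun k => (P.2 k).mat

/-! ### The bank -/

open Classical in
/-- The stabilizer group of a vector: all Pauli group operators that fix it. -/
def stabilizer {n : ℕ} (ψ : Basis n → ℂ) : Finset (SignedPauli n) :=
  Finset.univ.filter fun P => (SignedPauli.mat P).mulVec ψ = ψ

open Classical in
/-- The stabilizer groups of the `n`-qubit stabilizer states. A stabilizer state is a nonzero
vector fixed by `2 ^ n` Pauli group operators; up to a scalar it is determined by its stabilizer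
group, so that a uniformly random stabilizer state is a uniformly random element of this set. -/
def stabilizerGroups (n : ℕ) : Finset (Finset (SignedPauli n)) :=
  Finset.univ.filter fun S =>
    ∃ ψ : Basis n → ℂ, ψ ≠ 0 ∧ stabilizer ψ = S ∧ S.card = 2 ^ n

/-- The bank's table: for each of the `l` registers, `m` Pauli group operators on `n` qubits. -/
abbrev Table (n m l : ℕ) : Type := Fin l → Fin m → SignedPauli n

/-- The probability of the entry `P` in a register whose stabilizer group is `S`: with probability
`1 - ε` the entry is a uniformly random Pauli group operator, and with probability `ε` it is a
uniformly random element of `S`. -/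
def entryProb {n : ℕ} (ε : ℝ) (S : Finset (SignedPauli n)) (P : SignedPauli n) : ℝ :=
  (1 - ε) * (1 / (Fintype.card (SignedPauli n) : ℝ)) +
    ε * (if P ∈ S then 1 / (S.card : ℝ) else 0)

/-- The probability that the bank produces the table `E`. The registers are independent. In each
register the bank draws a uniformly random stabilizer state, and given that state the `m` entries
are independent. -/
def tableProb {n m l : ℕ} (ε : ℝ) (E : Table n m l) : ℝ :=
  ∏ i, (1 / ((stabilizerGroups n).card : ℝ)) *
    ∑ S ∈ stabilizerGroups n, ∏ j, entryProb ε S (E i j)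

open Classical in
/-- The probability that the bank's table lies in the set `A`. -/
def bankProb {n m l : ℕ} (ε : ℝ) (A : Set (Table n m l)) : ℝ :=
  ∑ E ∈ Finset.univ.filter (fun E => E ∈ A), tableProb ε E

/-! ### The verifier -/

/-- Labels of the computational basis of `l` registers of `n` qubits each. -/
abbrev MoneyBasis (n l : ℕ) : Type := Fin l → Basis n

/-- Density matrices. -/
def IsDensityMatrix {α : Type*} [Fintype α] (ρ : Matrix α α ℂ) : Prop :=
  ρ.PosSemidef ∧ ρ.trace = 1

/-- The operator `Q = (1/l) ∑ᵢ 1 ⊗ ⋯ ⊗ E_{i,j(i)} ⊗ ⋯ ⊗ 1` that the verifier measures. -/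
def measuredOp {n m l : ℕ} (E : Table n m l) (j : Fin l → Fin m) :
    Matrix (MoneyBasis n l) (MoneyBasis n l) ℂ :=
  (1 / (l : ℂ)) • ∑ i, tensor (Function.update (fun _ => 1) i (SignedPauli.mat (E i (j i))))

/-- The probability that measuring the Hermitian operator `Q` in the state `ρ` has an outcome of
at least `a`: the trace of `ρ` times the spectral projection of `Q` for `[a, ∞)`. -/
def probOutcomeGE {α : Type*} [Fintype α] [DecidableEq α] (Q ρ : Matrix α α ℂ) (a : ℝ) : ℝ :=
  (ρ * cfc (Set.indicator (Set.Ici a) (1 : ℝ → ℝ)) Q).trace.re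

/-- The probability that the verifier accepts `ρ`: it draws `j(i) ∈ [m]` uniformly and
independently for each register, measures `Q`, and accepts iff the outcome is at least `ε / 2`. -/
def acceptProb {n m l : ℕ} (ε : ℝ) (E : Table n m l)
    (ρ : Matrix (MoneyBasis n l) (MoneyBasis n l) ℂ) : ℝ :=
  (1 / (m : ℝ) ^ l) * ∑ j : Fin l → Fin m, probOutcomeGE (measuredOp E j) ρ (ε / 2)

/-! ### Quantum circuits -/

/-- Gates of a fixed universal set, on qubits labelled by natural numbers: Hadamard, `T` (the
`π/8` gate), controlled-not `(control, target)`, Toffoli `(control, control, target)`. -/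
inductive Gate where
  | had (q : ℕ)
  | tee (q : ℕ)
  | cnot (c t : ℕ)
  | toffoli (a b t : ℕ)

/-- Amplitudes of a state of the qubits `0, 1, 2, …` in the computational basis. -/
abbrev Amplitudes : Type := (ℕ → Fin 2) → ℂ

/-- The Hadamard matrix. -/
def hadMat : Matrix (Fin 2) (Fin 2) ℂ := ((1 / Real.sqrt 2 : ℝ) : ℂ) • !![1, 1; 1, -1]

/-- The matrix of the `T` gate. -/
def teeMat : Matrix (Fin 2) (Fin 2) ℂ := !![1, 0; 0, Complex.exp (Real.pi / 4 * Complex.I)]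

/-- A one-qubit operator applied to qubit `q`. -/
def applyOne (U : Matrix (Fin 2) (Fin 2) ℂ) (q : ℕ) (ψ : Amplitudes) : Amplitudes :=
  fun x => ∑ b, U (x q) b * ψ (Function.update x q b)

/-- The action of a gate. A controlled gate whose target is one of its controls does nothing. -/
def Gate.apply : Gate → Amplitudes → Amplitudes
  | .had q, ψ => applyOne hadMat q ψ
  | .tee q, ψ => applyOne teeMat q ψ
  | .cnot c t, ψ => if c = t then ψ else fun x => ψ (Function.update x t (x t + x c))
  | .toffoli a b t, ψ =>
      if a = t ∨ b = t then ψ else fun x => ψ (Function.update x t (x t + x a * x b))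

/-- A strict upper bound on the qubits that a gate acts on. -/
def Gate.width : Gate → ℕ
  | .had q => q + 1
  | .tee q => q + 1
  | .cnot c t => max c t + 1
  | .toffoli a b t => max (max a b) t + 1

/-- A strict upper bound on the qubits that a circuit acts on. -/
def circuitWidth (gs : List Gate) : ℕ := (gs.map Gate.width).foldr max 0

open Classical in
/-- The state after the gates of a circuit have been applied, first gate first, to `|000…⟩`. -/
def runCircuit (gs : List Gate) : Amplitudes :=
  gs.foldl (fun ψ g => g.apply ψ) fun x => if x = 0 then 1 else 0

/-- The bit string that has `x` on the first `l * n` qubits (qubit `i * n + k` is qubit `k` of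
register `i`), `z` on the next `w` qubits, and `0` beyond. -/
def assemble {n l w : ℕ} (x : MoneyBasis n l) (z : Basis w) : ℕ → Fin 2 := fun q =>
  if h : q < l * n then
    x (finProdFinEquiv.symm ⟨q, h⟩).1 (finProdFinEquiv.symm ⟨q, h⟩).2
  else if h : q - l * n < w then z ⟨q - l * n, h⟩ else 0

/-- The state of the first `l * n` qubits after the circuit has run on `|000…⟩`, that is, the
partial trace over all other qubits. (Qubits that no gate acts on stay in the state `|0⟩`.) -/
def outputState (n l : ℕ) (gs : List Gate) :
    Matrix (MoneyBasis n l) (MoneyBasis n l) ℂ :=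
  Matrix.of fun x y => ∑ z : Basis (circuitWidth gs),
    runCircuit gs (assemble x z) * starRingEnd ℂ (runCircuit gs (assemble y z))

/-! ### Uniformity: random access programs that print circuits, with a step count -/

/-- Programs of a classical random access machine that prints quantum gates. The memory cells
hold natural numbers; there is no multiplication, so that unit cost per instruction agrees with
Turing machine time up to a polynomial. -/
inductive Prog where
  /-- `mem[d] := k` -/
  | const (d k : ℕ)
  /-- `mem[d] := mem[a] + mem[b]` -/
  | add (d a b : ℕ)
  /-- `mem[d] := mem[a] - mem[b]`, truncated at `0` -/
  | sub (d a b : ℕ)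
  /-- `mem[d] := mem[mem[a]]` -/
  | load (d a : ℕ)
  /-- `mem[mem[a]] := mem[b]` -/
  | store (a b : ℕ)
  /-- `mem[d] := input[mem[a]]` -/
  | read (d a : ℕ)
  /-- print a Hadamard gate on qubit `mem[a]` -/
  | had (a : ℕ)
  /-- print a `T` gate on qubit `mem[a]` -/
  | tee (a : ℕ)
  /-- print a controlled-not gate with control `mem[a]` and target `mem[b]` -/
  | cnot (a b : ℕ)
  /-- print a Toffoli gate with controls `mem[a]`, `mem[b]` and target `mem[c]` -/
  | toffoli (a b c : ℕ)
  /-- first `P`, then `R` -/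
  | seq (P R : Prog)
  /-- if `mem[a] ≠ 0` then `P` else `R` -/
  | cond (a : ℕ) (P R : Prog)
  /-- while `mem[a] ≠ 0` do `P` -/
  | loop (a : ℕ) (P : Prog)

/-- `Exec inp P s gs t s'`: on input `inp`, the program `P` started with memory `s` halts after
exactly `t` steps with memory `s'`, having printed the gates `gs`. Each instruction and each test
is one step. -/
inductive Exec (inp : List ℕ) : Prog → (ℕ → ℕ) → List Gate → ℕ → (ℕ → ℕ) → Prop where
  | const (d k : ℕ) (s : ℕ → ℕ) :
      Exec inp (.const d k) s [] 1 (Function.update s d k)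
  | add (d a b : ℕ) (s : ℕ → ℕ) :
      Exec inp (.add d a b) s [] 1 (Function.update s d (s a + s b))
  | sub (d a b : ℕ) (s : ℕ → ℕ) :
      Exec inp (.sub d a b) s [] 1 (Function.update s d (s a - s b))
  | load (d a : ℕ) (s : ℕ → ℕ) :
      Exec inp (.load d a) s [] 1 (Function.update s d (s (s a)))
  | store (a b : ℕ) (s : ℕ → ℕ) :
      Exec inp (.store a b) s [] 1 (Function.update s (s a) (s b))
  | read (d a : ℕ) (s : ℕ → ℕ) :
      Exec inp (.read d a) s [] 1 (Function.update s d (inp.getD (s a) 0))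
  | had (a : ℕ) (s : ℕ → ℕ) :
      Exec inp (.had a) s [Gate.had (s a)] 1 s
  | tee (a : ℕ) (s : ℕ → ℕ) :
      Exec inp (.tee a) s [Gate.tee (s a)] 1 s
  | cnot (a b : ℕ) (s : ℕ → ℕ) :
      Exec inp (.cnot a b) s [Gate.cnot (s a) (s b)] 1 s
  | toffoli (a b c : ℕ) (s : ℕ → ℕ) :
      Exec inp (.toffoli a b c) s [Gate.toffoli (s a) (s b) (s c)] 1 s
  | seq {P R : Prog} {s s₁ s₂ : ℕ → ℕ} {g₁ g₂ : List Gate} {t₁ t₂ : ℕ} :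
      Exec inp P s g₁ t₁ s₁ → Exec inp R s₁ g₂ t₂ s₂ →
      Exec inp (.seq P R) s (g₁ ++ g₂) (t₁ + t₂) s₂
  | cond_true {a : ℕ} {P R : Prog} {s s₁ : ℕ → ℕ} {g : List Gate} {t : ℕ} :
      s a ≠ 0 → Exec inp P s g t s₁ → Exec inp (.cond a P R) s g (t + 1) s₁
  | cond_false {a : ℕ} {P R : Prog} {s s₁ : ℕ → ℕ} {g : List Gate} {t : ℕ} :
      s a = 0 → Exec inp R s g t s₁ → Exec inp (.cond a P R) s g (t + 1) s₁
  | loop_done {a : ℕ} {P : Prog} {s : ℕ → ℕ} :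
      s a = 0 → Exec inp (.loop a P) s [] 1 s
  | loop_step {a : ℕ} {P : Prog} {s s₁ s₂ : ℕ → ℕ} {g₁ g₂ : List Gate} {t₁ t₂ : ℕ} :
      s a ≠ 0 → Exec inp P s g₁ t₁ s₁ → Exec inp (.loop a P) s₁ g₂ t₂ s₂ →
      Exec inp (.loop a P) s (g₁ ++ g₂) (t₁ + t₂ + 1) s₂

/-- A number for each one-qubit Pauli operator. -/
def Pauli.code : Pauli → ℕ
  | .I => 0
  | .X => 1
  | .Y => 2
  | .Z => 3

/-- The classical input of the forger: `n`, `m`, `l`, and then the entries of the table row by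
row, each as its sign bit followed by the codes of its `n` tensor factors. -/
def encodeTable {n m l : ℕ} (E : Table n m l) : List ℕ :=
  [n, m, l] ++ (List.ofFn fun i : Fin l => (List.ofFn fun j : Fin m =>
    ((E i j).1 : ℕ) :: List.ofFn fun k : Fin n => ((E i j).2 k).code).flatten).flatten

/-- On the table `E` the quantum algorithm given by the program `P` outputs the state `ρ` within
`T` steps: from `E` (and memory filled with zeros) the program prints within `T` steps a circuit,
and this circuit, run on `|000…⟩`, leaves the money registers in the state `ρ`. -/
def Generates {n m l : ℕ} (P : Prog) (E : Table n m l)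
    (ρ : Matrix (MoneyBasis n l) (MoneyBasis n l) ℂ) (T : ℕ) : Prop :=
  ∃ (gs : List Gate) (t : ℕ) (s : ℕ → ℕ),
    Exec (encodeTable E) P (fun _ => 0) gs t s ∧ t ≤ T ∧ outputState n l gs = ρ

end StabilizerMoney

end

open scoped ComplexOrder

noncomputable section

namespace StabilizerMoney

/-! ### Tensor products of matrices -/

section TensorProduct

variable {k : ℕ} {α : Type*}

/-! The hidden stabilizer states need not be found: a state that depends only on the public row
already passes when ε ≤ 1/(16√m). For one register let H (`rowSum`) be the sum of the m entries of
its row. If the row has no coincidences (`GoodRow`), a product of two or four entries has nonzero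
trace only when the factors cancel in pairs. Hence tr H² = m·2^n and |tr H⁴| ≤ 3m²·2^n, so in
quadratic mean the eigenvalues of H have size √m. A state biased towards the positive ones gives a
random entry an expectation of order 1/√m.

Such a state is ρ = 2^{-n}(c + ½ T_k(H/M)), where T_k is a Chebyshev polynomial, M = 4^t is the
least power of 4 with m ≤ M, and k = 4⌊√M/8⌋ + 1. For k ≡ 1 mod 4 the inequality x T_k(x) ≥ k x² −
(k³−k)x⁴/6 holds on the whole line (`chebyshev_ge`). The two moments then yield an average
expectation of at least 1/(16√m) (`walk_bound`, `GoodRow.le_rowMean`).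

The state ρ is prepared without postselection. Let u be the uniform superposition of an index that
selects an involution: the negative transpose of an entry, or a phase that averages to zero when the
selected leaf has no entry. Let S apply the selected involution and let R = 1 − 2|u⟩⟨u|. Then the
block ⟨u|(RS)^k|u⟩ is T_k of the transpose of H/M (`average_walk`, `neg_average_walkMat`). A
Hadamard test of (RS)^k on one half of maximally entangled pairs leaves a state proportional to 1 +
T_k(H/M) on the other half when it succeeds. When it fails, the output is replaced by the maximally
mixed state. The mixture of the two cases is ρ (`outputDensity_lrun_finalGates`).

On a product state the verifier sees independent signs whose means are the row means, and a Chernoff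
bound applies (`acceptProb_tensor`, `one_sub_exp_le_sum_outcome`). Of the bank's distribution only
the size 2^n of a stabilizer group matters. An entry has a prescribed bit vector with probability at
most 2/2^n, so a row is bad with probability at most (m + m⁴)·2/2^n. By Markov's inequality the
fraction of bad rows is at most 1/(128√m), except with exponentially small probability
(`one_sub_le_bankProb`, `exists_le_mul_exp`), and so few bad rows do not spoil the Chernoff bound.

Uniformity is shown by a small program logic (`Spec`) that tracks the printed gates, the running
time and the memory. It leads to `spec_forgeProg`, with a time bound of degree four. -/

theorem tensor_mul [Fintype α] (A B : Fin k → Matrix α α ℂ) :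
    tensor A * tensor B = tensor fun i => A i * B i := by
  classical
  ext x y
  simp only [tensor, Matrix.mul_apply, Matrix.of_apply, Finset.prod_univ_sum,
    Fintype.piFinset_univ, Finset.prod_mul_distrib]

theorem trace_tensor [Fintype α] (A : Fin k → Matrix α α ℂ) :
    (tensor A).trace = ∏ i, (A i).trace := by
  classical
  simp only [tensor, Matrix.trace, Matrix.diag, Matrix.of_apply, Finset.prod_univ_sum,
    Fintype.piFinset_univ]

theorem tensor_one [DecidableEq α] : tensor (fun _ : Fin k => (1 : Matrix α α ℂ)) = 1 := by
  ext x y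
  simp only [tensor, Matrix.of_apply, Matrix.one_apply, Finset.prod_ite_zero, Finset.prod_const_one,
    funext_iff, Finset.mem_univ, true_implies]

theorem tensor_smul (c : Fin k → ℂ) (A : Fin k → Matrix α α ℂ) :
    tensor (fun i => c i • A i) = (∏ i, c i) • tensor A := by
  ext x y
  simp [tensor, Finset.prod_mul_distrib]

theorem sum_tensor {β : Type*} [Fintype β] (A : Fin k → β → Matrix α α ℂ) :
    ∑ s : Fin k → β, tensor (fun i => A i (s i)) = tensor fun i => ∑ b, A i b := by
  classical
  ext x y
  simp only [tensor, Matrix.sum_apply, Matrix.of_apply, Finset.prod_univ_sum,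
    Fintype.piFinset_univ]

theorem conjTranspose_tensor (A : Fin k → Matrix α α ℂ) :
    (tensor A).conjTranspose = tensor fun i => (A i).conjTranspose := by
  ext x y
  simp [tensor, Matrix.conjTranspose_apply]

end TensorProduct

/-! ### The distribution of the verifier's measurement -/

section Acceptance

theorem aeval_mul_of_mul_eq_smul {α : Type*} [Fintype α] [DecidableEq α]
    {Q P : Matrix α α ℂ} {q : ℝ} (h : Q * P = (q : ℂ) • P) (p : Polynomial ℝ) :
    Polynomial.aeval Q p * P = ((p.eval q : ℝ) : ℂ) • P := by
  induction p using Polynomial.induction_on' with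
  | add p r hp hr => simp [add_mul, hp, hr, add_smul]
  | monomial k a =>
    have hk : Q ^ k * P = (q : ℂ) ^ k • P := by
      induction k with
      | zero => simp
      | succ k ih => rw [pow_succ, mul_assoc, h, mul_smul_comm, ih, smul_smul]; ring_nf
    rw [Polynomial.aeval_monomial, mul_assoc, hk, Polynomial.eval_monomial]
    ext x y
    simp [Algebra.algebraMap_eq_smul_one, Matrix.smul_apply, Complex.real_smul]
    ring

/-- A Hermitian matrix has finite spectrum, so `cfc f Q` is a polynomial in Q even for discontinuous
f, such as the indicator function of a half-line. -/
theorem cfc_mul_of_mul_eq_smul {α β : Type*} [Fintype α] [DecidableEq α] [Fintype β]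
    {Q : Matrix α α ℂ} (hQ : Q.IsHermitian) (P : β → Matrix α α ℂ) (q : β → ℝ)
    (h : ∀ b, Q * P b = (q b : ℂ) • P b) (f : ℝ → ℝ) (b : β) :
    cfc f Q * P b = ((f (q b) : ℝ) : ℂ) • P b := by
  classical
  -- The values `q b` are added to the nodes because `P b` may vanish, and then `q b` need not lie
  -- in the spectrum.
  let S : Finset ℝ := (Matrix.finite_real_spectrum (A := Q)).toFinset ∪ Finset.univ.image q
  let p : Polynomial ℝ := Lagrange.interpolate S id f
  have hp : ∀ x ∈ S, p.eval x = f x := fun x hx =>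
    Lagrange.eval_interpolate_at_node (v := id) f (Set.injOn_id _) hx
  have hc : cfc f Q = Polynomial.aeval Q p := by
    rw [← cfc_polynomial p Q hQ.isSelfAdjoint]
    refine cfc_congr fun x hx => (hp x ?_).symm
    simp [S, hx]
  rw [hc, aeval_mul_of_mul_eq_smul (h b) p, hp]
  simp [S]

/-- The spectral projection of an involution for the eigenvalue `(-1)^b`. -/
def signProj {α : Type*} [DecidableEq α] (A : Matrix α α ℂ) (σ : ℝ) : Matrix α α ℂ :=
  (1 / 2 : ℂ) • (1 + (σ : ℂ) • A)

/-- The two possible outcomes of the measurement of an involution. -/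
def outcome (b : Bool) : ℝ := if b then 1 else -1

theorem outcome_mul_self (b : Bool) : outcome b * outcome b = 1 := by
  cases b <;> simp [outcome]

theorem mul_signProj {α : Type*} [Fintype α] [DecidableEq α] {A : Matrix α α ℂ} (hA : A * A = 1)
    (b : Bool) : A * signProj A (outcome b) = (outcome b : ℂ) • signProj A (outcome b) := by
  cases b <;> simp [signProj, outcome, mul_add, hA, add_comm]

theorem sum_signProj {α : Type*} [DecidableEq α] (A : Matrix α α ℂ) :
    ∑ b, signProj A (outcome b) = 1 := by
  simp only [signProj, outcome, Fintype.sum_bool]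
  ext x y
  simp
  ring

variable {l : ℕ} {α : Type*} [Fintype α] [DecidableEq α]

/-- Involutions on different tensor factors commute, and the products of their sign projections
resolve the identity into eigenspaces of the averaged operator, with the mean of the signs as
eigenvalue. On a product state the signs are therefore independent. -/
theorem trace_tensor_mul_cfc (A ρ : Fin l → Matrix α α ℂ) (hA : ∀ i, A i * A i = 1)
    (hH : ∀ i, (A i).IsHermitian) (f : ℝ → ℝ) :
    (tensor ρ * cfc f ((1 / (l : ℂ)) • ∑ i, tensor (Function.update (fun _ => 1) i (A i)))).trace =
      ∑ s : Fin l → Bool, (f ((1 / l) * ∑ i, outcome (s i)) : ℂ) *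
        ∏ i, (ρ i * signProj (A i) (outcome (s i))).trace := by
  set Q := (1 / (l : ℂ)) • ∑ i, tensor (Function.update (fun _ => 1) i (A i)) with hQ
  let P : (Fin l → Bool) → Matrix (Fin l → α) (Fin l → α) ℂ :=
    fun s => tensor fun i => signProj (A i) (outcome (s i))
  have hterm : ∀ i s, tensor (Function.update (fun _ => 1) i (A i)) * P s =
      (outcome (s i) : ℂ) • P s := by
    intro i s
    simp only [P]
    rw [tensor_mul]
    have : (fun i' => Function.update (fun _ => (1 : Matrix α α ℂ)) i (A i) i' *
        signProj (A i') (outcome (s i'))) = fun i' => (if i' = i then (outcome (s i) : ℂ) else 1) •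
          signProj (A i') (outcome (s i')) := by
      funext i'
      by_cases h : i' = i
      · subst h; simp [mul_signProj (hA i')]
      · simp [h]
    rw [this, tensor_smul]
    simp
  have hQP : ∀ s, Q * P s = (((1 / l) * ∑ i, outcome (s i) : ℝ) : ℂ) • P s := by
    intro s
    rw [hQ, smul_mul_assoc, Finset.sum_mul]
    simp only [hterm, ← Finset.sum_smul, smul_smul]
    push_cast
    rfl
  have hherm : Q.IsHermitian := by
    rw [Matrix.IsHermitian, hQ, Matrix.conjTranspose_smul, Matrix.conjTranspose_sum]
    simp only [conjTranspose_tensor]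
    congr 1
    · simp
    · refine Finset.sum_congr rfl fun i _ => ?_
      congr 1
      funext i'
      by_cases h : i' = i
      · subst h; simpa using (hH i').eq
      · simp [h]
  have hone : ∑ s, P s = 1 := by
    simp only [P]
    rw [sum_tensor (fun i b => signProj (A i) (outcome b))]
    simp only [sum_signProj, tensor_one]
  calc (tensor ρ * cfc f Q).trace = (tensor ρ * (cfc f Q * ∑ s, P s)).trace := by
        rw [hone, mul_one]
    _ = _ := by
      rw [Finset.mul_sum, Finset.mul_sum, Matrix.trace_sum]
      refine Finset.sum_congr rfl fun s _ => ?_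
      rw [cfc_mul_of_mul_eq_smul hherm P _ hQP f s, mul_smul_comm, Matrix.trace_smul, smul_eq_mul]
      simp only [P]
      rw [tensor_mul, trace_tensor]

/-- The expectation of a measurement of `A` in the state `ρ`. -/
def expectation (ρ A : Matrix α α ℂ) : ℝ := (ρ * A).trace.re

omit [DecidableEq α] in
theorem trace_mul_eq_expectation {ρ A : Matrix α α ℂ} (hρ : ρ.IsHermitian) (hA : A.IsHermitian) :
    (ρ * A).trace = expectation ρ A := by
  have h : starRingEnd ℂ (ρ * A).trace = (ρ * A).trace := by
    have := Matrix.trace_conjTranspose (ρ * A)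
    rw [Matrix.conjTranspose_mul, hρ.eq, hA.eq, Matrix.trace_mul_comm] at this
    exact this.symm
  exact (Complex.conj_eq_iff_re.1 h).symm

theorem trace_mul_signProj {ρ A : Matrix α α ℂ} (hρ : IsDensityMatrix ρ) (hA : A.IsHermitian)
    (σ : ℝ) : (ρ * signProj A σ).trace = ((1 + σ * expectation ρ A) / 2 : ℝ) := by
  rw [signProj, mul_smul_comm, mul_add, mul_one, mul_smul_comm, Matrix.trace_smul,
    Matrix.trace_add, Matrix.trace_smul, hρ.2, trace_mul_eq_expectation hρ.1.1 hA]
  push_cast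
  simp only [smul_eq_mul]
  ring

/-- Both weights (1 ± expectation)/2 are traces of ρ compressed by a projection, hence nonnegative.
-/
theorem abs_expectation_le_one {ρ A : Matrix α α ℂ} (hρ : IsDensityMatrix ρ)
    (hA : A.IsHermitian) (hA2 : A * A = 1) : |expectation ρ A| ≤ 1 := by
  have key : ∀ b : Bool, 0 ≤ (1 + outcome b * expectation ρ A) / 2 := by
    intro b
    have hh : (signProj A (outcome b)).IsHermitian := by
      rw [Matrix.IsHermitian, signProj]
      simp [hA.eq]
    have hp : signProj A (outcome b) * signProj A (outcome b) = signProj A (outcome b) := by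
      conv_lhs => enter [1]; rw [signProj]
      rw [smul_mul_assoc, add_mul, one_mul, smul_mul_assoc, mul_signProj hA2, smul_smul,
        ← Complex.ofReal_mul, outcome_mul_self]
      ext x y
      simp
      ring
    have h1 := (hρ.1.conjTranspose_mul_mul_same (signProj A (outcome b))).trace_nonneg
    rw [hh.eq, Matrix.trace_mul_comm, ← mul_assoc, hp, Matrix.trace_mul_comm,
      trace_mul_signProj hρ hA] at h1
    exact_mod_cast h1
  have h0 := key true
  have h1 := key false
  simp only [outcome] at h0 h1
  rw [abs_le]
  constructor <;> simp at h0 h1 <;> linarith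

end Acceptance

/-! ### Pauli group operators -/

theorem Pauli.mat_mul_self (a : Pauli) : a.mat * a.mat = 1 := by
  cases a <;> ext i j <;> fin_cases i <;> fin_cases j <;> simp [Pauli.mat]

theorem Pauli.mat_isHermitian (a : Pauli) : a.mat.IsHermitian := by
  cases a <;> ext i j <;> fin_cases i <;> fin_cases j <;>
    simp [Pauli.mat, Matrix.conjTranspose_apply]

theorem SignedPauli.mat_mul_self {n : ℕ} (P : SignedPauli n) :
    SignedPauli.mat P * SignedPauli.mat P = 1 := by
  rw [SignedPauli.mat, smul_mul_smul_comm, tensor_mul, ← mul_pow]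
  simp [Pauli.mat_mul_self, tensor_one]

theorem SignedPauli.mat_isHermitian {n : ℕ} (P : SignedPauli n) :
    (SignedPauli.mat P).IsHermitian := by
  rw [Matrix.IsHermitian, SignedPauli.mat, Matrix.conjTranspose_smul, conjTranspose_tensor]
  simp [(Pauli.mat_isHermitian _).eq]

/-! ### A Chernoff bound for the acceptance probability -/

theorem exp_le_one_add_add_sq {x : ℝ} (h : |x| ≤ 1) : Real.exp x ≤ 1 + x + x ^ 2 := by
  have := Real.abs_exp_sub_one_sub_id_le h
  rw [abs_le] at this
  linarith [this.2]

/-- The moment generating function of a sign with mean μ. Bounding e^{±t} by 1 ± t + t² gives 1 − tμ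
+ t², which is at most the exponential on the right. -/
theorem sum_outcome_weight_mul_exp_le {μ t : ℝ} (hμ : |μ| ≤ 1) (ht : |t| ≤ 1) :
    ∑ b, (1 + outcome b * μ) / 2 * Real.exp (-t * outcome b) ≤ Real.exp (-t * μ + t ^ 2) := by
  have h1 := exp_le_one_add_add_sq ht
  have h2 := exp_le_one_add_add_sq (x := -t) (by rwa [abs_neg])
  have h3 := Real.add_one_le_exp (-t * μ + t ^ 2)
  rw [abs_le] at hμ
  simp only [Fintype.sum_bool, outcome, if_true, Bool.false_eq_true, if_false]
  rw [show -t * (1 : ℝ) = -t by ring, show -t * (-1 : ℝ) = t by ring]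
  nlinarith [mul_le_mul_of_nonneg_left h1 (by linarith : 0 ≤ (1 - μ) / 2),
    mul_le_mul_of_nonneg_left h2 (by linarith : 0 ≤ (1 + μ) / 2)]

/-- Chernoff bound for independent signs that need not be identically distributed. Only the sum of
their means enters, so a few rows with bad means can be tolerated. -/
theorem one_sub_exp_le_sum_outcome {l : ℕ} (hl : 0 < l) (μ : Fin l → ℝ) (hμ : ∀ i, |μ i| ≤ 1)
    {t a : ℝ} (ht0 : 0 ≤ t) (ht : t ≤ 1) :
    1 - Real.exp (t * (l * a - ∑ i, μ i) + l * t ^ 2) ≤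
      ∑ s : Fin l → Bool, Set.indicator (Set.Ici a) (1 : ℝ → ℝ) ((1 / l) * ∑ i, outcome (s i)) *
        ∏ i, (1 + outcome (s i) * μ i) / 2 := by
  have hl' : (0 : ℝ) < l := by exact_mod_cast hl
  have hw : ∀ s : Fin l → Bool, 0 ≤ ∏ i, (1 + outcome (s i) * μ i) / 2 := by
    refine fun s => Finset.prod_nonneg fun i _ => ?_
    have := abs_le.1 (hμ i)
    unfold outcome
    split_ifs <;> linarith
  have hsum : ∑ s : Fin l → Bool, ∏ i, (1 + outcome (s i) * μ i) / 2 = 1 := by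
    have := Finset.prod_univ_sum (fun _ : Fin l => (Finset.univ : Finset Bool))
      fun i b => (1 + outcome b * μ i) / 2
    rw [Fintype.piFinset_univ] at this
    rw [← this]
    refine Finset.prod_eq_one fun i _ => ?_
    simp [outcome]
    ring
  have hexp : ∑ s : Fin l → Bool, Real.exp (t * (l * a - ∑ i, outcome (s i))) *
      ∏ i, (1 + outcome (s i) * μ i) / 2 ≤
        Real.exp (t * (l * a - ∑ i, μ i) + l * t ^ 2) := by
    have h1 : ∀ s : Fin l → Bool, Real.exp (t * (l * a - ∑ i, outcome (s i))) *
        ∏ i, (1 + outcome (s i) * μ i) / 2 = Real.exp (t * (l * a)) *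
          ∏ i, ((1 + outcome (s i) * μ i) / 2 * Real.exp (-t * outcome (s i))) := by
      intro s
      rw [Finset.prod_mul_distrib, ← Real.exp_sum, ← Finset.mul_sum, mul_sub, sub_eq_add_neg,
        Real.exp_add, neg_mul]
      ring
    have h2 := Finset.prod_univ_sum (fun _ : Fin l => (Finset.univ : Finset Bool))
      fun i b => (1 + outcome b * μ i) / 2 * Real.exp (-t * outcome b)
    rw [Fintype.piFinset_univ] at h2
    rw [Finset.sum_congr rfl fun s _ => h1 s, ← Finset.mul_sum, ← h2]
    have h3 : ∏ i, ∑ b, (1 + outcome b * μ i) / 2 * Real.exp (-t * outcome b) ≤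
        ∏ i : Fin l, Real.exp (-t * μ i + t ^ 2) := by
      refine Finset.prod_le_prod (fun i _ => Finset.sum_nonneg fun b _ => ?_) fun i _ =>
        sum_outcome_weight_mul_exp_le (hμ i) (by rwa [abs_of_nonneg ht0])
      have := abs_le.1 (hμ i)
      refine mul_nonneg ?_ (Real.exp_pos _).le
      unfold outcome
      split_ifs <;> linarith
    refine (mul_le_mul_of_nonneg_left h3 (Real.exp_pos _).le).trans_eq ?_
    rw [← Real.exp_sum, ← Real.exp_add, Finset.sum_add_distrib, ← Finset.mul_sum]
    congr 1
    simp
    ring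
  -- Exponential Markov inequality in pointwise form: below the threshold the exponential is at
  -- least 1, and above it the indicator function is 1.
  have hpt : ∀ s : Fin l → Bool, 1 - Real.exp (t * (l * a - ∑ i, outcome (s i))) ≤
      Set.indicator (Set.Ici a) (1 : ℝ → ℝ) ((1 / l) * ∑ i, outcome (s i)) := by
    intro s
    by_cases h : a ≤ (1 / l) * ∑ i, outcome (s i)
    · rw [Set.indicator_of_mem (Set.mem_Ici.2 h)]
      simp [(Real.exp_pos _).le]
    · rw [Set.indicator_of_notMem (by simpa using h)]
      rw [not_le, one_div, inv_mul_lt_iff₀ hl'] at h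
      have := Real.one_le_exp (mul_nonneg ht0 (by linarith : 0 ≤ l * a - ∑ i, outcome (s i)))
      linarith
  calc _ ≤ ∑ s : Fin l → Bool, (1 - Real.exp (t * (l * a - ∑ i, outcome (s i)))) *
        ∏ i, (1 + outcome (s i) * μ i) / 2 := by
        simp only [sub_mul, one_mul, Finset.sum_sub_distrib, hsum]
        linarith
    _ ≤ _ := Finset.sum_le_sum fun s _ => mul_le_mul_of_nonneg_right (hpt s) (hw s)

/-- The expectation of a uniformly random operator of a row of the table. -/
def rowMean {n m : ℕ} (ρ : Matrix (Basis n) (Basis n) ℂ) (e : Fin m → SignedPauli n) : ℝ :=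
  (1 / (m : ℝ)) * ∑ j, expectation ρ (SignedPauli.mat (e j))

theorem abs_rowMean_le_one {n m : ℕ} {ρ : Matrix (Basis n) (Basis n) ℂ} (hρ : IsDensityMatrix ρ)
    (e : Fin m → SignedPauli n) : |rowMean ρ e| ≤ 1 := by
  rw [rowMean, abs_mul, abs_of_nonneg (by positivity : 0 ≤ 1 / (m : ℝ))]
  have h : |∑ j, expectation ρ (SignedPauli.mat (e j))| ≤ m := by
    refine (Finset.abs_sum_le_sum_abs _ _).trans ?_
    refine (Finset.sum_le_sum fun j _ => abs_expectation_le_one hρ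
      (SignedPauli.mat_isHermitian (e j)) (SignedPauli.mat_mul_self _)).trans ?_
    simp
  rw [one_div, ← div_eq_inv_mul]
  exact div_le_one_of_le₀ h (by positivity)

/-- The weight of a sign is affine in the expectation and the j(i) are independent, so averaging
over the verifier's choices merely replaces each expectation by the mean over its row. -/
theorem acceptProb_tensor {n m l : ℕ} (hm : 0 < m) (ε : ℝ) (E : Table n m l)
    (ρ : Fin l → Matrix (Basis n) (Basis n) ℂ) (hρ : ∀ i, IsDensityMatrix (ρ i)) :
    acceptProb ε E (tensor ρ) = ∑ s : Fin l → Bool,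
      Set.indicator (Set.Ici (ε / 2)) (1 : ℝ → ℝ) ((1 / l) * ∑ i, outcome (s i)) *
        ∏ i, (1 + outcome (s i) * rowMean (ρ i) (E i)) / 2 := by
  have hm' : (m : ℝ) ≠ 0 := by exact_mod_cast hm.ne'
  have h1 : ∀ j : Fin l → Fin m, probOutcomeGE (measuredOp E j) (tensor ρ) (ε / 2) =
      ∑ s : Fin l → Bool,
      Set.indicator (Set.Ici (ε / 2)) (1 : ℝ → ℝ) ((1 / l) * ∑ i, outcome (s i)) *
        ∏ i, (1 + outcome (s i) * expectation (ρ i) (SignedPauli.mat (E i (j i)))) / 2 := by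
    intro j
    rw [probOutcomeGE, measuredOp, trace_tensor_mul_cfc _ _
      (fun i => SignedPauli.mat_mul_self _) (fun i => SignedPauli.mat_isHermitian _)]
    simp only [trace_mul_signProj (hρ _) (SignedPauli.mat_isHermitian _)]
    simp only [← Complex.ofReal_prod, ← Complex.ofReal_mul, ← Complex.ofReal_sum]
    exact Complex.ofReal_re _
  simp only [acceptProb, h1]
  rw [Finset.sum_comm, Finset.mul_sum]
  refine Finset.sum_congr rfl fun s _ => ?_
  rw [← Finset.mul_sum, mul_left_comm]
  congr 1
  have h2 := Finset.prod_univ_sum (fun _ : Fin l => (Finset.univ : Finset (Fin m)))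
    fun i b => (1 + outcome (s i) * expectation (ρ i) (SignedPauli.mat (E i b))) / 2
  rw [Fintype.piFinset_univ] at h2
  rw [← h2]
  have h3 : (1 / (m : ℝ) ^ l) = ∏ _i : Fin l, (1 / (m : ℝ)) := by simp
  rw [h3, ← Finset.prod_mul_distrib]
  refine Finset.prod_congr rfl fun i _ => ?_
  rw [rowMean, ← Finset.sum_div, Finset.sum_add_distrib, ← Finset.mul_sum]
  simp
  field_simp

theorem one_sub_exp_le_acceptProb {n m l : ℕ} (hm : 0 < m) (hl : 0 < l) (ε : ℝ) (E : Table n m l)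
    (ρ : Fin l → Matrix (Basis n) (Basis n) ℂ) (hρ : ∀ i, IsDensityMatrix (ρ i))
    {t : ℝ} (ht0 : 0 ≤ t) (ht : t ≤ 1) :
    1 - Real.exp (t * (l * (ε / 2) - ∑ i, rowMean (ρ i) (E i)) + l * t ^ 2) ≤
      acceptProb ε E (tensor ρ) := by
  rw [acceptProb_tensor hm ε E ρ hρ]
  exact one_sub_exp_le_sum_outcome hl _ (fun i => abs_rowMean_le_one (hρ i) _) ht0 ht

/-! ### Families of independent random variables with finitely many values -/

section Product

variable {k : ℕ} {β : Type*} [Fintype β]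

theorem sum_prod_apply (g : Fin k → β → ℝ) :
    ∑ e : Fin k → β, ∏ j, g j (e j) = ∏ j, ∑ b, g j b := by
  have := Finset.prod_univ_sum (fun _ : Fin k => (Finset.univ : Finset β)) g
  rw [Fintype.piFinset_univ] at this
  exact this.symm

theorem sum_prod_mul_apply {p : β → ℝ} (hp : ∑ b, p b = 1) (f : β → ℝ) (i : Fin k) :
    ∑ e : Fin k → β, (∏ j, p (e j)) * f (e i) = ∑ b, p b * f b := by
  have h : ∀ e : Fin k → β, (∏ j, p (e j)) * f (e i) =
      ∏ j, p (e j) * (if j = i then f (e j) else 1) := by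
    intro e
    rw [Finset.prod_mul_distrib]
    simp
  simp only [h]
  rw [sum_prod_apply fun j b => p b * (if j = i then f b else 1),
    Finset.prod_eq_single_of_mem i (Finset.mem_univ i)]
  · simp
  · intro j _ hj
    simp [hj, hp]

/-- Since F ignores coordinate i, freezing the other coordinates turns F into a fixed target, which
the remaining coordinate hits with probability at most δ. -/
theorem sum_prod_ite_eq_le {V : Type*} [DecidableEq V] {p : β → ℝ} (hp0 : ∀ b, 0 ≤ p b)
    (hp : ∑ b, p b = 1) (X : β → V) {δ : ℝ} (hδ : ∀ t, ∑ b, (if X b = t then p b else 0) ≤ δ)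
    (i : Fin k) (F : (Fin k → β) → V)
    (hF : ∀ e b, F (Function.update e i b) = F e) :
    ∑ e : Fin k → β, (if X (e i) = F e then ∏ j, p (e j) else 0) ≤ δ := by
  classical
  let f := (Equiv.funSplitAt i β).symm
  have hfi : ∀ b r, f (b, r) i = b := fun b r => by simp [f]
  have hfj : ∀ b r j (h : j ≠ i), f (b, r) j = r ⟨j, h⟩ := fun b r j h => by simp [f, h]
  have hFf : ∀ b b' r, F (f (b, r)) = F (f (b', r)) := by
    intro b b' r
    rw [← hF (f (b', r)) b]
    congr 1
    funext j
    by_cases h : j = i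
    · subst h; simp [hfi]
    · simp [h, hfj]
  have hprod : ∀ b r, ∏ j, p (f (b, r) j) = p b * ∏ j : {j // j ≠ i}, p (r j) := by
    intro b r
    rw [← Finset.mul_prod_erase _ _ (Finset.mem_univ i), hfi]
    congr 1
    rw [Finset.prod_subtype (Finset.univ.erase i) (p := fun j => j ≠ i) (by simp)]
    exact Finset.prod_congr rfl fun j _ => by rw [hfj b r j j.2]
  rw [← Equiv.sum_comp f, Fintype.sum_prod_type_right]
  by_cases hβ : Nonempty β
  · obtain ⟨b₀⟩ := hβ
    have hsum : ∑ r : {j // j ≠ i} → β, ∏ j, p (r j) = 1 := by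
      have := Finset.prod_univ_sum (fun _ : {j // j ≠ i} => (Finset.univ : Finset β))
        fun _ => p
      rw [Fintype.piFinset_univ] at this
      rw [← this]
      simp [hp]
    calc _ ≤ ∑ r : {j // j ≠ i} → β, δ * ∏ j, p (r j) := by
          refine Finset.sum_le_sum fun r _ => ?_
          have : ∀ b, (if X (f (b, r) i) = F (f (b, r)) then ∏ j, p (f (b, r) j) else 0) =
              (if X b = F (f (b₀, r)) then p b else 0) * ∏ j, p (r j) := by
            intro b
            rw [hfi, hFf b b₀, hprod, ite_mul, zero_mul]
          rw [Finset.sum_congr rfl fun b _ => this b, ← Finset.sum_mul]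
          exact mul_le_mul_of_nonneg_right (hδ _) (Finset.prod_nonneg fun j _ => hp0 _)
      _ = δ := by rw [← Finset.mul_sum, hsum, mul_one]
  · rw [not_nonempty_iff] at hβ
    simp at hp

end Product

/-! ### Good rows of the table -/

/-- A one-qubit Pauli operator, up to a phase, as a vector over the field with two elements. -/
def Pauli.bits : Pauli → ZMod 2 × ZMod 2
  | .I => (0, 0)
  | .X => (1, 0)
  | .Y => (1, 1)
  | .Z => (0, 1)

theorem Pauli.bits_injective : Function.Injective Pauli.bits := by
  intro a b; cases a <;> cases b <;> decide

/-- A Pauli group operator, up to a phase, as a vector over the field with two elements. -/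
def SignedPauli.bits {n : ℕ} (P : SignedPauli n) : Fin n → ZMod 2 × ZMod 2 :=
  fun k => (P.2 k).bits

/-- A row of the table without coincidences: no entry is trivial, and none is, up to a phase, a
product of three of the other entries. -/
def GoodRow {n m : ℕ} (e : Fin m → SignedPauli n) : Prop :=
  (∀ j, SignedPauli.bits (e j) ≠ 0) ∧
    ∀ i : Fin m × Fin m × Fin m × Fin m, i.1 ≠ i.2.1 → i.1 ≠ i.2.2.1 → i.1 ≠ i.2.2.2 →
      SignedPauli.bits (e i.1) ≠ SignedPauli.bits (e i.2.1) + SignedPauli.bits (e i.2.2.1) +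
        SignedPauli.bits (e i.2.2.2)

open Classical in
/-- The indicator function of the rows with a coincidence. -/
def badRow {n m : ℕ} (e : Fin m → SignedPauli n) : ℝ := if GoodRow e then 0 else 1

/-- The union bound in pointwise form: at most m events of the first kind and m⁴ of the second. The
three indices on the right of a coincidence may agree with one another. -/
theorem badRow_le {n m : ℕ} (e : Fin m → SignedPauli n) :
    badRow e ≤ ∑ j, (if SignedPauli.bits (e j) = 0 then 1 else 0) +
      ∑ i : Fin m × Fin m × Fin m × Fin m,
        if i.1 ≠ i.2.1 ∧ i.1 ≠ i.2.2.1 ∧ i.1 ≠ i.2.2.2 then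
          if SignedPauli.bits (e i.1) = SignedPauli.bits (e i.2.1) + SignedPauli.bits (e i.2.2.1) +
            SignedPauli.bits (e i.2.2.2) then 1 else 0
        else 0 := by
  have h1 : ∀ j ∈ Finset.univ, (0 : ℝ) ≤ if SignedPauli.bits (e j) = 0 then 1 else 0 := by
    intro j _; split_ifs <;> simp
  have h2 : ∀ i ∈ (Finset.univ : Finset (Fin m × Fin m × Fin m × Fin m)),
      (0 : ℝ) ≤ if i.1 ≠ i.2.1 ∧ i.1 ≠ i.2.2.1 ∧ i.1 ≠ i.2.2.2 then
          if SignedPauli.bits (e i.1) = SignedPauli.bits (e i.2.1) + SignedPauli.bits (e i.2.2.1) +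
            SignedPauli.bits (e i.2.2.2) then 1 else 0
        else 0 := by
    intro i _; split_ifs <;> simp
  unfold badRow
  split_ifs with h
  · exact add_nonneg (Finset.sum_nonneg h1) (Finset.sum_nonneg h2)
  · rw [GoodRow, not_and_or] at h
    rcases h with h | h
    · push Not at h
      obtain ⟨j, hj⟩ := h
      have := Finset.single_le_sum h1 (Finset.mem_univ j)
      rw [if_pos hj] at this
      linarith [Finset.sum_nonneg h2]
    · push Not at h
      obtain ⟨i, hi1, hi2, hi3, hi⟩ := h
      have := Finset.single_le_sum h2 (Finset.mem_univ i)
      rw [if_pos ⟨hi1, hi2, hi3⟩, if_pos hi] at this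
      linarith [Finset.sum_nonneg h1]

theorem card_pauli : Fintype.card Pauli = 4 := rfl

theorem card_signedPauli (n : ℕ) : Fintype.card (SignedPauli n) = 2 * 4 ^ n := by
  simp [SignedPauli, card_pauli]

section EntryProb

variable {n : ℕ} {ε : ℝ} {S : Finset (SignedPauli n)}

theorem entryProb_nonneg (h0 : 0 ≤ ε) (h1 : ε ≤ 1) (P : SignedPauli n) : 0 ≤ entryProb ε S P := by
  have : 0 ≤ 1 - ε := by linarith
  unfold entryProb
  positivity

theorem sum_entryProb (hS : S.card = 2 ^ n) : ∑ P, entryProb ε S P = 1 := by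
  have hc : (Fintype.card (SignedPauli n) : ℝ) ≠ 0 := by
    rw [card_signedPauli]; positivity
  have hS' : (S.card : ℝ) ≠ 0 := by rw [hS]; positivity
  simp only [entryProb, Finset.sum_add_distrib, Finset.sum_const, ← Finset.mul_sum,
    Finset.sum_ite_mem, Finset.univ_inter, Finset.card_univ, nsmul_eq_mul]
  field_simp
  ring

/-- Both components of the mixture are uniform on sets of at least 2^n elements. No other property
of the hidden group affects the collision estimates. -/
theorem entryProb_le (h0 : 0 ≤ ε) (h1 : ε ≤ 1) (hS : S.card = 2 ^ n) (P : SignedPauli n) :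
    entryProb ε S P ≤ 1 / 2 ^ n := by
  have h2 : (1 : ℝ) / (Fintype.card (SignedPauli n) : ℝ) ≤ 1 / 2 ^ n := by
    rw [card_signedPauli]
    apply one_div_le_one_div_of_le (by positivity)
    push_cast
    have : (2 : ℝ) ^ n ≤ 4 ^ n := pow_le_pow_left₀ (by norm_num) (by norm_num) n
    have : (0 : ℝ) ≤ 4 ^ n := by positivity
    linarith
  have h3 : (if P ∈ S then 1 / (S.card : ℝ) else 0) ≤ 1 / 2 ^ n := by
    rw [hS]
    split_ifs
    · push_cast; exact le_rfl
    · positivity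
  unfold entryProb
  nlinarith [mul_le_mul_of_nonneg_left h2 (by linarith : 0 ≤ 1 - ε),
    mul_le_mul_of_nonneg_left h3 h0]

/-- A bit vector determines the Pauli string, so only the sign remains free; this is the factor 2.
-/
theorem sum_entryProb_bits_eq_le (h0 : 0 ≤ ε) (h1 : ε ≤ 1) (hS : S.card = 2 ^ n)
    (t : Fin n → ZMod 2 × ZMod 2) :
    ∑ P, (if SignedPauli.bits P = t then entryProb ε S P else 0) ≤ 2 / 2 ^ n := by
  rw [Fintype.sum_prod_type]
  have h : ∀ b : Fin 2, ∑ A : Fin n → Pauli,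
      (if SignedPauli.bits (b, A) = t then entryProb ε S (b, A) else 0) ≤ 1 / 2 ^ n := by
    intro b
    by_cases hA : ∃ A : Fin n → Pauli, SignedPauli.bits (b, A) = t
    · obtain ⟨A, hA⟩ := hA
      rw [Finset.sum_eq_single_of_mem A (Finset.mem_univ A), if_pos hA]
      · exact entryProb_le h0 h1 hS _
      · intro A' _ hne
        rw [if_neg]
        intro h
        apply hne
        funext k
        exact Pauli.bits_injective (congrFun (h.trans hA.symm) k)
    · push Not at hA
      simp only [hA, if_false, Finset.sum_const_zero]
      positivity
  calc _ ≤ ∑ b : Fin 2, (1 : ℝ) / 2 ^ n := Finset.sum_le_sum fun b _ => h b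
    _ = 2 / 2 ^ n := by simp [div_eq_mul_inv]

theorem sum_prod_entryProb_mul_badRow_le {m : ℕ} (h0 : 0 ≤ ε) (h1 : ε ≤ 1)
    (hS : S.card = 2 ^ n) :
    ∑ e : Fin m → SignedPauli n, (∏ j, entryProb ε S (e j)) * badRow e ≤
      ((m : ℝ) + m ^ 4) * (2 / 2 ^ n) := by
  have hp0 := entryProb_nonneg (S := S) h0 h1
  have hnn : ∀ e : Fin m → SignedPauli n, 0 ≤ ∏ j, entryProb ε S (e j) :=
    fun e => Finset.prod_nonneg fun j _ => hp0 _
  refine (Finset.sum_le_sum fun e _ => mul_le_mul_of_nonneg_left (badRow_le e) (hnn e)).trans ?_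
  simp only [mul_add, Finset.sum_add_distrib, Finset.mul_sum, mul_ite, mul_one, mul_zero]
  rw [Finset.sum_comm, Finset.sum_comm (t := (Finset.univ : Finset (Fin m × Fin m × Fin m × Fin m))),
    add_mul]
  have key := fun (i : Fin m) F hF => sum_prod_ite_eq_le hp0 (sum_entryProb hS) SignedPauli.bits
    (sum_entryProb_bits_eq_le h0 h1 hS) i F hF
  refine add_le_add ?_ ?_
  · refine (Finset.sum_le_sum fun i _ => key i (fun _ => 0) fun _ _ => rfl).trans ?_
    simp
  · refine (Finset.sum_le_sum (g := fun _ => 2 / 2 ^ n) fun i _ => ?_).trans ?_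
    · by_cases hi : i.1 ≠ i.2.1 ∧ i.1 ≠ i.2.2.1 ∧ i.1 ≠ i.2.2.2
      · simp only [hi, ne_eq, not_false_eq_true, and_self, if_true]
        refine key i.1 (fun e => SignedPauli.bits (e i.2.1) + SignedPauli.bits (e i.2.2.1) +
            SignedPauli.bits (e i.2.2.2)) fun e b => ?_
        simp only [Function.update_of_ne hi.1.symm, Function.update_of_ne hi.2.1.symm,
          Function.update_of_ne hi.2.2.symm]
      · simp only [hi, if_false, Finset.sum_const_zero]
        positivity
    · rw [Finset.sum_const, Finset.card_univ, nsmul_eq_mul]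
      simp only [Fintype.card_prod, Fintype.card_fin]
      push_cast
      apply le_of_eq
      ring

end EntryProb

/-! ### The bank's distribution -/

/-- The probability of a row of the table. -/
def rowProb {n m : ℕ} (ε : ℝ) (e : Fin m → SignedPauli n) : ℝ :=
  (1 / ((stabilizerGroups n).card : ℝ)) *
    ∑ S ∈ stabilizerGroups n, ∏ j, entryProb ε S (e j)

theorem tableProb_eq_prod_rowProb {n m l : ℕ} (ε : ℝ) (E : Table n m l) :
    tableProb ε E = ∏ i, rowProb ε (E i) := rfl

theorem card_of_mem_stabilizerGroups {n : ℕ} {S : Finset (SignedPauli n)}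
    (h : S ∈ stabilizerGroups n) : S.card = 2 ^ n := by
  classical
  obtain ⟨ψ, _, _, h⟩ := (Finset.mem_filter.1 h).2
  exact h

theorem mem_stabilizer_single_iff {n : ℕ} (P : SignedPauli n) :
    P ∈ stabilizer (Pi.single 0 1 : Basis n → ℂ) ↔
      P.1 = 0 ∧ ∀ k, P.2 k = .I ∨ P.2 k = .Z := by
  rw [stabilizer, Finset.mem_filter, and_iff_right (Finset.mem_univ _)]
  rw [Matrix.mulVec_single_one]
  have hval : ∀ x : Basis n, SignedPauli.mat P x 0 =
      (-1 : ℂ) ^ (P.1 : ℕ) * ∏ k, (P.2 k).mat (x k) 0 := fun x => by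
    simp [SignedPauli.mat, tensor]
  constructor
  · intro h
    have h0 := congrFun h 0
    rw [Matrix.col_apply, hval, Pi.single_eq_same] at h0
    have hk : ∀ k, P.2 k = .I ∨ P.2 k = .Z := by
      intro k
      have hne : ∏ k, (P.2 k).mat ((0 : Basis n) k) 0 ≠ 0 := by
        intro h; rw [h, mul_zero] at h0; exact zero_ne_one h0
      have := Finset.prod_ne_zero_iff.1 hne k (Finset.mem_univ k)
      rcases h : P.2 k <;> simp [h, Pauli.mat] at this ⊢
    refine ⟨?_, hk⟩
    have hone : ∏ k, (P.2 k).mat ((0 : Basis n) k) 0 = 1 := by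
      refine Finset.prod_eq_one fun k _ => ?_
      rcases hk k with h | h <;> simp [h, Pauli.mat]
    rw [hone, mul_one] at h0
    match hb : P.1, h0 with
    | 0, _ => rfl
    | 1, h0 => norm_num [hb] at h0
  · rintro ⟨hb, hk⟩
    funext x
    rw [Matrix.col_apply, hval, hb]
    by_cases hx : x = 0
    · subst hx
      rw [Pi.single_eq_same]
      simp only [Fin.val_zero, pow_zero, one_mul]
      refine Finset.prod_eq_one fun k _ => ?_
      rcases hk k with h | h <;> simp [h, Pauli.mat]
    · rw [Pi.single_eq_of_ne hx]
      obtain ⟨k, hxk⟩ := Function.ne_iff.1 hx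
      have hxk : x k = 1 := by
        rw [Pi.zero_apply] at hxk; omega
      rw [Finset.prod_eq_zero (Finset.mem_univ k), mul_zero]
      rcases hk k with h | h <;> simp [h, Pauli.mat, hxk]

/-- If there were no stabilizer state, the factor 1/card would be 1/0 = 0 and the table
probabilities would not sum to 1. The witness is |0⋯0⟩, which is stabilized by the 2^n strings of I
and Z with positive sign. -/
theorem stabilizerGroups_nonempty (n : ℕ) : (stabilizerGroups n).Nonempty := by
  classical
  refine ⟨stabilizer (Pi.single 0 1 : Basis n → ℂ), Finset.mem_filter.2 ⟨Finset.mem_univ _,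
    Pi.single 0 1, ?_, rfl, ?_⟩⟩
  · intro h
    simpa using congrFun h 0
  · have : stabilizer (Pi.single 0 1 : Basis n → ℂ) =
        {0} ×ˢ Fintype.piFinset fun _ => {Pauli.I, Pauli.Z} := by
      ext P
      rw [mem_stabilizer_single_iff, Finset.mem_product]
      simp [Fintype.mem_piFinset]
    rw [this, Finset.card_product, Fintype.card_piFinset]
    simp

section RowProb

variable {n m l : ℕ} {ε : ℝ}

theorem rowProb_nonneg (h0 : 0 ≤ ε) (h1 : ε ≤ 1) (e : Fin m → SignedPauli n) :
    0 ≤ rowProb ε e :=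
  mul_nonneg (by positivity) (Finset.sum_nonneg fun _ _ => Finset.prod_nonneg fun _ _ =>
    entryProb_nonneg h0 h1 _)

theorem sum_rowProb : ∑ e : Fin m → SignedPauli n, rowProb ε e = 1 := by
  have hc : ((stabilizerGroups n).card : ℝ) ≠ 0 := by
    exact_mod_cast (Finset.card_pos.2 (stabilizerGroups_nonempty n)).ne'
  simp only [rowProb, ← Finset.mul_sum]
  rw [Finset.sum_comm, Finset.sum_congr rfl (g := fun _ => (1 : ℝ))]
  · simp [hc]
  · intro S hS
    rw [sum_prod_apply fun _ => entryProb ε S]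
    simp [sum_entryProb (card_of_mem_stabilizerGroups hS)]

theorem sum_rowProb_mul_badRow_le (h0 : 0 ≤ ε) (h1 : ε ≤ 1) :
    ∑ e : Fin m → SignedPauli n, rowProb ε e * badRow e ≤
      ((m : ℝ) + m ^ 4) * (2 / 2 ^ n) := by
  have hc : (0 : ℝ) < (stabilizerGroups n).card := by
    exact_mod_cast Finset.card_pos.2 (stabilizerGroups_nonempty n)
  simp only [rowProb, mul_assoc, ← Finset.mul_sum, Finset.sum_mul]
  rw [Finset.sum_comm, one_div, inv_mul_le_iff₀ hc]
  refine (Finset.sum_le_sum fun S hS => sum_prod_entryProb_mul_badRow_le h0 h1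
    (card_of_mem_stabilizerGroups hS)).trans ?_
  simp

/-- Markov's inequality for the number of bad rows. Its expectation is at most l times the bound for
a single row, and the factor l cancels against the threshold `l * η`. -/
theorem one_sub_le_bankProb (h0 : 0 ≤ ε) (h1 : ε ≤ 1) (hl : 0 < l) {η : ℝ} (hη : 0 < η)
    {A : Set (Table n m l)} (hA : ∀ E : Table n m l, ∑ i, badRow (E i) ≤ l * η → E ∈ A) :
    1 - ((m : ℝ) + m ^ 4) * (2 / 2 ^ n) / η ≤ bankProb ε A := by
  classical
  have hl' : (0 : ℝ) < l := by exact_mod_cast hl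
  have hnn : ∀ E : Table n m l, 0 ≤ tableProb ε E := fun E =>
    Finset.prod_nonneg fun i _ => rowProb_nonneg h0 h1 _
  have hone : ∑ E : Table n m l, tableProb ε E = 1 := by
    simp only [tableProb_eq_prod_rowProb]
    rw [sum_prod_apply fun _ => rowProb ε]
    simp [sum_rowProb]
  have hmean : ∑ E : Table n m l, tableProb ε E * ∑ i, badRow (E i) ≤
      l * (((m : ℝ) + m ^ 4) * (2 / 2 ^ n)) := by
    simp only [tableProb_eq_prod_rowProb, Finset.mul_sum]
    rw [Finset.sum_comm]
    simp only [sum_prod_mul_apply sum_rowProb]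
    refine (Finset.sum_le_sum fun i _ => sum_rowProb_mul_badRow_le h0 h1).trans ?_
    simp
  have hpt : ∀ E : Table n m l, tableProb ε E - tableProb ε E * (∑ i, badRow (E i)) / (l * η) ≤
      if E ∈ A then tableProb ε E else 0 := by
    intro E
    have hb : 0 ≤ ∑ i, badRow (E i) := Finset.sum_nonneg fun i _ => by
      unfold badRow; split_ifs <;> simp
    split_ifs with h
    · have : 0 ≤ tableProb ε E * (∑ i, badRow (E i)) / (l * η) := by
        have := hnn E
        positivity
      linarith
    · have h2 : l * η ≤ ∑ i, badRow (E i) := by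
        by_contra hlt
        exact h (hA E (not_le.1 hlt).le)
      rw [sub_nonpos, le_div_iff₀ (by positivity)]
      exact mul_le_mul_of_nonneg_left h2 (hnn E)
  rw [bankProb, Finset.sum_filter]
  refine le_trans ?_ (Finset.sum_le_sum fun E _ => hpt E)
  rw [Finset.sum_sub_distrib, hone, ← Finset.sum_div]
  have : (∑ E : Table n m l, tableProb ε E * ∑ i, badRow (E i)) / (l * η) ≤
      ((m : ℝ) + m ^ 4) * (2 / 2 ^ n) / η := by
    rw [div_le_div_iff₀ (by positivity) hη]
    nlinarith [mul_le_mul_of_nonneg_right hmean hη.le]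
  linarith

end RowProb

/-! ### Products of Pauli operators -/

theorem Pauli.exists_mat_mul (a b : Pauli) :
    ∃ (φ : ℂ) (c : Pauli), ‖φ‖ = 1 ∧ c.bits = a.bits + b.bits ∧ a.mat * b.mat = φ • c.mat := by
  have key : ∀ (φ : ℂ) (c : Pauli), ‖φ‖ = 1 → c.bits = a.bits + b.bits →
      (∀ i j, (a.mat * b.mat) i j = (φ • c.mat) i j) →
      ∃ (φ : ℂ) (c : Pauli), ‖φ‖ = 1 ∧ c.bits = a.bits + b.bits ∧ a.mat * b.mat = φ • c.mat :=
    fun φ c h1 h2 h3 => ⟨φ, c, h1, h2, Matrix.ext h3⟩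
  have hI : ‖(-Complex.I : ℂ)‖ = 1 := by simp
  cases a <;> cases b
  · exact key 1 .I (by simp) (by decide) (by
      intro i j; fin_cases i <;> fin_cases j <;> simp [Pauli.mat])
  · exact key 1 .X (by simp) (by decide) (by
      intro i j; fin_cases i <;> fin_cases j <;> simp [Pauli.mat])
  · exact key 1 .Y (by simp) (by decide) (by
      intro i j; fin_cases i <;> fin_cases j <;> simp [Pauli.mat])
  · exact key 1 .Z (by simp) (by decide) (by
      intro i j; fin_cases i <;> fin_cases j <;> simp [Pauli.mat])
  · exact key 1 .X (by simp) (by decide) (by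
      intro i j; fin_cases i <;> fin_cases j <;> simp [Pauli.mat])
  · exact key 1 .I (by simp) (by decide) (by
      intro i j; fin_cases i <;> fin_cases j <;> simp [Pauli.mat])
  · exact key Complex.I .Z (by simp) (by decide) (by
      intro i j; fin_cases i <;> fin_cases j <;> simp [Pauli.mat])
  · exact key (-Complex.I) .Y hI (by decide) (by
      intro i j; fin_cases i <;> fin_cases j <;> simp [Pauli.mat])
  · exact key 1 .Y (by simp) (by decide) (by
      intro i j; fin_cases i <;> fin_cases j <;> simp [Pauli.mat])
  · exact key (-Complex.I) .Z hI (by decide) (by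
      intro i j; fin_cases i <;> fin_cases j <;> simp [Pauli.mat])
  · exact key 1 .I (by simp) (by decide) (by
      intro i j; fin_cases i <;> fin_cases j <;> simp [Pauli.mat])
  · exact key Complex.I .X (by simp) (by decide) (by
      intro i j; fin_cases i <;> fin_cases j <;> simp [Pauli.mat])
  · exact key 1 .Z (by simp) (by decide) (by
      intro i j; fin_cases i <;> fin_cases j <;> simp [Pauli.mat])
  · exact key Complex.I .Y (by simp) (by decide) (by
      intro i j; fin_cases i <;> fin_cases j <;> simp [Pauli.mat])
  · exact key (-Complex.I) .X hI (by decide) (by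
      intro i j; fin_cases i <;> fin_cases j <;> simp [Pauli.mat])
  · exact key 1 .I (by simp) (by decide) (by
      intro i j; fin_cases i <;> fin_cases j <;> simp [Pauli.mat])

theorem Pauli.trace_mat (a : Pauli) : a.mat.trace = if a = .I then 2 else 0 := by
  cases a <;> simp [Pauli.mat, Matrix.trace_fin_two]; norm_num

/-- A matrix is a Pauli string with the given bits, up to a phase. -/
def IsPauliString {n : ℕ} (A : Matrix (Basis n) (Basis n) ℂ) (v : Fin n → ZMod 2 × ZMod 2) : Prop :=
  ∃ (φ : ℂ) (Q : Fin n → Pauli), ‖φ‖ = 1 ∧ (fun k => (Q k).bits) = v ∧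
    A = φ • tensor fun k => (Q k).mat

theorem SignedPauli.isPauliString {n : ℕ} (P : SignedPauli n) :
    IsPauliString (SignedPauli.mat P) (SignedPauli.bits P) :=
  ⟨_, P.2, by simp, rfl, rfl⟩

theorem IsPauliString.mul {n : ℕ} {A B : Matrix (Basis n) (Basis n) ℂ}
    {v w : Fin n → ZMod 2 × ZMod 2} (hA : IsPauliString A v) (hB : IsPauliString B w) :
    IsPauliString (A * B) (v + w) := by
  obtain ⟨φ, Q, hφ, hQ, rfl⟩ := hA
  obtain ⟨χ, R, hχ, hR, rfl⟩ := hB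
  choose ξ S hξ hS hmul using fun k => Pauli.exists_mat_mul (Q k) (R k)
  refine ⟨φ * χ * ∏ k, ξ k, S, ?_, ?_, ?_⟩
  · simp [hφ, hχ, hξ]
  · funext k
    rw [hS, ← hQ, ← hR]
    rfl
  · rw [smul_mul_smul_comm, tensor_mul]
    simp only [hmul]
    rw [tensor_smul, smul_smul]

/-- The trace factorizes over the qubits, and a nonzero bit vector forces one traceless factor. -/
theorem IsPauliString.trace_eq_zero {n : ℕ} {A : Matrix (Basis n) (Basis n) ℂ}
    {v : Fin n → ZMod 2 × ZMod 2} (hA : IsPauliString A v) (hv : v ≠ 0) : A.trace = 0 := by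
  obtain ⟨φ, Q, hφ, hQ, rfl⟩ := hA
  obtain ⟨k, hk⟩ := Function.ne_iff.1 hv
  rw [Matrix.trace_smul, trace_tensor, Finset.prod_eq_zero (Finset.mem_univ k), smul_zero]
  rw [Pauli.trace_mat, if_neg]
  intro h
  apply hk
  rw [← hQ]
  change (Q k).bits = 0
  rw [h]
  rfl

theorem IsPauliString.norm_trace_le {n : ℕ} {A : Matrix (Basis n) (Basis n) ℂ}
    {v : Fin n → ZMod 2 × ZMod 2} (hA : IsPauliString A v) : ‖A.trace‖ ≤ 2 ^ n := by
  obtain ⟨φ, Q, hφ, hQ, rfl⟩ := hA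
  rw [Matrix.trace_smul, trace_tensor, norm_smul, hφ, one_mul, norm_prod]
  refine (Finset.prod_le_prod (g := fun _ => (2 : ℝ)) (fun k _ => norm_nonneg _) fun k _ => ?_).trans ?_
  · rw [Pauli.trace_mat]
    split_ifs <;> simp
  · simp

/-! ### Moments of the sum of a good row -/

section Moments

variable {n m : ℕ} {e : Fin m → SignedPauli n}

/-- The sum of the operators of a row of the table. -/
def rowSum (e : Fin m → SignedPauli n) : Matrix (Basis n) (Basis n) ℂ :=
  ∑ j, SignedPauli.mat (e j)

theorem rowSum_isHermitian (e : Fin m → SignedPauli n) : (rowSum e).IsHermitian := by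
  rw [rowSum, Matrix.IsHermitian, Matrix.conjTranspose_sum]
  simp [(SignedPauli.mat_isHermitian _).eq]

theorem bits_add_self (v : Fin n → ZMod 2 × ZMod 2) : v + v = 0 := by
  funext k
  ext <;> simp [CharTwo.add_self_eq_zero]

theorem bits_eq_of_add_eq_zero {v w : Fin n → ZMod 2 × ZMod 2} (h : v + w = 0) : v = w := by
  have := congrArg (· + w) h
  simpa [add_assoc, bits_add_self] using this

theorem GoodRow.trace_mat (he : GoodRow e) (j : Fin m) : (SignedPauli.mat (e j)).trace = 0 :=
  (SignedPauli.isPauliString _).trace_eq_zero (he.1 j)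

/-- Equality of two entries is the degenerate coincidence `(i, j, j, j)`, since v + v + v = v in
characteristic two. -/
theorem GoodRow.bits_ne (he : GoodRow e) {i j : Fin m} (h : i ≠ j) :
    SignedPauli.bits (e i) ≠ SignedPauli.bits (e j) := by
  have := he.2 (i, j, j, j) h h h
  simpa [bits_add_self] using this

/-- Products of two different entries are nontrivial Pauli strings and have trace zero; each of the
m squares is the identity. -/
theorem GoodRow.trace_rowSum_sq (he : GoodRow e) :
    (rowSum e ^ 2).trace = (m : ℂ) * 2 ^ n := by
  rw [sq, rowSum, Finset.sum_mul, Matrix.trace_sum]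
  have : ∀ i, (SignedPauli.mat (e i) * ∑ j, SignedPauli.mat (e j)).trace = 2 ^ n := by
    intro i
    rw [Finset.mul_sum, Matrix.trace_sum, Finset.sum_eq_single_of_mem i (Finset.mem_univ i)]
    · rw [SignedPauli.mat_mul_self, Matrix.trace_one]
      simp [Basis]
    · intro j _ hj
      refine ((SignedPauli.isPauliString _).mul (SignedPauli.isPauliString _)).trace_eq_zero ?_
      exact fun h => he.bits_ne hj.symm (bits_eq_of_add_eq_zero h)
  simp [this]

/-- This is what the definition of a good row is made for: four entries multiply to a phase only in
the unavoidable cases. -/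
theorem GoodRow.pairing (he : GoodRow e) {i j k l : Fin m}
    (h : SignedPauli.bits (e i) + SignedPauli.bits (e j) + SignedPauli.bits (e k) +
      SignedPauli.bits (e l) = 0) : (i = j ∧ k = l) ∨ (i = k ∧ j = l) ∨ (i = l ∧ j = k) := by
  have h1 : i = j ∨ i = k ∨ i = l := by
    by_contra! hc
    refine he.2 (i, j, k, l) hc.1 hc.2.1 hc.2.2 (bits_eq_of_add_eq_zero ?_)
    rw [← h]; abel
  have key : ∀ {a b : Fin m} (v : Fin n → ZMod 2 × ZMod 2),
      v + v + (SignedPauli.bits (e a) + SignedPauli.bits (e b)) = 0 → a = b := by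
    intro a b v h
    rw [bits_add_self, zero_add] at h
    by_contra hc
    exact he.bits_ne hc (bits_eq_of_add_eq_zero h)
  rcases h1 with rfl | rfl | rfl
  · exact Or.inl ⟨rfl, key (SignedPauli.bits (e i)) (by rw [← h]; abel)⟩
  · exact Or.inr (Or.inl ⟨rfl, key (SignedPauli.bits (e i)) (by rw [← h]; abel)⟩)
  · exact Or.inr (Or.inr ⟨rfl, key (SignedPauli.bits (e i)) (by rw [← h]; abel)⟩)

/-- As for a Gaussian variable of variance m: three pairings of four positions with m² choices of
indices each, every term contributing at most 2^n. Index tuples that satisfy several pairings are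
counted repeatedly, which is harmless for an upper bound. -/
theorem GoodRow.norm_trace_rowSum_pow_four_le (he : GoodRow e) :
    ‖(rowSum e ^ 4).trace‖ ≤ 3 * (m : ℝ) ^ 2 * 2 ^ n := by
  have hexp : rowSum e ^ 4 = ∑ i, ∑ j, ∑ k, ∑ l, SignedPauli.mat (e i) * SignedPauli.mat (e j) *
      SignedPauli.mat (e k) * SignedPauli.mat (e l) := by
    have h2 : rowSum e * rowSum e = ∑ i, ∑ j, SignedPauli.mat (e i) * SignedPauli.mat (e j) :=
      Finset.sum_mul_sum _ _ _ _
    have hr : ∀ X, X * rowSum e = ∑ j, X * SignedPauli.mat (e j) := fun X => Finset.mul_sum _ _ _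
    rw [show rowSum e ^ 4 = rowSum e * rowSum e * rowSum e * rowSum e by simp [pow_succ], h2,
      Finset.sum_mul, Finset.sum_mul]
    refine Finset.sum_congr rfl fun i _ => ?_
    rw [Finset.sum_mul, Finset.sum_mul]
    refine Finset.sum_congr rfl fun j _ => ?_
    rw [hr (SignedPauli.mat (e i) * SignedPauli.mat (e j)), Finset.sum_mul]
    exact Finset.sum_congr rfl fun k _ => hr _
  have hterm : ∀ i j k l, ‖(SignedPauli.mat (e i) * SignedPauli.mat (e j) *
      SignedPauli.mat (e k) * SignedPauli.mat (e l)).trace‖ ≤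
      ((if i = j ∧ k = l then 1 else 0) + (if i = k ∧ j = l then 1 else 0) +
        (if i = l ∧ j = k then 1 else 0)) * 2 ^ n := by
    intro i j k l
    have hP := (((SignedPauli.isPauliString (e i)).mul (SignedPauli.isPauliString (e j))).mul
      (SignedPauli.isPauliString (e k))).mul (SignedPauli.isPauliString (e l))
    by_cases h : SignedPauli.bits (e i) + SignedPauli.bits (e j) + SignedPauli.bits (e k) +
        SignedPauli.bits (e l) = 0
    · refine hP.norm_trace_le.trans ?_
      have h1 : (1 : ℝ) ≤ (if i = j ∧ k = l then 1 else 0) + (if i = k ∧ j = l then 1 else 0) +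
        (if i = l ∧ j = k then 1 else 0) := by
        rcases he.pairing h with h | h | h <;> rw [if_pos h] <;> split_ifs <;> norm_num
      have h2 : (0 : ℝ) ≤ 2 ^ n := by positivity
      nlinarith
    · rw [hP.trace_eq_zero h, norm_zero]
      positivity
  rw [hexp]
  simp only [Matrix.trace_sum]
  refine (norm_sum_le _ _).trans ((Finset.sum_le_sum fun i _ => (norm_sum_le _ _).trans
    (Finset.sum_le_sum fun j _ => (norm_sum_le _ _).trans (Finset.sum_le_sum fun k _ =>
      (norm_sum_le _ _).trans (Finset.sum_le_sum fun l _ => hterm i j k l)))).trans ?_)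
  simp only [← Finset.sum_mul, Finset.sum_add_distrib]
  apply le_of_eq
  congr 1
  simp only [ite_and, Finset.sum_ite_eq, Finset.mem_univ, if_true, Finset.sum_const,
    Finset.sum_ite_irrel, Finset.card_univ, Fintype.card_fin, nsmul_eq_mul, smul_zero, mul_one,
    mul_ite, mul_zero]
  ring

end Moments

/-! ### Chebyshev polynomials -/

section Chebyshev

open Polynomial in
theorem trace_aeval_eq_sum_eigenvalues {α : Type*} [Fintype α] [DecidableEq α]
    {A : Matrix α α ℂ} (hA : A.IsHermitian) (p : ℝ[X]) :
    (aeval A p).trace = ((∑ i, p.eval (hA.eigenvalues i) : ℝ) : ℂ) := by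
  rw [← cfc_polynomial p A hA.isSelfAdjoint, hA.cfc_eq, Matrix.IsHermitian.cfc,
    Unitary.conjStarAlgAut_apply, Matrix.trace_mul_comm, ← mul_assoc]
  simp [Matrix.trace_diagonal]

/-- Induction through sin((2p+3)θ) = sin((2p+1)θ) + 2 sin θ (1 − 2 sin²((p+1)θ)) together with
|sin(qθ)| ≤ q|sin θ|. One step costs at most 4(p+1)² sin⁴θ, which is exactly the increment of the
coefficient (k³−k)/6 from k = 2p+1 to k = 2p+3. -/
theorem sin_mul_sin_odd_ge (θ : ℝ) (p : ℕ) :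
    (2 * p + 1) * Real.sin θ ^ 2 - (((2 * p + 1 : ℝ) ^ 3 - (2 * p + 1)) / 6) * Real.sin θ ^ 4 ≤
      Real.sin θ * Real.sin ((2 * p + 1) * θ) := by
  induction p with
  | zero => simp [sq]
  | succ p ih =>
    have hsin : ∀ q : ℕ, Real.sin (q * θ) ^ 2 ≤ (q : ℝ) ^ 2 * Real.sin θ ^ 2 := by
      intro q
      have h : |Real.sin (q * θ)| ≤ q * |Real.sin θ| := by
        induction q with
        | zero => simp
        | succ q ih =>
          push_cast
          rw [add_mul, one_mul, Real.sin_add]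
          refine (abs_add_le _ _).trans ?_
          rw [abs_mul, abs_mul]
          nlinarith [Real.abs_cos_le_one θ, Real.abs_cos_le_one (q * θ), abs_nonneg (Real.sin θ),
            abs_nonneg (Real.sin (q * θ))]
      have := pow_le_pow_left₀ (abs_nonneg _) h 2
      rwa [mul_pow, sq_abs, sq_abs] at this
    have h1 : Real.sin ((2 * ((p + 1 : ℕ) : ℝ) + 1) * θ) = Real.sin ((2 * p + 1) * θ) +
        2 * Real.sin θ * (1 - 2 * Real.sin (((p + 1 : ℕ) : ℝ) * θ) ^ 2) := by
      have e1 : (2 * ((p + 1 : ℕ) : ℝ) + 1) * θ = 2 * (((p + 1 : ℕ) : ℝ) * θ) + θ := by ring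
      have e2 : (2 * (p : ℝ) + 1) * θ = 2 * (((p + 1 : ℕ) : ℝ) * θ) - θ := by push_cast; ring
      rw [e1, e2, Real.sin_add, Real.sin_sub, Real.cos_two_mul', Real.cos_sq']
      ring
    have h2 := hsin (p + 1)
    rw [h1]
    have h3 := mul_le_mul_of_nonneg_left h2 (by positivity : 0 ≤ 4 * Real.sin θ ^ 2)
    push_cast at h3 ⊢
    nlinarith [h3, ih]

/-- The left side is the Taylor polynomial of x T_k(x) of degree 4 at the origin. The degree k ≡ 1
mod 4 makes T_k(sin θ) = sin(kθ) with a positive sign. As the bound holds for every real x, no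
estimate of the spectrum of H is needed. -/
theorem chebyshev_ge (q : ℕ) (x : ℝ) :
    (4 * q + 1) * x ^ 2 - (((4 * q + 1 : ℝ) ^ 3 - (4 * q + 1)) / 6) * x ^ 4 ≤
      x * (Polynomial.Chebyshev.T ℝ (4 * q + 1)).eval x := by
  by_cases hx : |x| ≤ 1
  · rw [abs_le] at hx
    have h1 := sin_mul_sin_odd_ge (Real.arcsin x) (2 * q)
    have h2 : (Polynomial.Chebyshev.T ℝ (4 * q + 1)).eval x =
        Real.sin ((4 * q + 1) * Real.arcsin x) := by
      conv_lhs => rw [← Real.sin_arcsin hx.1 hx.2, ← Real.cos_pi_div_two_sub]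
      rw [Polynomial.Chebyshev.T_real_cos]
      push_cast
      rw [show (4 * (q : ℝ) + 1) * (Real.pi / 2 - Real.arcsin x) =
        Real.pi / 2 - (4 * q + 1) * Real.arcsin x + q * (2 * Real.pi) by ring,
        Real.cos_add_nat_mul_two_pi, Real.cos_pi_div_two_sub]
    rw [Real.sin_arcsin hx.1 hx.2] at h1
    push_cast at h1
    rw [h2]
    have e : 2 * (2 * (q : ℝ)) = 4 * q := by ring
    rw [e] at h1
    exact h1
  · rw [not_le] at hx
    have hT : 0 ≤ x * (Polynomial.Chebyshev.T ℝ (4 * q + 1)).eval x := by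
      rcases lt_abs.1 hx with h | h
      · have := Polynomial.Chebyshev.one_le_eval_T_real (4 * q + 1) h.le
        nlinarith
      · have h1 := Polynomial.Chebyshev.one_le_eval_T_real (4 * q + 1) h.le
        have hodd : Odd (4 * (q : ℤ) + 1) := ⟨2 * q, by ring⟩
        rw [Polynomial.Chebyshev.T_eval_neg, Int.negOnePow_odd _ hodd] at h1
        push_cast at h1
        nlinarith
    -- For q = 0 the quartic coefficient vanishes. For q ≥ 1 it is at least k, so for |x| > 1 the
    -- left side is at most zero, while x T_k(x) is nonnegative.
    rcases Nat.eq_zero_or_pos q with rfl | hq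
    · simp [sq]
    · refine le_trans ?_ hT
      have hq1 : (1 : ℝ) ≤ q := by exact_mod_cast hq
      have hx2 : 1 ≤ x ^ 2 := by rw [← sq_abs]; nlinarith
      have hk : 6 * (4 * (q : ℝ) + 1) ≤ (4 * q + 1) ^ 3 - (4 * q + 1) := by
        nlinarith [mul_nonneg (by linarith : (0 : ℝ) ≤ q - 1) (by linarith : (0 : ℝ) ≤ q),
          mul_nonneg (mul_nonneg (by linarith : (0 : ℝ) ≤ q - 1) (by linarith : (0 : ℝ) ≤ q))
            (by linarith : (0 : ℝ) ≤ q)]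
      have h4 : x ^ 4 = x ^ 2 * x ^ 2 := by ring
      rw [h4]
      nlinarith [mul_nonneg (by linarith : 0 ≤ x ^ 2 - 1) (by linarith : 0 ≤ x ^ 2),
        mul_le_mul_of_nonneg_right hk (by positivity : 0 ≤ x ^ 2 * x ^ 2)]

end Chebyshev

/-! ### The energy of the forged state of a good row -/

section Energy

variable {n m : ℕ} {e : Fin m → SignedPauli n}

open Polynomial in
-- Apply `chebyshev_ge` to each eigenvalue and sum. Only the second and fourth moments appear; the
-- factor 3 of the fourth moment turns the denominator 6 into 2.
theorem GoodRow.le_trace_rowSum_mul_chebyshev (he : GoodRow e) {M : ℕ} (hM : 0 < M) (q : ℕ) :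
    ((4 * q + 1) * (m / M) - ((4 * q + 1 : ℝ) ^ 3 - (4 * q + 1)) / 2 * (m ^ 2 / M ^ 3)) * 2 ^ n ≤
      (aeval ((1 / M : ℝ) • rowSum e) (Chebyshev.T ℝ (4 * q + 1)) * rowSum e).trace.re := by
  have hM' : (0 : ℝ) < M := by exact_mod_cast hM
  set x := (1 / M : ℝ) • rowSum e with hx
  have hxH : x.IsHermitian := by
    rw [Matrix.IsHermitian, hx, Matrix.conjTranspose_smul, (rowSum_isHermitian e).eq]
    simp
  have hsum : rowSum e = (M : ℝ) • x := by
    rw [hx, smul_smul]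
    field_simp
    simp
  have h2 : ∑ i, hxH.eigenvalues i ^ 2 = m * 2 ^ n / M ^ 2 := by
    have := trace_aeval_eq_sum_eigenvalues hxH (X ^ 2)
    have hx2 : (x ^ 2).trace = (1 / M : ℝ) ^ 2 • ((m : ℂ) * 2 ^ n) := by
      rw [hx, _root_.smul_pow, Matrix.trace_smul, he.trace_rowSum_sq]
    rw [aeval_X_pow, hx2] at this
    simp only [eval_pow, eval_X] at this
    rw [← Complex.ofReal_inj, ← this]
    push_cast
    rw [Complex.real_smul]
    push_cast
    ring
  have h4 : ∑ i, hxH.eigenvalues i ^ 4 ≤ 3 * m ^ 2 * 2 ^ n / M ^ 4 := by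
    have := trace_aeval_eq_sum_eigenvalues hxH (X ^ 4)
    have hx4 : (x ^ 4).trace = (1 / M : ℝ) ^ 4 • (rowSum e ^ 4).trace := by
      rw [hx, _root_.smul_pow, Matrix.trace_smul]
    rw [aeval_X_pow, hx4] at this
    simp only [eval_pow, eval_X] at this
    have h5 := congrArg Complex.re this
    rw [Complex.ofReal_re, Complex.smul_re] at h5
    rw [← h5, smul_eq_mul, div_pow, one_pow, one_div, ← div_eq_inv_mul]
    exact div_le_div_of_nonneg_right
      ((Complex.re_le_norm _).trans he.norm_trace_rowSum_pow_four_le) (by positivity)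
  have h1 : (aeval x (Chebyshev.T ℝ (4 * q + 1)) * rowSum e).trace.re =
      M * ∑ i, hxH.eigenvalues i * (Chebyshev.T ℝ (4 * q + 1)).eval (hxH.eigenvalues i) := by
    have := trace_aeval_eq_sum_eigenvalues hxH (X * Chebyshev.T ℝ (4 * q + 1))
    rw [mul_comm, aeval_mul, aeval_X] at this
    simp only [eval_mul, eval_X] at this
    rw [hsum, mul_smul_comm, Matrix.trace_smul, this, Complex.smul_re, Complex.ofReal_re,
      smul_eq_mul]
    congr 1
    exact Finset.sum_congr rfl fun i _ => mul_comm _ _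
  rw [h1]
  have h6 := Finset.sum_le_sum fun i (_ : i ∈ Finset.univ) => chebyshev_ge q (hxH.eigenvalues i)
  rw [Finset.sum_sub_distrib, ← Finset.mul_sum, ← Finset.mul_sum, h2] at h6
  have hk : (0 : ℝ) ≤ ((4 * q + 1 : ℝ) ^ 3 - (4 * q + 1)) / 6 := by
    have : (0 : ℝ) ≤ q := by positivity
    have : (4 * (q : ℝ) + 1) ^ 3 - (4 * q + 1) = 64 * q ^ 3 + 48 * q ^ 2 + 8 * q := by ring
    rw [this]; positivity
  have h7 := mul_le_mul_of_nonneg_left h4 hk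
  refine le_trans ?_ (mul_le_mul_of_nonneg_left (le_trans (sub_le_sub_left h7 _) h6) hM'.le)
  apply le_of_eq
  field_simp
  ring

/-- With k = 4q + 1 and K = 8q the degree is about K/2. The linear term is then about 1/(2K) and the
cubic correction about 1/(16K), which leaves more than 1/(4K), and K < 2√m. For K ≤ 4 the degree k =
1 suffices and the correction vanishes. -/
theorem walk_bound {K m : ℝ} {q : ℕ} (hK1 : 1 ≤ K) (hK : K ^ 2 < 4 * m)
    (hq : K ≤ 4 ∧ q = 0 ∨ K = 8 * q) :
    1 / (8 * Real.sqrt m) ≤ (4 * q + 1) / K ^ 2 -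
      ((4 * q + 1 : ℝ) ^ 3 - (4 * q + 1)) / (2 * (K ^ 2) ^ 2) := by
  have hm : 0 < m := by nlinarith
  have hs : K / 2 < Real.sqrt m := Real.lt_sqrt_of_sq_lt (by nlinarith)
  have hle : 1 / (8 * Real.sqrt m) ≤ 1 / (4 * K) :=
    one_div_le_one_div_of_le (by linarith) (by linarith)
  refine hle.trans ?_
  rcases hq with ⟨h4, rfl⟩ | rfl
  · simp only [Nat.cast_zero, mul_zero, zero_add, one_pow, sub_self, zero_div, sub_zero]
    exact one_div_le_one_div_of_le (by positivity) (by nlinarith)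
  · have hq : (0 : ℝ) < q := by linarith
    have hq1 : (1 : ℝ) ≤ q := by
      have : 0 < q := by exact_mod_cast hq
      exact_mod_cast this
    have e : (4 * (q : ℝ) + 1) / (8 * q) ^ 2 -
      ((4 * q + 1 : ℝ) ^ 3 - (4 * q + 1)) / (2 * ((8 * q) ^ 2) ^ 2) =
        (4 * q + 1) * (14 * q - 1) / (1024 * q ^ 3) := by
      field_simp
      ring
    rw [e, div_le_div_iff₀ (by positivity) (by positivity)]
    nlinarith [mul_pos hq hq, mul_pos (mul_pos hq hq) hq]

open Polynomial in
-- The multiple of the identity contributes nothing because the entries are traceless. The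
-- coefficient ½ of the Chebyshev term halves the bound 1/(8√m) of `walk_bound`.
theorem GoodRow.le_rowMean (he : GoodRow e) (hm : 0 < m) {K q : ℕ} (hK1 : 1 ≤ K)
    (hmK : m ≤ K ^ 2) (hK : K ^ 2 < 4 * m) (hq : K ≤ 4 ∧ q = 0 ∨ K = 8 * q) (c : ℂ) :
    1 / (16 * Real.sqrt m) ≤ rowMean ((1 / 2 ^ n : ℂ) • (c • 1 + (1 / 2 : ℂ) •
      aeval ((1 / (K ^ 2 : ℕ) : ℝ) • rowSum e) (Chebyshev.T ℝ (4 * q + 1)))) e := by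
  set C := aeval ((1 / (K ^ 2 : ℕ) : ℝ) • rowSum e) (Chebyshev.T ℝ (4 * q + 1)) with hC
  have hm' : (0 : ℝ) < m := by exact_mod_cast hm
  have hK' : (1 : ℝ) ≤ K := by exact_mod_cast hK1
  have h1 : rowMean ((1 / 2 ^ n : ℂ) • (c • 1 + (1 / 2 : ℂ) • C)) e =
      (1 / m) * ((1 / 2 ^ n) * ((1 / 2) * (C * rowSum e).trace.re)) := by
    rw [rowMean]
    congr 1
    simp only [expectation, smul_mul_assoc, add_mul, one_mul, Matrix.trace_smul, Matrix.trace_add,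
      he.trace_mat, smul_zero, zero_add]
    rw [rowSum, Finset.mul_sum, Matrix.trace_sum, Complex.re_sum, Finset.mul_sum, Finset.mul_sum]
    refine Finset.sum_congr rfl fun j _ => ?_
    have e1 : (1 / 2 ^ n : ℂ) = ((1 / 2 ^ n : ℝ) : ℂ) := by push_cast; rfl
    have e2 : (1 / 2 : ℂ) = ((1 / 2 : ℝ) : ℂ) := by push_cast; rfl
    rw [e1, e2, smul_eq_mul, smul_eq_mul, Complex.re_ofReal_mul, Complex.re_ofReal_mul]
  have h2 := he.le_trace_rowSum_mul_chebyshev (M := K ^ 2) (by positivity) q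
  rw [← hC] at h2
  have h3 := walk_bound hK' (by exact_mod_cast hK : (K : ℝ) ^ 2 < 4 * m) (q := q)
    (by rcases hq with ⟨h, h'⟩ | h
        · exact Or.inl ⟨by exact_mod_cast h, h'⟩
        · exact Or.inr (by exact_mod_cast h))
  rw [h1]
  have h4 : (m : ℝ) * (1 / (8 * Real.sqrt m)) ≤ (4 * q + 1) * (m / (K ^ 2 : ℕ)) -
      ((4 * q + 1 : ℝ) ^ 3 - (4 * q + 1)) / 2 * (m ^ 2 / (K ^ 2 : ℕ) ^ 3) := by
    refine (mul_le_mul_of_nonneg_left h3 hm'.le).trans ?_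
    push_cast
    have hmK' : (m : ℝ) ≤ K ^ 2 := by exact_mod_cast hmK
    have hk : (0 : ℝ) ≤ ((4 * q + 1 : ℝ) ^ 3 - (4 * q + 1)) := by
      have : (4 * (q : ℝ) + 1) ^ 3 - (4 * q + 1) = 64 * q ^ 3 + 48 * q ^ 2 + 8 * q := by ring
      rw [this]; positivity
    have : ((4 * q + 1 : ℝ) ^ 3 - (4 * q + 1)) / 2 * (m ^ 2 / (K ^ 2) ^ 3) ≤
        m * (((4 * q + 1 : ℝ) ^ 3 - (4 * q + 1)) / (2 * (K ^ 2) ^ 2)) := by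
      have e : m * (((4 * q + 1 : ℝ) ^ 3 - (4 * q + 1)) / (2 * (K ^ 2) ^ 2)) =
        ((4 * q + 1 : ℝ) ^ 3 - (4 * q + 1)) / 2 * (m * K ^ 2 / (K ^ 2) ^ 3) := by
        field_simp
      rw [e]
      refine mul_le_mul_of_nonneg_left (div_le_div_of_nonneg_right ?_ (by positivity))
        (by positivity)
      nlinarith
    rw [mul_sub]
    have e : (m : ℝ) * ((4 * q + 1) / K ^ 2) = (4 * q + 1) * (m / K ^ 2) := by ring
    linarith
  have h5 := mul_le_mul_of_nonneg_right h4 (by positivity : (0 : ℝ) ≤ 2 ^ n)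
  have h6 := h5.trans h2
  calc 1 / (16 * Real.sqrt m) =
        (1 / m) * ((1 / 2 ^ n) * ((1 / 2) * (m * (1 / (8 * Real.sqrt m)) * 2 ^ n))) := by
        have : 0 < Real.sqrt m := Real.sqrt_pos.2 hm'
        field_simp
        norm_num
    _ ≤ _ := by
      refine mul_le_mul_of_nonneg_left (mul_le_mul_of_nonneg_left
        (mul_le_mul_of_nonneg_left h6 ?_) ?_) ?_ <;> positivity

end Energy

/-! ### The quantum walk of a family of involutions -/

section Walk

variable {Z α : Type*} [Fintype Z] [Nonempty Z] [Fintype α] [DecidableEq α]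

/-- The average of a family of matrices. -/
def average (Ψ : Z → Matrix α α ℂ) : Matrix α α ℂ := (1 / (Fintype.card Z : ℂ)) • ∑ z, Ψ z

/-- One step of the walk: apply the involutions, then reflect about the constant families. -/
def walkStep (U Ψ : Z → Matrix α α ℂ) : Z → Matrix α α ℂ :=
  fun z => U z * Ψ z - (2 : ℂ) • average fun z => U z * Ψ z

/-- The walk, started in the constant family of identity matrices. -/
def walk (U : Z → Matrix α α ℂ) (k : ℕ) : Z → Matrix α α ℂ := (walkStep U)^[k] fun _ => 1

omit [Nonempty Z] [DecidableEq α] in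
theorem average_mul_right (Ψ : Z → Matrix α α ℂ) (x : Matrix α α ℂ) :
    average (fun z => Ψ z * x) = average Ψ * x := by
  rw [average, average, smul_mul_assoc, Finset.sum_mul]

omit [Nonempty Z] [DecidableEq α] in
theorem average_mul_left (Ψ : Z → Matrix α α ℂ) (x : Matrix α α ℂ) :
    average (fun z => x * Ψ z) = x * average Ψ := by
  rw [average, average, mul_smul_comm, Finset.mul_sum]

omit [Nonempty Z] [Fintype α] [DecidableEq α] in
theorem average_add (Ψ Φ : Z → Matrix α α ℂ) :
    average (fun z => Ψ z + Φ z) = average Ψ + average Φ := by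
  rw [average, average, average, Finset.sum_add_distrib, smul_add]

omit [Nonempty Z] [Fintype α] [DecidableEq α] in
theorem average_smul (c : ℂ) (Ψ : Z → Matrix α α ℂ) :
    average (fun z => c • Ψ z) = c • average Ψ := by
  rw [average, average, ← Finset.smul_sum, smul_comm]

omit [Fintype α] [DecidableEq α] in
theorem average_const (x : Matrix α α ℂ) : average (fun _ : Z => x) = x := by
  rw [average, Finset.sum_const, Finset.card_univ, ← Nat.cast_smul_eq_nsmul ℂ, smul_smul]
  rw [one_div, inv_mul_cancel₀ (by exact_mod_cast Fintype.card_ne_zero), one_smul]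

omit [Nonempty Z] [Fintype α] [DecidableEq α] in
theorem average_conjTranspose (Ψ : Z → Matrix α α ℂ) :
    average (fun z => (Ψ z).conjTranspose) = (average Ψ).conjTranspose := by
  rw [average, average, Matrix.conjTranspose_smul, Matrix.conjTranspose_sum]
  simp

omit [Nonempty Z] in
theorem walk_succ (U : Z → Matrix α α ℂ) (k : ℕ) : walk U (k + 1) = walkStep U (walk U k) :=
  Function.iterate_succ_apply' _ _ _

variable {U : Z → Matrix α α ℂ}

/-- The three-term recurrence of the Chebyshev polynomials, valid for every member of the family
before averaging. The involution property is needed only for k = 0. Afterwards the recurrence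
propagates because a step of the walk is additive and commutes with right multiplication by a fixed
matrix. -/
theorem walk_add_two (hU : ∀ z, U z * U z = 1) (k : ℕ) (z : Z) :
    walk U (k + 2) z + walk U k z = walk U (k + 1) z * ((-2 : ℂ) • average U) := by
  induction k generalizing z with
  | zero =>
    have h0 : walk U 0 = fun _ => 1 := rfl
    have h1 : walk U 1 = fun z => U z - (2 : ℂ) • average U := by
      rw [walk_succ, h0]
      funext z
      simp [walkStep]
    have h2 : (fun z => U z * walk U 1 z) = fun z => 1 + (-2 : ℂ) • (U z * average U) := by
      funext z
      rw [h1, mul_sub, hU, mul_smul_comm, neg_smul, sub_eq_add_neg]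
    have h3 : average (fun z => U z * walk U 1 z) = 1 + (-2 : ℂ) • (average U * average U) := by
      rw [h2, average_add, average_const, average_smul, average_mul_right]
    rw [walk_succ, walkStep, h3, zero_add, congrFun h2 z, h0, h1]
    simp only [sub_mul, mul_smul_comm, smul_mul_assoc, smul_add, smul_smul]
    module
  | succ k ih =>
    have hlin : ∀ (Ψ Φ Ξ : Z → Matrix α α ℂ) (x : Matrix α α ℂ), (∀ z, Ψ z + Φ z = Ξ z * x) →
        ∀ z, walkStep U Ψ z + walkStep U Φ z = walkStep U Ξ z * x := by
      intro Ψ Φ Ξ x h z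
      have h1 : average (fun z => U z * Ψ z) + average (fun z => U z * Φ z) =
          average (fun z => U z * Ξ z) * x := by
        rw [← average_add, ← average_mul_right]
        congr 1
        funext z
        rw [← mul_add, h, mul_assoc]
      simp only [walkStep]
      rw [sub_mul, mul_assoc, ← h, smul_mul_assoc, ← h1, mul_add, smul_add]
      abel
    have := hlin _ _ _ _ ih z
    rwa [← walk_succ, ← walk_succ, ← walk_succ] at this

open Polynomial in
-- Averaging the recurrence gives that of T_k. Two consecutive degrees are carried along because the
-- recurrence has order two. The argument is the negative of the average because the reflection is 1
-- − 2|u⟩⟨u|.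
theorem average_walk (hU : ∀ z, U z * U z = 1) (k : ℕ) :
    average (walk U k) = aeval (-average U) (Chebyshev.T ℝ k) ∧
      average (walk U (k + 1)) = aeval (-average U) (Chebyshev.T ℝ (k + 1)) := by
  induction k with
  | zero =>
    have h0 : walk U 0 = fun _ => 1 := rfl
    constructor
    · rw [h0, average_const]; simp
    · have h1 : walk U (0 + 1) = fun z => U z - (2 : ℂ) • average U := by
        rw [walk_succ, h0]
        funext z
        simp [walkStep]
      rw [h1]
      have : (fun z => U z - (2 : ℂ) • average U) = fun z => U z + (-2 : ℂ) • average U := by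
        funext z; rw [neg_smul, sub_eq_add_neg]
      rw [this, average_add, average_const]
      simp
      module
  | succ k ih =>
    refine ⟨by exact_mod_cast ih.2, ?_⟩
    have h : average (walk U (k + 2)) + average (walk U k) =
        average (walk U (k + 1)) * ((-2 : ℂ) • average U) := by
      rw [← average_add, ← average_mul_right]
      congr 1
      funext z
      exact walk_add_two hU k z
    rw [ih.1, ih.2] at h
    push_cast
    rw [show (k : ℤ) + 1 + 1 = k + 2 by ring, Chebyshev.T_add_two, ← eq_sub_iff_add_eq] at *
    have h2 : (2 * X : ℝ[X]) = X + X := two_mul X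
    have h3 : (-2 : ℂ) • average U = -average U + -average U := by module
    rw [h, map_sub, mul_comm (2 * X), h2, map_mul, map_add, aeval_X, h3]

/-- Unitarity of the walk: the involutions and the reflection both preserve the averaged Gram
matrix. This normalizes the state in the Hadamard test. -/
theorem average_conjTranspose_mul_walk (hU : ∀ z, U z * U z = 1)
    (hH : ∀ z, (U z).IsHermitian) (k : ℕ) :
    average (fun z => (walk U k z).conjTranspose * walk U k z) = 1 := by
  induction k with
  | zero =>
    have h0 : walk U 0 = fun _ => 1 := rfl
    simp [h0, average_const]
  | succ k ih =>
    set Φ := fun z => U z * walk U k z with hΦ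
    have h1 : ∀ z, walk U (k + 1) z = Φ z - (2 : ℂ) • average Φ := fun z => by
      rw [walk_succ]; rfl
    have h2 : average (fun z => (Φ z).conjTranspose * Φ z) = 1 := by
      rw [← ih]
      congr 1
      funext z
      rw [hΦ]
      simp only [Matrix.conjTranspose_mul, (hH z).eq]
      rw [mul_assoc, ← mul_assoc (U z), hU, one_mul]
    have h3 : (fun z => (walk U (k + 1) z).conjTranspose * walk U (k + 1) z) = fun z =>
        ((Φ z).conjTranspose * Φ z + (-2 : ℂ) • ((Φ z).conjTranspose * average Φ)) +
          ((-2 : ℂ) • ((average Φ).conjTranspose * Φ z) +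
            (4 : ℂ) • ((average Φ).conjTranspose * average Φ)) := by
      funext z
      rw [h1, Matrix.conjTranspose_sub, Matrix.conjTranspose_smul]
      simp only [sub_mul, mul_sub, smul_mul_assoc, mul_smul_comm, smul_sub, smul_smul]
      simp
      module
    rw [h3, average_add, average_add, average_add, h2, average_smul, average_smul,
      average_mul_right, average_mul_left, average_conjTranspose, average_const]
    module

end Walk

/-! ### Gates on labelled qubits -/

/-- The gates, on qubits labelled by `α`. -/
inductive LGate (α : Type*) where
  | had (q : α)
  | tee (q : α)
  | cnot (c t : α)
  | toffoli (a b t : α)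

section LGate

variable {α : Type*}

/-- The gate on the qubits of the machine, for an address map `π`. -/
def LGate.toGate (π : α → ℕ) : LGate α → Gate
  | .had q => .had (π q)
  | .tee q => .tee (π q)
  | .cnot c t => .cnot (π c) (π t)
  | .toffoli a b t => .toffoli (π a) (π b) (π t)

/-- The labels on which a gate acts. -/
def LGate.labels : LGate α → List α
  | .had q => [q]
  | .tee q => [q]
  | .cnot c t => [c, t]
  | .toffoli a b t => [a, b, t]

variable [DecidableEq α]

/-- A one-qubit operator applied to the qubit `q`. -/
def lapplyOne (U : Matrix (Fin 2) (Fin 2) ℂ) (q : α) (ψ : (α → Fin 2) → ℂ) : (α → Fin 2) → ℂ :=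
  fun x => ∑ b, U (x q) b * ψ (Function.update x q b)

/-- The action of a gate. -/
def LGate.apply : LGate α → ((α → Fin 2) → ℂ) → (α → Fin 2) → ℂ
  | .had q, ψ => lapplyOne hadMat q ψ
  | .tee q, ψ => lapplyOne teeMat q ψ
  | .cnot c t, ψ => if c = t then ψ else fun x => ψ (Function.update x t (x t + x c))
  | .toffoli a b t, ψ =>
      if a = t ∨ b = t then ψ else fun x => ψ (Function.update x t (x t + x a * x b))

/-- The action of a circuit, first gate first. -/
def lrun (gs : List (LGate α)) (ψ : (α → Fin 2) → ℂ) : (α → Fin 2) → ℂ :=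
  gs.foldl (fun ψ g => g.apply ψ) ψ

@[simp] theorem lrun_nil (ψ : (α → Fin 2) → ℂ) : lrun [] ψ = ψ := rfl

@[simp] theorem lrun_cons (g : LGate α) (gs : List (LGate α)) (ψ : (α → Fin 2) → ℂ) :
    lrun (g :: gs) ψ = lrun gs (g.apply ψ) := rfl

theorem lrun_append (gs hs : List (LGate α)) (ψ : (α → Fin 2) → ℂ) :
    lrun (gs ++ hs) ψ = lrun hs (lrun gs ψ) := List.foldl_append

/-! #### Reversible classical circuits -/

/-- The permutation of the bit strings given by a classical gate. -/
def LGate.flip : LGate α → (α → Fin 2) → α → Fin 2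
  | .had _, x => x
  | .tee _, x => x
  | .cnot c t, x => if c = t then x else Function.update x t (x t + x c)
  | .toffoli a b t, x => if a = t ∨ b = t then x else Function.update x t (x t + x a * x b)

/-- Controlled-not and Toffoli gates. -/
def LGate.IsClassical : LGate α → Prop
  | .had _ => False
  | .tee _ => False
  | .cnot _ _ => True
  | .toffoli _ _ _ => True

/-- The effect of a classical circuit on a bit string, first gate first. -/
def exec (gs : List (LGate α)) (x : α → Fin 2) : α → Fin 2 := gs.foldl (fun x g => g.flip x) x

@[simp] theorem exec_nil (x : α → Fin 2) : exec [] x = x := rfl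

@[simp] theorem exec_cons (g : LGate α) (gs : List (LGate α)) (x : α → Fin 2) :
    exec (g :: gs) x = exec gs (g.flip x) := rfl

theorem exec_append (gs hs : List (LGate α)) (x : α → Fin 2) :
    exec (gs ++ hs) x = exec hs (exec gs x) := List.foldl_append

theorem fin_two_add_add_self (a b : Fin 2) : a + b + b = a := by
  revert a b; decide

theorem LGate.flip_flip (g : LGate α) (x : α → Fin 2) : g.flip (g.flip x) = x := by
  cases g with
  | had => rfl
  | tee => rfl
  | cnot c t =>
    simp only [LGate.flip]
    split_ifs with h
    · rfl
    · simp [h, fin_two_add_add_self]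
  | toffoli a b t =>
    simp only [LGate.flip]
    split_ifs with h
    · rfl
    · rw [not_or] at h
      simp [h.1, h.2, fin_two_add_add_self]

theorem LGate.apply_of_isClassical {g : LGate α} (h : g.IsClassical) (ψ : (α → Fin 2) → ℂ)
    (x : α → Fin 2) : g.apply ψ x = ψ (g.flip x) := by
  cases g with
  | had => exact h.elim
  | tee => exact h.elim
  | cnot c t => simp only [LGate.apply, LGate.flip]; split_ifs <;> rfl
  | toffoli a b t => simp only [LGate.apply, LGate.flip]; split_ifs <;> rfl

theorem exec_reverse_exec (gs : List (LGate α)) (x : α → Fin 2) :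
    exec gs.reverse (exec gs x) = x := by
  induction gs generalizing x with
  | nil => rfl
  | cons g gs ih =>
    rw [List.reverse_cons, exec_append]
    change g.flip (exec gs.reverse (exec gs (g.flip x))) = x
    rw [ih, LGate.flip_flip]

/-- Amplitudes are pulled back along the inverse permutation, which is the reversed circuit because
each classical gate is its own inverse. -/
theorem lrun_of_isClassical {gs : List (LGate α)} (h : ∀ g ∈ gs, g.IsClassical)
    (ψ : (α → Fin 2) → ℂ) (x : α → Fin 2) : lrun gs ψ x = ψ (exec gs.reverse x) := by
  induction gs generalizing ψ with
  | nil => rfl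
  | cons g gs ih =>
    rw [lrun_cons, ih fun g hg => h g (List.mem_cons_of_mem _ hg),
      LGate.apply_of_isClassical (h g List.mem_cons_self), List.reverse_cons, exec_append]
    rfl

/-- Compute, act, uncompute: the inner circuit is evaluated at the computed bit string. -/
theorem lrun_conj_of_isClassical {gs : List (LGate α)} (h : ∀ g ∈ gs, g.IsClassical)
    (hs : List (LGate α)) (ψ : (α → Fin 2) → ℂ) (x : α → Fin 2) :
    lrun (gs ++ hs ++ gs.reverse) ψ x =
      lrun hs (fun y => ψ (exec gs.reverse y)) (exec gs x) := by
  rw [lrun_append, lrun_append, lrun_of_isClassical (by simpa using h), List.reverse_reverse]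
  congr 2
  funext y
  exact lrun_of_isClassical h ψ y

/-! #### Phases -/

/-- The sign `(-1)^b`. -/
def bitSign (b : Fin 2) : ℂ := (-1) ^ (b : ℕ)

@[simp] theorem bitSign_zero : bitSign 0 = 1 := by simp [bitSign]

@[simp] theorem bitSign_one : bitSign 1 = -1 := by simp [bitSign]

theorem bitSign_mul_self (b : Fin 2) : bitSign b * bitSign b = 1 := by
  fin_cases b <;> simp

theorem LGate.apply_tee (q : α) (ψ : (α → Fin 2) → ℂ) (x : α → Fin 2) :
    (LGate.tee q).apply ψ x = teeMat (x q) (x q) * ψ x := by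
  have h : ∀ b : Fin 2, x q = b → (LGate.tee q).apply ψ x = teeMat (x q) (x q) * ψ x := by
    intro b hb
    have hu : Function.update x q b = x := by rw [← hb, Function.update_eq_self]
    rw [LGate.apply, lapplyOne, Finset.sum_eq_single b, hb, hu]
    · intro c _ hc
      have : teeMat b c = 0 := by fin_cases b <;> fin_cases c <;> simp [teeMat] at hc ⊢
      rw [hb, this, zero_mul]
    · simp
  exact h _ rfl

/-- The phase gate `T²`. -/
def sGate (q : α) : List (LGate α) := [.tee q, .tee q]

/-- The phase gate `T⁴`. -/
def zGate (q : α) : List (LGate α) := [.tee q, .tee q, .tee q, .tee q]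

theorem lrun_sGate (q : α) (ψ : (α → Fin 2) → ℂ) (x : α → Fin 2) :
    lrun (sGate q) ψ x = if x q = 0 then ψ x else Complex.I * ψ x := by
  simp only [sGate, lrun_cons, lrun_nil, LGate.apply_tee, ← mul_assoc]
  have h : ∀ b : Fin 2, teeMat b b * teeMat b b = if b = 0 then 1 else Complex.I := by
    intro b
    fin_cases b
    · simp [teeMat]
    · simp only [teeMat, Matrix.of_apply]
      simp only [Fin.mk_one, Matrix.cons_val_one, Matrix.cons_val_fin_one, one_ne_zero, if_false]
      rw [← Complex.exp_add, show (Real.pi / 4 * Complex.I + Real.pi / 4 * Complex.I : ℂ) =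
        Real.pi / 2 * Complex.I by ring, Complex.exp_pi_div_two_mul_I]
  rw [h]
  split_ifs <;> simp

theorem lrun_zGate (q : α) (ψ : (α → Fin 2) → ℂ) (x : α → Fin 2) :
    lrun (zGate q) ψ x = bitSign (x q) * ψ x := by
  have : zGate q = sGate q ++ sGate q := rfl
  rw [this, lrun_append, lrun_sGate, lrun_sGate]
  have h : x q = 0 ∨ x q = 1 := by omega
  rcases h with h | h
  · simp [h]
  · rw [if_neg (by simp [h]), if_neg (by simp [h]), ← mul_assoc, Complex.I_mul_I, h]
    simp

/-! #### Hadamard gates -/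

/-- The normalization of the Hadamard gate. -/
def hadNorm : ℂ := ((1 / Real.sqrt 2 : ℝ) : ℂ)

theorem hadNorm_sq : hadNorm * hadNorm = 1 / 2 := by
  rw [hadNorm, ← Complex.ofReal_mul, div_mul_div_comm, one_mul,
    Real.mul_self_sqrt (by norm_num)]
  push_cast
  rfl

theorem conj_hadNorm : starRingEnd ℂ hadNorm = hadNorm := Complex.conj_ofReal _

theorem hadMat_apply (a b : Fin 2) : hadMat a b = hadNorm * bitSign (a * b) := by
  fin_cases a <;> fin_cases b <;> simp [hadMat, hadNorm]

theorem LGate.apply_had (q : α) (ψ : (α → Fin 2) → ℂ) (x : α → Fin 2) :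
    (LGate.had q).apply ψ x =
      hadNorm * ∑ b, bitSign (x q * b) * ψ (Function.update x q b) := by
  rw [LGate.apply, lapplyOne, Finset.mul_sum]
  simp only [hadMat_apply, mul_assoc]

theorem LGate.apply_had_had (q : α) (ψ : (α → Fin 2) → ℂ) :
    (LGate.had q).apply ((LGate.had q).apply ψ) = ψ := by
  funext x
  simp only [LGate.apply_had, Function.update_self, Function.update_idem, Fin.sum_univ_two]
  have h : x q = 0 ∨ x q = 1 := by omega
  have hx : Function.update x q (x q) = x := Function.update_eq_self _ _
  rcases h with h | h <;> rw [h] at hx ⊢ <;> simp <;> rw [hx] <;>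
    linear_combination 2 * ψ x * hadNorm_sq

theorem LGate.apply_had_comm (p q : α) (ψ : (α → Fin 2) → ℂ) :
    (LGate.had p).apply ((LGate.had q).apply ψ) = (LGate.had q).apply ((LGate.had p).apply ψ) := by
  by_cases h : p = q
  · rw [h]
  · funext x
    simp only [LGate.apply_had, Fin.sum_univ_two, Function.update_of_ne h,
      Function.update_of_ne (Ne.symm h)]
    simp only [Function.update_comm h]
    ring

/-- A layer of Hadamard gates. -/
def hadLayer (qs : List α) : List (LGate α) := qs.map .had

theorem lrun_hadLayer_apply_had (qs : List α) (q : α) (ψ : (α → Fin 2) → ℂ) :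
    lrun (hadLayer qs) ((LGate.had q).apply ψ) = (LGate.had q).apply (lrun (hadLayer qs) ψ) := by
  induction qs generalizing ψ with
  | nil => rfl
  | cons p qs ih =>
    simp only [hadLayer, List.map_cons, lrun_cons] at ih ⊢
    rw [LGate.apply_had_comm, ih]

theorem lrun_hadLayer_hadLayer (qs : List α) (ψ : (α → Fin 2) → ℂ) :
    lrun (hadLayer qs) (lrun (hadLayer qs) ψ) = ψ := by
  induction qs generalizing ψ with
  | nil => rfl
  | cons q qs ih =>
    have h : ∀ φ, lrun (hadLayer (q :: qs)) φ = (LGate.had q).apply (lrun (hadLayer qs) φ) :=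
      fun φ => lrun_hadLayer_apply_had qs q φ
    rw [h, h, lrun_hadLayer_apply_had, LGate.apply_had_had, ih]

open Classical in
/-- The state that is constant on the bit strings that vanish off `S`, and zero elsewhere. -/
def uniformOn (S : Set α) (x : α → Fin 2) : ℂ := if ∀ q ∉ S, x q = 0 then 1 else 0

theorem lrun_hadLayer_uniformOn (qs : List α) (hq : qs.Nodup) (S : Set α)
    (hS : ∀ q ∈ qs, q ∉ S) (c : ℂ) :
    lrun (hadLayer qs) (fun x => c * uniformOn S x) =
      fun x => c * hadNorm ^ qs.length * uniformOn (S ∪ {q | q ∈ qs}) x := by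
  induction qs generalizing S c with
  | nil => simp [hadLayer]
  | cons q qs ih =>
    have h1 : (LGate.had q).apply (fun x => c * uniformOn S x) =
        fun x => c * hadNorm * uniformOn (S ∪ {q}) x := by
      funext x
      have hqS : q ∉ S := hS q List.mem_cons_self
      rw [LGate.apply_had, Fin.sum_univ_two]
      have e1 : uniformOn S (Function.update x q 1) = 0 := by
        rw [uniformOn, if_neg]
        intro h
        simpa using h q hqS
      have e2 : uniformOn S (Function.update x q 0) = uniformOn (S ∪ {q}) x := by
        unfold uniformOn
        congr 1
        apply propext
        constructor
        · intro h p hp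
          simp only [Set.mem_union, Set.mem_singleton_iff, not_or] at hp
          simpa [hp.2] using h p hp.1
        · intro h p hp
          by_cases hpq : p = q
          · subst hpq; simp
          · simpa [hpq] using h p (by simp [hp, hpq])
      rw [e1, e2]
      simp
      ring
    rw [hadLayer, List.map_cons, lrun_cons, h1]
    rw [List.nodup_cons] at hq
    have h2 := ih hq.2 (S ∪ {q}) (by
      intro p hp
      simp only [Set.mem_union, Set.mem_singleton_iff, not_or]
      exact ⟨hS p (List.mem_cons_of_mem _ hp), fun h => hq.1 (h ▸ hp)⟩) (c * hadNorm)
    rw [hadLayer] at h2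
    rw [h2]
    funext x
    rw [List.length_cons, pow_succ']
    have : S ∪ {q} ∪ {p | p ∈ qs} = S ∪ {p | p ∈ q :: qs} := by
      ext p
      simp
      tauto
    rw [this]
    ring

/-- The bit string `x` with the bits at `f 0, …, f (k - 1)` replaced by `z`. -/
def overwrite {k : ℕ} (f : Fin k → α) (x : α → Fin 2) (z : Fin k → Fin 2) : α → Fin 2 :=
  fun q => if h : ∃ v, f v = q then z h.choose else x q

theorem overwrite_apply {k : ℕ} {f : Fin k → α} (hf : Function.Injective f) (x : α → Fin 2)
    (z : Fin k → Fin 2) (v : Fin k) : overwrite f x z (f v) = z v := by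
  have h : ∃ w, f w = f v := ⟨v, rfl⟩
  rw [overwrite, dif_pos h]
  congr 1
  exact hf h.choose_spec

theorem overwrite_of_ne {k : ℕ} {f : Fin k → α} (x : α → Fin 2)
    (z : Fin k → Fin 2) {q : α} (hq : ∀ v, f v ≠ q) : overwrite f x z q = x q := by
  rw [overwrite, dif_neg]
  push Not
  exact hq

theorem overwrite_overwrite {k : ℕ} {f : Fin k → α} (x : α → Fin 2)
    (z w : Fin k → Fin 2) : overwrite f (overwrite f x z) w = overwrite f x w := by
  funext q
  unfold overwrite
  split_ifs <;> rfl

theorem overwrite_self {k : ℕ} {f : Fin k → α} (x : α → Fin 2) :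
    overwrite f x (fun v => x (f v)) = x := by
  funext q
  unfold overwrite
  split_ifs with h
  · exact congrArg x h.choose_spec
  · rfl

/-- A layer of one-qubit operations that are controlled by bits outside of the layer. -/
theorem lrun_layer {σ : Type*} {k : ℕ} {f : Fin k → α} (hf : Function.Injective f)
    (s : (α → Fin 2) → σ) (hs : ∀ x v b, s (Function.update x (f v) b) = s x)
    (G : Fin k → List (LGate α)) (V : σ → Fin k → Matrix (Fin 2) (Fin 2) ℂ)
    (hG : ∀ v ψ x, lrun (G v) ψ x = ∑ b, V (s x) v (x (f v)) b * ψ (Function.update x (f v) b))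
    (ψ : (α → Fin 2) → ℂ) (x : α → Fin 2) :
    lrun (List.ofFn G).flatten ψ x =
      ∑ z : Fin k → Fin 2, (∏ v, V (s x) v (x (f v)) (z v)) * ψ (overwrite f x z) := by
  -- Stated for arbitrary subfamilies `g` of the layer, so that the assertion survives the induction
  -- on `k`.
  have hsover : ∀ (j : ℕ) (g : Fin j → Fin k) (x : α → Fin 2) (z : Fin j → Fin 2),
      Function.Injective g → s (overwrite (fun v => f (g v)) x z) = s x := by
    intro j
    induction j with
    | zero =>
      intro g x z _
      rw [show overwrite (fun v => f (g v)) x z = x from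
        funext fun q => overwrite_of_ne x _ fun v => v.elim0]
    | succ j ih =>
      intro g x z hg
      have h1 : overwrite (fun v => f (g v)) x z =
          Function.update (overwrite (fun v : Fin j => f (g v.succ)) x fun v => z v.succ)
            (f (g 0)) (z 0) := by
        funext q
        by_cases hq : ∃ v, f (g v) = q
        · obtain ⟨v, rfl⟩ := hq
          rw [overwrite_apply (f := fun v => f (g v)) (hf.comp hg)]
          refine Fin.cases ?_ (fun v => ?_) v
          · simp
          · rw [Function.update_of_ne (fun h => Fin.succ_ne_zero v (hg (hf h)))]
            exact (overwrite_apply (f := fun v : Fin j => f (g v.succ))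
              (hf.comp (hg.comp (Fin.succ_injective j))) x (fun v => z v.succ) v).symm
        · push Not at hq
          rw [overwrite_of_ne _ _ hq, Function.update_of_ne (Ne.symm (hq 0)),
            overwrite_of_ne _ _ fun v => hq v.succ]
      rw [h1, hs]
      exact ih (fun v => g v.succ) x _ (hg.comp (Fin.succ_injective j))
  induction k generalizing ψ x with
  | zero =>
    simp only [List.ofFn_zero, List.flatten_nil, lrun_nil,
      Finset.univ_unique, Finset.sum_singleton, Finset.univ_eq_empty, Finset.prod_empty, one_mul]
    exact congrArg ψ (funext fun q => (overwrite_of_ne x _ fun v => v.elim0).symm)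
  | succ k ih =>
    have hf' : Function.Injective fun v : Fin k => f v.succ :=
      hf.comp (Fin.succ_injective k)
    have hs0 := hsover k Fin.succ
    rw [List.ofFn_succ, List.flatten_cons, lrun_append,
      ih hf' (fun x v b => hs x v.succ b) (fun v => G v.succ) (fun t v => V t v.succ)
        (fun v => hG v.succ) (lrun (G 0) ψ) x
        (fun j g x z hg => hsover j (fun v => (g v).succ) x z ((Fin.succ_injective k).comp hg)),
      ← (Fin.consEquiv fun _ => Fin 2).sum_comp, Fintype.sum_prod_type_right]
    refine Finset.sum_congr rfl fun z _ => ?_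
    have h0 : overwrite (fun v : Fin k => f v.succ) x z (f 0) = x (f 0) :=
      overwrite_of_ne _ _ fun v h => Fin.succ_ne_zero v (hf h)
    rw [hG, h0, hs0 x z (Fin.succ_injective k), Finset.mul_sum]
    refine Finset.sum_congr rfl fun b _ => ?_
    rw [Fin.prod_univ_succ]
    simp only [Fin.consEquiv_apply, Fin.cons_zero, Fin.cons_succ]
    have : Function.update (overwrite (fun v : Fin k => f v.succ) x z) (f 0) b =
        overwrite f x (Fin.cons b z) := by
      funext q
      by_cases hq : ∃ v, f v = q
      · obtain ⟨v, rfl⟩ := hq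
        rw [overwrite_apply hf]
        refine Fin.cases ?_ (fun v => ?_) v
        · simp
        · rw [Function.update_of_ne (fun h => Fin.succ_ne_zero v (hf h)), Fin.cons_succ]
          exact overwrite_apply hf' x z v
      · push Not at hq
        rw [overwrite_of_ne _ _ hq, Function.update_of_ne (Ne.symm (hq 0)),
          overwrite_of_ne _ _ fun v => hq v.succ]
    rw [this]
    change _ = _ * ψ (overwrite f x (Fin.cons b z))
    ring

omit [DecidableEq α] in
theorem hadLayer_ofFn {k : ℕ} (f : Fin k → α) :
    hadLayer (List.ofFn f) = (List.ofFn fun v => [LGate.had (f v)]).flatten := by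
  induction k with
  | zero => simp [hadLayer]
  | succ k ih =>
    rw [List.ofFn_succ, List.ofFn_succ, List.flatten_cons, ← ih]
    rfl

theorem lrun_hadLayer {k : ℕ} {f : Fin k → α} (hf : Function.Injective f)
    (ψ : (α → Fin 2) → ℂ) (x : α → Fin 2) :
    lrun (hadLayer (List.ofFn f)) ψ x = hadNorm ^ k *
      ∑ z : Fin k → Fin 2, (∏ v, bitSign (x (f v) * z v)) * ψ (overwrite f x z) := by
  rw [hadLayer_ofFn, lrun_layer hf (fun _ => ()) (fun _ _ _ => rfl) _ (fun _ _ => hadMat)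
    (fun v ψ x => rfl), Finset.mul_sum]
  refine Finset.sum_congr rfl fun z _ => ?_
  simp only [hadMat_apply, Finset.prod_mul_distrib, Finset.prod_const, Finset.card_univ,
    Fintype.card_fin]
  ring

/-! #### Controlled Pauli operators -/

/-- The controlled `σ_z`. -/
def czGate (c t : α) : List (LGate α) := [.had t, .cnot c t, .had t]

theorem lrun_czGate {c t : α} (h : c ≠ t) (ψ : (α → Fin 2) → ℂ) (x : α → Fin 2) :
    lrun (czGate c t) ψ x = bitSign (x c * x t) * ψ x := by
  have hx : Function.update x t (x t) = x := Function.update_eq_self _ _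
  simp only [czGate, lrun_cons, lrun_nil, LGate.apply_had]
  simp only [LGate.apply, h, if_false, lapplyOne, hadMat_apply, Function.update_self,
    Function.update_idem, Function.update_of_ne h, Fin.sum_univ_two]
  have ht : x t = 0 ∨ x t = 1 := by omega
  have hc : x c = 0 ∨ x c = 1 := by omega
  rcases ht with ht | ht <;> rcases hc with hc | hc <;> rw [ht] at hx ⊢ <;> rw [hc] <;>
    simp <;> rw [hx]
  · linear_combination 2 * ψ x * hadNorm_sq
  · linear_combination 2 * ψ x * hadNorm_sq
  · linear_combination 2 * ψ x * hadNorm_sq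
  · linear_combination -2 * ψ x * hadNorm_sq

/-- The transpose of a Pauli operator on `t`, controlled by `c`. -/
def ctrlPauli (c t : α) : Pauli → List (LGate α)
  | .I => []
  | .X => [.cnot c t]
  | .Y => .cnot c t :: czGate c t ++ sGate c
  | .Z => czGate c t

/-- Row and column are exchanged in the sum, so the circuit acts by the transpose. This matters only
for Y, the one Pauli matrix that is not symmetric; its factor i becomes a phase gate on the control.
-/
theorem lrun_ctrlPauli {c t : α} (h : c ≠ t) (P : Pauli) (ψ : (α → Fin 2) → ℂ)
    (x : α → Fin 2) : lrun (ctrlPauli c t P) ψ x =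
      ∑ b, (if x c = 0 then (1 : Matrix _ _ ℂ) else P.mat) b (x t) *
        ψ (Function.update x t b) := by
  have hx : Function.update x t (x t) = x := Function.update_eq_self _ _
  have ht : x t = 0 ∨ x t = 1 := by omega
  have hc : x c = 0 ∨ x c = 1 := by omega
  cases P
  · rcases ht with ht | ht <;> rcases hc with hc | hc <;> rw [ht] at hx <;>
      simp [ctrlPauli, hc, ht, hx, Pauli.mat] <;>
      rw [ht, Matrix.one_apply_eq, one_mul]
  · rcases ht with ht | ht <;> rcases hc with hc | hc <;> rw [ht] at hx <;>
      simp [ctrlPauli, LGate.apply, h, hc, ht, hx, Pauli.mat] <;>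
      rw [ht, Matrix.one_apply_eq, one_mul]
  · rw [ctrlPauli, List.cons_append, lrun_cons, lrun_append, lrun_sGate, lrun_czGate h]
    rcases ht with ht | ht <;> rcases hc with hc | hc <;> rw [ht] at hx <;>
      simp [LGate.apply, h, hc, ht, hx, Pauli.mat] <;>
      rw [ht, Matrix.one_apply_eq, one_mul]
  · rw [ctrlPauli, lrun_czGate h]
    rcases ht with ht | ht <;> rcases hc with hc | hc <;> rw [ht] at hx <;>
      simp [hc, ht, hx, Pauli.mat] <;>
      rw [ht, Matrix.one_apply_eq, one_mul]

/-- The transpose of the negative of a Pauli group operator on the qubits `f`, controlled by `c`. -/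
def ctrlEntry {n : ℕ} (c : α) (f : Fin n → α) (P : SignedPauli n) : List (LGate α) :=
  (if P.1 = 0 then zGate c else []) ++ (List.ofFn fun k => ctrlPauli c (f k) (P.2 k)).flatten

/-- A matrix, applied to the qubits `f`. -/
def actOn {n : ℕ} (f : Fin n → α) (K : Matrix (Basis n) (Basis n) ℂ) (ψ : (α → Fin 2) → ℂ)
    (x : α → Fin 2) : ℂ := ∑ a, K (fun k => x (f k)) a * ψ (overwrite f x a)

theorem actOn_one {n : ℕ} {f : Fin n → α} (c : ℂ) (ψ : (α → Fin 2) → ℂ) (x : α → Fin 2) :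
    actOn f (c • (1 : Matrix (Basis n) (Basis n) ℂ)) ψ x = c * ψ x := by
  rw [actOn, Finset.sum_eq_single fun k => x (f k)]
  · rw [overwrite_self]
    simp
  · intro a _ ha
    simp [Matrix.one_apply_ne ha.symm]
  · simp

/-- A sign of a controlled operator is a phase of its control. Since the negative of the entry is
wanted, the control receives a `σ_z` exactly when the sign bit of the entry is 0. -/
theorem lrun_ctrlEntry {n : ℕ} {c : α} {f : Fin n → α} (hf : Function.Injective f)
    (hc : ∀ k, f k ≠ c) (P : SignedPauli n) (ψ : (α → Fin 2) → ℂ) (x : α → Fin 2) :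
    lrun (ctrlEntry c f P) ψ x =
      if x c = 0 then ψ x else actOn f (-(SignedPauli.mat P).transpose) ψ x := by
  rw [ctrlEntry, lrun_append, lrun_layer hf (fun x => x c)
    (fun x v b => by simp [Function.update_of_ne (hc v).symm]) _
    (fun t k => (if t = 0 then (1 : Matrix _ _ ℂ) else (P.2 k).mat).transpose)
    (fun k ψ x => by rw [lrun_ctrlPauli (hc k).symm]; rfl)]
  have hsign : ∀ y : α → Fin 2, lrun (if P.1 = 0 then zGate c else []) ψ y =
      (if P.1 = 0 then bitSign (y c) else 1) * ψ y := by
    intro y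
    split_ifs
    · exact lrun_zGate c ψ y
    · simp
  have hover : ∀ z, overwrite f x z c = x c := fun z => overwrite_of_ne _ _ hc
  simp only [hsign, hover]
  have hx : x c = 0 ∨ x c = 1 := by omega
  have hP : P.1 = 0 ∨ P.1 = 1 := by omega
  rcases hx with hx | hx
  · simp only [hx, if_true]
    rw [Finset.sum_eq_single fun k => x (f k)]
    · rw [overwrite_self]; simp
    · intro z _ hz
      obtain ⟨k, hk⟩ := Function.ne_iff.1 hz
      rw [Finset.prod_eq_zero (Finset.mem_univ k), zero_mul]
      rw [Matrix.transpose_apply, Matrix.one_apply_ne hk]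
    · simp
  · simp only [hx, one_ne_zero, if_false, actOn]
    refine Finset.sum_congr rfl fun z _ => ?_
    rcases hP with hP | hP <;> simp [SignedPauli.mat, tensor, hP]

/-! #### Controlled operations of which at most one is active -/

section OneHot

variable {n : ℕ} {f : Fin n → α} {ι : Type*} {g : ι → List (LGate α)} {c : ι → α}
  {K : ι → (α → Fin 2) → Matrix (Basis n) (Basis n) ℂ}
  (hg : ∀ i ψ x, lrun (g i) ψ x = if x (c i) = 0 then ψ x else actOn f (K i x) ψ x)

include hg

theorem lrun_flatMap_of_inactive {L : List ι} {x : α → Fin 2} (hx : ∀ i ∈ L, x (c i) = 0)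
    (ψ : (α → Fin 2) → ℂ) : lrun (L.flatMap g) ψ x = ψ x := by
  induction L generalizing ψ with
  | nil => rfl
  | cons i L ih =>
    rw [List.flatMap_cons, lrun_append, ih fun j hj => hx j (List.mem_cons_of_mem _ hj), hg,
      if_pos (hx i List.mem_cons_self)]

/-- The controls are disjoint from the qubits acted on, so the active operation does not switch the
others on or off. -/
theorem lrun_flatMap_of_active (hcf : ∀ i k, f k ≠ c i) {L : List ι} (hL : L.Nodup) {i : ι}
    (hi : i ∈ L) {x : α → Fin 2} (hxi : x (c i) ≠ 0) (hx : ∀ j ∈ L, j ≠ i → x (c j) = 0)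
    (ψ : (α → Fin 2) → ℂ) : lrun (L.flatMap g) ψ x = actOn f (K i x) ψ x := by
  obtain ⟨L₁, L₂, rfl⟩ := List.append_of_mem hi
  have hnd := List.nodup_append.1 hL
  have h2 : ∀ j ∈ L₂, x (c j) = 0 := fun j hj =>
    hx j (by simp [hj]) fun h => (List.nodup_cons.1 hnd.2.1).1 (h ▸ hj)
  have h1 : ∀ j ∈ L₁, x (c j) = 0 := fun j hj =>
    hx j (by simp [hj]) fun h => hnd.2.2 j hj i List.mem_cons_self h
  rw [List.flatMap_append, List.flatMap_cons, lrun_append, lrun_append,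
    lrun_flatMap_of_inactive hg h2, hg, if_neg hxi, actOn, actOn]
  refine Finset.sum_congr rfl fun a _ => ?_
  rw [lrun_flatMap_of_inactive hg]
  intro j hj
  rw [overwrite_of_ne _ _ fun k => hcf j k, h1 j hj]

/-- Handles bit strings with dirty ancillas: the operations mix only amplitudes that differ in the
bits at `f`, and all of these vanish. -/
theorem lrun_flatMap_eq_zero {L : List ι} {x : α → Fin 2} {ψ : (α → Fin 2) → ℂ}
    (hψ : ∀ a, ψ (overwrite f x a) = 0) : lrun (L.flatMap g) ψ x = 0 := by
  have key : ∀ i (ψ : (α → Fin 2) → ℂ) (x : α → Fin 2), (∀ a, ψ (overwrite f x a) = 0) →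
      lrun (g i) ψ x = 0 := by
    intro i ψ x h
    have := h fun k => x (f k)
    rw [overwrite_self] at this
    rw [hg]
    split_ifs
    · exact this
    · exact Finset.sum_eq_zero fun a _ => by rw [h, mul_zero]
  induction L generalizing ψ with
  | nil =>
    have := hψ fun k => x (f k)
    rwa [overwrite_self] at this
  | cons i L ih =>
    rw [List.flatMap_cons, lrun_append]
    exact ih fun a => key i ψ _ fun a' => by rw [overwrite_overwrite, hψ]

end OneHot

end LGate

/-! ### Decoding a register into a path of a binary tree -/

section Tree

/-- The bits of the nodes of a binary heap: the root carries `c`, and a node passes its bit to one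
of its children, selected by `J`. -/
def treeBit (J : ℕ → Fin 2) (c : Fin 2) : ℕ → Fin 2
  | 0 => c
  | w + 1 => if w % 2 = 1 then treeBit J c (w / 2) * J (w / 2)
      else treeBit J c (w / 2) + treeBit J c (w / 2) * J (w / 2)

theorem treeBit_left (J : ℕ → Fin 2) (c : Fin 2) (v : ℕ) :
    treeBit J c (2 * v + 1) = treeBit J c v + treeBit J c v * J v := by
  rw [treeBit, if_neg (by omega), show 2 * v / 2 = v by omega]

theorem treeBit_right (J : ℕ → Fin 2) (c : Fin 2) (v : ℕ) :
    treeBit J c (2 * v + 2) = treeBit J c v * J v := by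
  rw [treeBit, if_pos (by omega), show (2 * v + 1) / 2 = v by omega]

theorem treeBit_zero (J : ℕ → Fin 2) (u : ℕ) : treeBit J 0 u = 0 := by
  induction u using Nat.strong_induction_on with
  | _ u ih =>
    cases u with
    | zero => rw [treeBit]
    | succ w => rw [treeBit, ih (w / 2) (by omega)]; simp

theorem treeBit_congr {J J' : ℕ → Fin 2} (c : Fin 2) {v : ℕ} (h : ∀ u < v, J u = J' u) {u : ℕ}
    (hu : u ≤ v) : treeBit J c u = treeBit J' c u := by
  induction u using Nat.strong_induction_on with
  | _ u ih =>
    cases u with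
    | zero => rw [treeBit, treeBit]
    | succ w => rw [treeBit, treeBit, ih (w / 2) (by omega) (by omega), h (w / 2) (by omega)]

/-- A single token descends from the root. From position j₀ of one level it moves to position 2j₀ or
2j₀ + 1 of the next, according to the bit of J at the node it leaves. -/
theorem exists_treeBit_leaf (J : ℕ → Fin 2) (t : ℕ) :
    ∃ j₀ < 2 ^ t, ∀ j < 2 ^ t, treeBit J 1 (2 ^ t - 1 + j) = if j = j₀ then 1 else 0 := by
  induction t with
  | zero => exact ⟨0, by simp, fun j hj => by
      rw [pow_zero] at hj
      obtain rfl : j = 0 := by omega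
      simp [treeBit]⟩
  | succ t ih =>
    obtain ⟨j₀, hj₀, h⟩ := ih
    have hp : 0 < 2 ^ t := by positivity
    have hlt : (J (2 ^ t - 1 + j₀) : ℕ) < 2 := (J (2 ^ t - 1 + j₀)).2
    refine ⟨2 * j₀ + (J (2 ^ t - 1 + j₀) : ℕ), by rw [pow_succ]; omega, fun j hj => ?_⟩
    rw [pow_succ] at hj ⊢
    have hj' : j / 2 < 2 ^ t := by omega
    have hJ : J (2 ^ t - 1 + j₀) = 0 ∨ J (2 ^ t - 1 + j₀) = 1 := by omega
    rcases Nat.even_or_odd' j with ⟨i, rfl | rfl⟩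
    · rw [show 2 ^ t * 2 - 1 + 2 * i = 2 * (2 ^ t - 1 + i) + 1 by omega, treeBit_left,
        h i (by omega)]
      by_cases hi : i = j₀
      · subst hi
        rcases hJ with hJ | hJ <;> simp [hJ]
      · rw [if_neg hi, if_neg (by omega)]; simp
    · rw [show 2 ^ t * 2 - 1 + (2 * i + 1) = 2 * (2 ^ t - 1 + i) + 2 by omega, treeBit_right,
        h i (by omega)]
      by_cases hi : i = j₀
      · subst hi
        rcases hJ with hJ | hJ <;> simp [hJ]
      · rw [if_neg hi, if_neg (by omega)]; simp

/-- A finite string of bits, followed by zeros. -/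
def extendBits {N : ℕ} (z : Fin N → Fin 2) (v : ℕ) : Fin 2 := if h : v < N then z ⟨v, h⟩ else 0

/-- The string `z` with the bit `v` flipped. -/
def flipBit {N : ℕ} (v : Fin N) (z : Fin N → Fin 2) : Fin N → Fin 2 :=
  Function.update z v (z v + 1)

theorem flipBit_involutive {N : ℕ} (v : Fin N) : Function.Involutive (flipBit v) := by
  intro z
  simp [flipBit, fin_two_add_add_self]

theorem sum_flipBit {N : ℕ} (v : Fin N) (F : (Fin N → Fin 2) → ℂ) :
    ∑ z, F (flipBit v z) = ∑ z, F z :=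
  Equiv.sum_comp (flipBit_involutive v).toPerm F

theorem extendBits_flipBit_of_ne {N : ℕ} (v : Fin N) (z : Fin N → Fin 2) {u : ℕ}
    (h : u ≠ v) : extendBits (flipBit v z) u = extendBits z u := by
  unfold extendBits flipBit
  split_ifs with hu
  · rw [Function.update_of_ne]
    intro he
    exact h (congrArg Fin.val he)
  · rfl

theorem extendBits_flipBit_self {N : ℕ} (v : Fin N) (z : Fin N → Fin 2) :
    extendBits (flipBit v z) v = extendBits z v + 1 := by
  simp [extendBits, flipBit]

theorem treeBit_flipBit {N : ℕ} (v : Fin N) (z : Fin N → Fin 2) (c : Fin 2) :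
    treeBit (extendBits (flipBit v z)) c v = treeBit (extendBits z) c v :=
  treeBit_congr c (fun _ hu => extendBits_flipBit_of_ne v z hu.ne) le_rfl

/-- The indicator function of a bit. -/
def bitInd (b : Fin 2) : ℂ := if b = 0 then 0 else 1

/-- Whether node v is reached depends only on bits with smaller index. Flipping bit v therefore
keeps the first factor and negates the second. -/
theorem sum_treeBit_mul_sign_eq_zero {N : ℕ} (v : Fin N) :
    ∑ z : Fin N → Fin 2, bitInd (treeBit (extendBits z) 1 v) * bitSign (extendBits z v) = 0 := by
  have h := sum_flipBit v fun z => bitInd (treeBit (extendBits z) 1 v) * bitSign (extendBits z v)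
  simp only [treeBit_flipBit, extendBits_flipBit_self] at h
  have h2 : ∀ b : Fin 2, bitSign (b + 1) = -bitSign b := by
    intro b; fin_cases b <;> simp
  simp only [h2, mul_neg, Finset.sum_neg_distrib] at h
  exact self_eq_neg.1 h.symm

/-- Flipping the bit of a node exchanges its children, so each child receives half of the weight of
the parent. -/
theorem sum_treeBit_leaf {N : ℕ} (t j : ℕ) (hj : j < 2 ^ t) (hN : 2 ^ t - 1 ≤ N) :
    ∑ z : Fin N → Fin 2, bitInd (treeBit (extendBits z) 1 (2 ^ t - 1 + j)) =
      2 ^ N / 2 ^ t := by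
  induction t generalizing j with
  | zero =>
    obtain rfl : j = 0 := by simpa using hj
    simp [treeBit, bitInd]
  | succ t ih =>
    have hp : 0 < 2 ^ t := by positivity
    rw [pow_succ] at hj hN
    have key : ∀ v : Fin N,
        ∑ z : Fin N → Fin 2, bitInd (treeBit (extendBits z) 1 (2 * v + 1)) =
          (∑ z : Fin N → Fin 2, bitInd (treeBit (extendBits z) 1 v)) / 2 ∧
        ∑ z : Fin N → Fin 2, bitInd (treeBit (extendBits z) 1 (2 * v + 2)) =
          (∑ z : Fin N → Fin 2, bitInd (treeBit (extendBits z) 1 v)) / 2 := by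
      intro v
      have h1 := sum_flipBit v fun z => bitInd (treeBit (extendBits z) 1 (2 * v + 1))
      simp only [treeBit_left, treeBit_flipBit, extendBits_flipBit_self] at h1
      have e1 : ∀ a b : Fin 2, a + a * (b + 1) = a * b := by decide
      simp only [e1] at h1
      have e2 : ∀ a b : Fin 2, bitInd (a + a * b) + bitInd (a * b) = bitInd a := by
        intro a b
        fin_cases a <;> fin_cases b <;> simp [bitInd]
      simp only [treeBit_left, treeBit_right]
      have h3 : ∑ z : Fin N → Fin 2, bitInd (treeBit (extendBits z) 1 v) =
          ∑ z : Fin N → Fin 2, bitInd (treeBit (extendBits z) 1 v +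
            treeBit (extendBits z) 1 v * extendBits z v) +
          ∑ z : Fin N → Fin 2, bitInd (treeBit (extendBits z) 1 v * extendBits z v) := by
        rw [← Finset.sum_add_distrib]
        exact Finset.sum_congr rfl fun z _ => (e2 _ _).symm
      rw [h3, h1]
      constructor <;> ring
    have hlt : 2 ^ t - 1 + j / 2 < N := by omega
    have hk := key ⟨2 ^ t - 1 + j / 2, hlt⟩
    simp only at hk
    rw [ih (j / 2) (by omega) (by omega)] at hk
    rw [pow_succ (2 : ℂ), ← div_div]
    rcases Nat.even_or_odd' j with ⟨i, rfl | rfl⟩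
    · rw [show 2 * i / 2 = i by omega] at hk
      rw [pow_succ, show 2 ^ t * 2 - 1 + 2 * i = 2 * (2 ^ t - 1 + i) + 1 by omega]
      exact hk.1
    · rw [show (2 * i + 1) / 2 = i by omega] at hk
      rw [pow_succ, show 2 ^ t * 2 - 1 + (2 * i + 1) = 2 * (2 ^ t - 1 + i) + 2 by omega]
      exact hk.2

/-- The bits of a chain: the next link carries the bit as long as `J` vanishes. -/
def chainBit (J : ℕ → Fin 2) (c : Fin 2) : ℕ → Fin 2
  | 0 => c
  | v + 1 => chainBit J c v * J v + chainBit J c v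

theorem chainBit_eq (J : ℕ → Fin 2) (c : Fin 2) (v : ℕ) :
    chainBit J c v = if c = 1 ∧ ∀ u < v, J u = 0 then 1 else 0 := by
  induction v with
  | zero =>
    have h : c = 0 ∨ c = 1 := by omega
    rcases h with h | h <;> simp [chainBit, h]
  | succ v ih =>
    rw [chainBit, ih]
    have h : J v = 0 ∨ J v = 1 := by omega
    by_cases hc : c = 1 ∧ ∀ u < v, J u = 0
    · rw [if_pos hc]
      rcases h with h | h
      · rw [h, if_pos]
        · simp
        · refine ⟨hc.1, fun u hu => ?_⟩
          rcases Nat.lt_succ_iff_lt_or_eq.1 hu with h' | rfl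
          · exact hc.2 u h'
          · exact h
      · rw [h, if_neg]
        · decide
        · intro hn
          rw [hn.2 v (Nat.lt_succ_self v)] at h
          exact zero_ne_one h
    · rw [if_neg hc, if_neg]
      · simp
      · exact fun hn => hc ⟨hn.1, fun u hu => hn.2 u (by omega)⟩

end Tree

/-! ### The circuit of one register -/

/-- The qubits of one register: the output, one half `A` of maximally entangled pairs, random bits
`r`, dephasing ancillas `q`, the index `J` of the walk, and the nodes `h` of the decoding tree.
The qubit `h 0` controls the walk. -/
inductive Lab where
  | out (k : ℕ)
  | A (k : ℕ)
  | r (k : ℕ)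
  | q (k : ℕ)
  | J (v : ℕ)
  | h (v : ℕ)
  deriving DecidableEq

section Register

/-- The circuit that computes the first `t` inner nodes of the tree. -/
def treeGates (t : ℕ) : List (LGate Lab) :=
  (List.range t).flatMap fun v => [.toffoli (.h v) (.J v) (.h (2 * v + 2)),
    .cnot (.h v) (.h (2 * v + 1)), .cnot (.h (2 * v + 2)) (.h (2 * v + 1))]

/-- The circuit that computes the first `t` links of the chain. -/
def chainGates (t : ℕ) : List (LGate Lab) :=
  (List.range t).flatMap fun v => [.toffoli (.h v) (.J v) (.h (v + 1)),
    .cnot (.h v) (.h (v + 1))]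

theorem isClassical_treeGates (t : ℕ) : ∀ g ∈ treeGates t, g.IsClassical := by
  intro g hg
  simp only [treeGates, List.mem_flatMap, List.mem_cons, List.not_mem_nil, or_false] at hg
  obtain ⟨v, _, rfl | rfl | rfl⟩ := hg <;> trivial

theorem isClassical_chainGates (t : ℕ) : ∀ g ∈ chainGates t, g.IsClassical := by
  intro g hg
  simp only [chainGates, List.mem_flatMap, List.mem_cons, List.not_mem_nil, or_false] at hg
  obtain ⟨v, _, rfl | rfl⟩ := hg <;> trivial

/-- The children of node t are 2t + 1 and 2t + 2. When t is processed its own bit is final and both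
children are still zero. -/
theorem exec_treeGates {x : Lab → Fin 2} (hx : ∀ v, x (.h (v + 1)) = 0) (t : ℕ) :
    exec (treeGates t) x = fun p => match p with
      | .h u => if u ≤ 2 * t then treeBit (fun v => x (.J v)) (x (.h 0)) u else 0
      | p => x p := by
  induction t with
  | zero =>
    funext p
    cases p with
    | h u =>
      cases u with
      | zero => simp [treeGates, treeBit]
      | succ u => simp [treeGates, hx]
    | _ => rfl
  | succ t ih =>
    have hs : treeGates (t + 1) = treeGates t ++ [.toffoli (.h t) (.J t) (.h (2 * t + 2)),
        .cnot (.h t) (.h (2 * t + 1)), .cnot (.h (2 * t + 2)) (.h (2 * t + 1))] := by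
      simp [treeGates, List.range_succ]
    have n1 : ¬ (t = 2 * t + 2) := by omega
    have n2 : ¬ (t = 2 * t + 1) := by omega
    have n3 : t ≤ 2 * t := by omega
    have n4 : ¬ (2 * t + 1 ≤ 2 * t) := by omega
    have n5 : ¬ (2 * t + 2 ≤ 2 * t) := by omega
    rw [hs, exec_append, ih]
    funext p
    cases p with
    | h u =>
      by_cases h2 : u = 2 * t + 2
      · subst h2
        simp [LGate.flip, n1, n2, n3, treeBit_right, mul_add]
      · by_cases h1 : u = 2 * t + 1
        · subst h1
          simp [LGate.flip, n1, n2, n3, treeBit_left, mul_add]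
        · have hle : u ≤ 2 * (t + 1) ↔ u ≤ 2 * t := by omega
          simp only [hle]
          simp [LGate.flip, n1, n2, h1, h2]
    | _ => simp [LGate.flip, n1, n2]

theorem exec_chainGates {x : Lab → Fin 2} (hx : ∀ v, x (.h (v + 1)) = 0) (t : ℕ) :
    exec (chainGates t) x = fun p => match p with
      | .h u => if u ≤ t then chainBit (fun v => x (.J v)) (x (.h 0)) u else 0
      | p => x p := by
  induction t with
  | zero =>
    funext p
    cases p with
    | h u =>
      cases u with
      | zero => simp [chainGates, chainBit]
      | succ u => simp [chainGates, hx]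
    | _ => rfl
  | succ t ih =>
    have hs : chainGates (t + 1) = chainGates t ++ [.toffoli (.h t) (.J t) (.h (t + 1)),
        .cnot (.h t) (.h (t + 1))] := by
      simp [chainGates, List.range_succ]
    rw [hs, exec_append, ih]
    funext p
    cases p with
    | h u =>
      by_cases h1 : u = t + 1
      · subst h1
        simp [LGate.flip, chainBit]
      · have hle : u ≤ t + 1 ↔ u ≤ t := by omega
        simp only [hle]
        simp [LGate.flip, h1]
    | _ => simp [LGate.flip]

/-- Needed for uncomputing the tree after the selected operator has changed the bits of `A`. -/
theorem exec_overwrite_A {n : ℕ} {gs : List (LGate Lab)}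
    (hgs : ∀ g ∈ gs, ∀ p ∈ g.labels, ∀ k, p ≠ Lab.A k) (x : Lab → Fin 2) (a : Basis n) :
    exec gs (overwrite (fun k : Fin n => Lab.A k) x a) =
      overwrite (fun k : Fin n => Lab.A k) (exec gs x) a := by
  induction gs generalizing x with
  | nil => rfl
  | cons g gs ih =>
    have hg := hgs g List.mem_cons_self
    have hover : ∀ y : Lab → Fin 2, ∀ p ∈ g.labels,
        overwrite (fun k : Fin n => Lab.A k) y a p = y p := fun y p hp =>
      overwrite_of_ne _ _ fun k => Ne.symm (hg p hp k)
    have hupd : ∀ (y : Lab → Fin 2) (p : Lab) (b : Fin 2), p ∈ g.labels →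
        Function.update (overwrite (fun k : Fin n => Lab.A k) y a) p b =
          overwrite (fun k : Fin n => Lab.A k) (Function.update y p b) a := by
      intro y p b hp
      funext s
      by_cases hs : s = p
      · subst hs
        rw [Function.update_self, overwrite_of_ne _ _ fun k => Ne.symm (hg s hp k),
          Function.update_self]
      · rw [Function.update_of_ne hs]
        unfold overwrite
        split_ifs
        · rfl
        · rw [Function.update_of_ne hs]
    rw [exec_cons, exec_cons, ← ih fun g hg => hgs g (List.mem_cons_of_mem _ hg)]
    congr 1
    cases g with
    | had => rfl
    | tee => rfl
    | cnot c t =>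
      simp only [LGate.flip]
      rw [hover x c (by simp [LGate.labels]), hover x t (by simp [LGate.labels]),
        hupd x t _ (by simp [LGate.labels])]
      split_ifs <;> rfl
    | toffoli c d t =>
      simp only [LGate.flip]
      rw [hover x c (by simp [LGate.labels]), hover x d (by simp [LGate.labels]),
        hover x t (by simp [LGate.labels]), hupd x t _ (by simp [LGate.labels])]
      split_ifs <;> rfl

variable {n m : ℕ}

/-- The operation of the leaf `j`: an entry of the row, or a phase that averages out. -/
def leafGates (M : ℕ) (e : Fin m → SignedPauli n) (j : ℕ) : List (LGate Lab) :=
  if hj : j < m then ctrlEntry (.h (M - 1 + j)) (fun k : Fin n => .A k) (e ⟨j, hj⟩)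
  else czGate (.h (M - 1 + j)) (.J (M - 1 + j))

/-- The matrix of the operation of the leaf `j`. -/
def leafMat (M : ℕ) (e : Fin m → SignedPauli n) (J : ℕ → Fin 2) (j : ℕ) :
    Matrix (Basis n) (Basis n) ℂ :=
  if hj : j < m then -(SignedPauli.mat (e ⟨j, hj⟩)).transpose else bitSign (J (M - 1 + j)) • 1

/-- The operations of all leaves. -/
def selectGates (M : ℕ) (e : Fin m → SignedPauli n) : List (LGate Lab) :=
  (List.range M).flatMap (leafGates M e)

theorem injective_A : Function.Injective fun k : Fin n => Lab.A k := by
  intro a b h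
  simpa [Fin.val_inj] using h

theorem injective_J {N : ℕ} : Function.Injective fun k : Fin N => Lab.J k := by
  intro a b h
  simpa [Fin.val_inj] using h

theorem lrun_leafGates (M : ℕ) (e : Fin m → SignedPauli n) (j : ℕ) (ψ : (Lab → Fin 2) → ℂ)
    (x : Lab → Fin 2) : lrun (leafGates M e j) ψ x = if x (.h (M - 1 + j)) = 0 then ψ x else
      actOn (fun k : Fin n => Lab.A k) (leafMat M e (fun v => x (.J v)) j) ψ x := by
  unfold leafGates leafMat
  split_ifs with hj h0 h0
  · rw [lrun_ctrlEntry injective_A (by simp), if_pos h0]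
  · rw [lrun_ctrlEntry injective_A (by simp), if_neg h0]
  · rw [lrun_czGate (by simp), h0]; simp
  · rw [lrun_czGate (by simp), actOn_one, show x (.h (M - 1 + j)) = 1 by omega, one_mul]

/-- The involutions of the walk. -/
def walkMat (M N : ℕ) (e : Fin m → SignedPauli n) (z : Fin N → Fin 2) :
    Matrix (Basis n) (Basis n) ℂ :=
  ∑ j ∈ Finset.range M, bitInd (treeBit (extendBits z) 1 (M - 1 + j)) •
    leafMat M e (extendBits z) j

/-- Exactly one leaf is reached, so the sum has one nonzero term. `walkMat` thus inherits the
properties of a single leaf operation, while its form as a sum allows averaging leaf by leaf. -/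
theorem exists_walkMat_eq (s N : ℕ) (e : Fin m → SignedPauli n) (z : Fin N → Fin 2) :
    ∃ j₀ < 2 ^ s, (∀ j < 2 ^ s, treeBit (extendBits z) 1 (2 ^ s - 1 + j) =
      if j = j₀ then 1 else 0) ∧ walkMat (2 ^ s) N e z = leafMat (2 ^ s) e (extendBits z) j₀ := by
  obtain ⟨j₀, hj₀, h⟩ := exists_treeBit_leaf (extendBits z) s
  refine ⟨j₀, hj₀, h, ?_⟩
  rw [walkMat, Finset.sum_eq_single_of_mem j₀ (Finset.mem_range.2 hj₀)]
  · rw [h j₀ hj₀]; simp [bitInd]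
  · intro j hj hne
    rw [h j (Finset.mem_range.1 hj), if_neg hne]
    simp [bitInd]

theorem leafMat_mul_self (M : ℕ) (e : Fin m → SignedPauli n) (J : ℕ → Fin 2) (j : ℕ) :
    leafMat M e J j * leafMat M e J j = 1 := by
  unfold leafMat
  split_ifs
  · rw [neg_mul_neg, ← Matrix.transpose_mul, SignedPauli.mat_mul_self, Matrix.transpose_one]
  · rw [smul_mul_smul_comm, bitSign_mul_self]; simp

theorem leafMat_isHermitian (M : ℕ) (e : Fin m → SignedPauli n) (J : ℕ → Fin 2) (j : ℕ) :
    (leafMat M e J j).IsHermitian := by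
  unfold leafMat
  split_ifs
  · exact (SignedPauli.mat_isHermitian _).transpose.neg
  · rw [Matrix.IsHermitian, Matrix.conjTranspose_smul]
    have : ∀ b : Fin 2, star (bitSign b) = bitSign b := by intro b; fin_cases b <;> simp
    rw [this]; simp

theorem walkMat_mul_self (s N : ℕ) (e : Fin m → SignedPauli n) (z : Fin N → Fin 2) :
    walkMat (2 ^ s) N e z * walkMat (2 ^ s) N e z = 1 := by
  obtain ⟨j₀, _, _, h⟩ := exists_walkMat_eq s N e z
  rw [h, leafMat_mul_self]

theorem walkMat_isHermitian (s N : ℕ) (e : Fin m → SignedPauli n) (z : Fin N → Fin 2) :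
    (walkMat (2 ^ s) N e z).IsHermitian := by
  obtain ⟨j₀, _, _, h⟩ := exists_walkMat_eq s N e z
  rw [h]
  exact leafMat_isHermitian _ _ _ _

/-- Every leaf is reached with weight 2^{-s}. The leaves beyond the m entries carry the sign of
their own index bit, which averages to zero; these bits are the reason for an index of 2·2^s − 1
qubits rather than 2^s − 1. -/
theorem neg_average_walkMat (s : ℕ) (e : Fin m → SignedPauli n) (hm : m ≤ 2 ^ s) {N : ℕ}
    (hN : 2 * 2 ^ s - 1 ≤ N) :
    -average (walkMat (2 ^ s) N e) = ((1 / (2 ^ s : ℕ) : ℝ) • rowSum e).transpose := by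
  have hp : 0 < 2 ^ s := by positivity
  have h1 : ∀ j ∈ Finset.range (2 ^ s), ∑ z : Fin N → Fin 2,
      bitInd (treeBit (extendBits z) 1 (2 ^ s - 1 + j)) • leafMat (2 ^ s) e (extendBits z) j =
        if hj : j < m then (2 ^ N / 2 ^ s : ℂ) • -(SignedPauli.mat (e ⟨j, hj⟩)).transpose
        else 0 := by
    intro j hj
    rw [Finset.mem_range] at hj
    unfold leafMat
    split_ifs with hjm
    · rw [← Finset.sum_smul, sum_treeBit_leaf s j hj (by omega)]
    · simp only [smul_smul, ← Finset.sum_smul]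
      have := sum_treeBit_mul_sign_eq_zero (⟨2 ^ s - 1 + j, by omega⟩ : Fin N)
      simp only at this
      rw [this, zero_smul]
  have h2 : ∑ z, walkMat (2 ^ s) N e z =
      (2 ^ N / 2 ^ s : ℂ) • -(rowSum e).transpose := by
    simp only [walkMat]
    rw [Finset.sum_comm, Finset.sum_congr rfl h1]
    rw [rowSum, Matrix.transpose_sum, ← Finset.sum_neg_distrib, Finset.smul_sum]
    have hsub : Finset.range m ⊆ Finset.range (2 ^ s) := Finset.range_subset_range.2 hm
    rw [← Finset.sum_subset hsub, Finset.sum_range]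
    · refine Finset.sum_congr rfl fun j _ => ?_
      rw [dif_pos j.2]
    · intro j _ hj
      rw [Finset.mem_range] at hj
      rw [dif_neg hj]
  rw [average, h2, Matrix.transpose_smul, smul_smul, smul_neg, neg_neg]
  ext x y
  have : (2 : ℂ) ^ N ≠ 0 := by positivity
  simp
  field_simp
  simp

/-! #### States of a register -/

/-- The ancillas that are unused between the steps of the walk vanish. -/
def Clean (n N : ℕ) (x : Lab → Fin 2) : Prop :=
  (∀ v, x (.h (v + 1)) = 0) ∧ (∀ k, x (.q k) = 0) ∧
    (∀ k, n ≤ k → x (.out k) = 0 ∧ x (.A k) = 0 ∧ x (.r k) = 0) ∧ ∀ v, N ≤ v → x (.J v) = 0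

/-- The bits of `A`. -/
def bitsA (n : ℕ) (x : Lab → Fin 2) : Basis n := fun k => x (.A k)

/-- The bits of the output. -/
def bitsOut (n : ℕ) (x : Lab → Fin 2) : Basis n := fun k => x (.out k)

/-- The bits of the index of the walk. -/
def bitsJ (N : ℕ) (x : Lab → Fin 2) : Fin N → Fin 2 := fun v => x (.J v)

open Classical in
/-- The state in which the walk, controlled by `h 0`, has reached `Ψ`. -/
def walkState (n N : ℕ) (Ψ : (Fin N → Fin 2) → Matrix (Basis n) (Basis n) ℂ)
    (x : Lab → Fin 2) : ℂ :=
  if Clean n N x then hadNorm ^ (1 + N + n + n) *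
    (if x (.h 0) = 0 then (1 : Matrix (Basis n) (Basis n) ℂ) else Ψ (bitsJ N x))
      (bitsA n x) (bitsOut n x) else 0

theorem clean_overwrite_A {N : ℕ} (x : Lab → Fin 2) (a : Basis n) :
    Clean n N (overwrite (fun k : Fin n => Lab.A k) x a) ↔ Clean n N x := by
  have h : ∀ k, n ≤ k → overwrite (fun k : Fin n => Lab.A k) x a (.A k) = x (.A k) := by
    intro k hk
    refine overwrite_of_ne _ _ fun v hv => ?_
    have := v.2
    simp only [Lab.A.injEq] at hv
    omega
  have h' : ∀ p, (∀ k, Lab.A k ≠ p) → overwrite (fun k : Fin n => Lab.A k) x a p = x p :=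
    fun p hp => overwrite_of_ne _ _ fun v => hp v
  unfold Clean
  simp only [h' (.h _) (by simp), h' (.q _) (by simp), h' (.out _) (by simp),
    h' (.r _) (by simp), h' (.J _) (by simp)]
  refine and_congr_right fun _ => and_congr_right fun _ => and_congr_left fun _ =>
    forall_congr' fun k => forall_congr' fun hk => ?_
  rw [h k hk]

theorem clean_overwrite_J {N : ℕ} (x : Lab → Fin 2) (z : Fin N → Fin 2) :
    Clean n N (overwrite (fun v : Fin N => Lab.J v) x z) ↔ Clean n N x := by
  have h : ∀ k, N ≤ k → overwrite (fun k : Fin N => Lab.J k) x z (.J k) = x (.J k) := by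
    intro k hk
    refine overwrite_of_ne _ _ fun v hv => ?_
    have := v.2
    simp only [Lab.J.injEq] at hv
    omega
  have h' : ∀ p, (∀ k, Lab.J k ≠ p) → overwrite (fun k : Fin N => Lab.J k) x z p = x p :=
    fun p hp => overwrite_of_ne _ _ fun v => hp v
  unfold Clean
  simp only [h' (.h _) (by simp), h' (.q _) (by simp), h' (.out _) (by simp),
    h' (.r _) (by simp), h' (.A _) (by simp)]
  refine and_congr_right fun _ => and_congr_right fun _ => and_congr_right fun _ =>
    forall_congr' fun k => forall_congr' fun hk => ?_
  rw [h k hk]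

theorem Clean.extendBits_bitsJ {N : ℕ} {x : Lab → Fin 2} (hx : Clean n N x) :
    extendBits (bitsJ N x) = fun v => x (.J v) := by
  funext v
  unfold extendBits bitsJ
  split_ifs with h
  · rfl
  · exact (hx.2.2.2 v (not_lt.1 h)).symm

theorem labels_treeGates_ne_A (t : ℕ) : ∀ g ∈ treeGates t, ∀ p ∈ g.labels, ∀ k, p ≠ Lab.A k := by
  intro g hg p hp k
  simp only [treeGates, List.mem_flatMap, List.mem_cons, List.not_mem_nil, or_false] at hg
  obtain ⟨v, _, rfl | rfl | rfl⟩ := hg <;> simp only [LGate.labels, List.mem_cons,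
    List.not_mem_nil, or_false] at hp <;> rcases hp with rfl | rfl | rfl <;> simp

/-- On clean strings with `h 0` equal to 0 no leaf is lit and nothing happens. With `h 0` equal to 1
the unique lit leaf multiplies the amplitude matrix from the left through the bits of `A`. Strings
that are not clean have amplitude zero before and after. -/
theorem lrun_tree_select_tree (s : ℕ) (e : Fin m → SignedPauli n) {N : ℕ}
    (Ψ : (Fin N → Fin 2) → Matrix (Basis n) (Basis n) ℂ) :
    lrun (treeGates (2 ^ s - 1) ++ selectGates (2 ^ s) e ++ (treeGates (2 ^ s - 1)).reverse)
      (walkState n N Ψ) = walkState n N fun z => walkMat (2 ^ s) N e z * Ψ z := by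
  have hp : 0 < 2 ^ s := by positivity
  funext x
  rw [lrun_conj_of_isClassical (isClassical_treeGates _)]
  set gs := treeGates (2 ^ s - 1) with hgs
  have hback : ∀ a : Basis n, exec gs.reverse (overwrite (fun k : Fin n => Lab.A k)
      (exec gs x) a) = overwrite (fun k : Fin n => Lab.A k) x a := by
    intro a
    rw [exec_overwrite_A, exec_reverse_exec]
    intro g hg
    exact labels_treeGates_ne_A _ g (List.mem_reverse.1 hg)
  by_cases hx : Clean n N x
  · have hex := exec_treeGates hx.1 (2 ^ s - 1)
    rw [← hgs] at hex
    have hleaf : ∀ j < 2 ^ s, exec gs x (.h (2 ^ s - 1 + j)) =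
        treeBit (extendBits (bitsJ N x)) (x (.h 0)) (2 ^ s - 1 + j) := by
      intro j hj
      rw [hex, hx.extendBits_bitsJ]
      simp only
      rw [if_pos (by omega)]
    have hc : x (.h 0) = 0 ∨ x (.h 0) = 1 := by omega
    rcases hc with hc | hc
    · rw [selectGates, lrun_flatMap_of_inactive (lrun_leafGates (2 ^ s) e), exec_reverse_exec]
      · simp only [walkState, hc, if_true]
      · intro j hj
        rw [hleaf j (List.mem_range.1 hj), hc, treeBit_zero]
    · obtain ⟨j₀, hj₀, hone, hmat⟩ := exists_walkMat_eq s N e (bitsJ N x)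
      rw [selectGates, lrun_flatMap_of_active (lrun_leafGates (2 ^ s) e) (by simp)
        List.nodup_range (List.mem_range.2 hj₀)]
      · have h1 : (fun v => exec gs x (.J v)) = extendBits (bitsJ N x) := by
          rw [hex, hx.extendBits_bitsJ]
        have h2 : (fun k : Fin n => exec gs x (.A k)) = bitsA n x := by
          rw [hex]; rfl
        have hA : ∀ a : Basis n, ∀ p, (∀ k, Lab.A k ≠ p) →
            overwrite (fun k : Fin n => Lab.A k) x a p = x p :=
          fun a p hp => overwrite_of_ne _ _ fun v => hp v
        rw [h1, ← hmat, actOn]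
        simp only [hback, h2]
        simp only [walkState, clean_overwrite_A, hx, if_true, hA _ (.h 0) (by simp), hc,
          one_ne_zero, if_false, Matrix.mul_apply]
        rw [Finset.mul_sum]
        refine Finset.sum_congr rfl fun a _ => ?_
        have e1 : bitsJ N (overwrite (fun k : Fin n => Lab.A k) x a) = bitsJ N x :=
          funext fun v => hA a _ (by simp)
        have e2 : bitsOut n (overwrite (fun k : Fin n => Lab.A k) x a) = bitsOut n x :=
          funext fun v => hA a _ (by simp)
        have e3 : bitsA n (overwrite (fun k : Fin n => Lab.A k) x a) = a :=
          funext fun v => overwrite_apply injective_A x a v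
        rw [e1, e2, e3]
        ring
      · rw [hleaf j₀ hj₀, hc, hone j₀ hj₀]; simp
      · intro j hj hne
        rw [hleaf j (List.mem_range.1 hj), hc, hone j (List.mem_range.1 hj), if_neg hne]
  · rw [selectGates, lrun_flatMap_eq_zero (lrun_leafGates (2 ^ s) e)]
    · simp [walkState, hx]
    · intro a
      rw [hback]
      simp [walkState, clean_overwrite_A, hx]

end Register

/-! ### Reflection, walk step, preparation and Hadamard test of one register. -/

section Register

variable {n m : ℕ}

/-- The Hadamard gates on the index of the walk. -/
def indexLayer (N : ℕ) : List (LGate Lab) := hadLayer (List.ofFn fun v : Fin N => .J v)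

/-- The reflection about the uniform superposition of the index. -/
def reflectGates (N : ℕ) : List (LGate Lab) :=
  indexLayer N ++ (chainGates N ++ zGate (.h N) ++ (chainGates N).reverse) ++ indexLayer N

theorem lrun_indexLayer_sub {N : ℕ} (ψ φ : (Lab → Fin 2) → ℂ) (c : ℂ) :
    lrun (indexLayer N) (fun x => ψ x - c * φ x) =
      fun x => lrun (indexLayer N) ψ x - c * lrun (indexLayer N) φ x := by
  funext x
  simp only [indexLayer, lrun_hadLayer injective_J, mul_sub, Finset.sum_sub_distrib]
  congr 1
  rw [mul_left_comm c]
  congr 1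
  rw [Finset.mul_sum]
  exact Finset.sum_congr rfl fun z _ => by ring

/-- Between the Hadamard layers the reflection is a sign at J = 0. The chain starts at `h 0`, so it
tests the control at the same time; on the branch with control 0 the two layers cancel. -/
theorem lrun_reflectGates {N : ℕ} (Ψ : (Fin N → Fin 2) → Matrix (Basis n) (Basis n) ℂ) :
    lrun (reflectGates N) (walkState n N Ψ) =
      walkState n N fun z => Ψ z - (2 : ℂ) • average Ψ := by
  classical
  set φ := lrun (indexLayer N) (walkState n N Ψ) with hφ
  let P : (Lab → Fin 2) → Prop := fun x => exec (chainGates N) x (.h N) = 1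
  let χ : (Lab → Fin 2) → ℂ := fun x => if P x then φ x else 0
  have hmid : lrun (chainGates N ++ zGate (.h N) ++ (chainGates N).reverse) φ =
      fun x => φ x - 2 * χ x := by
    funext x
    rw [lrun_conj_of_isClassical (isClassical_chainGates N), lrun_zGate, exec_reverse_exec]
    have h : exec (chainGates N) x (.h N) = 0 ∨ exec (chainGates N) x (.h N) = 1 := by omega
    simp only [χ, P]
    rcases h with h | h
    · simp [h]
    · rw [h]; simp; ring
  have hJ : ∀ (x : Lab → Fin 2) (z : Fin N → Fin 2) p, (∀ k, Lab.J k ≠ p) →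
      overwrite (fun k : Fin N => Lab.J k) x z p = x p :=
    fun x z p hp => overwrite_of_ne _ _ fun v => hp v
  have hφx : ∀ x, φ x = hadNorm ^ N * ∑ z : Fin N → Fin 2,
      (∏ v : Fin N, bitSign (x (.J v) * z v)) *
        walkState n N Ψ (overwrite (fun v : Fin N => Lab.J v) x z) := fun x => by
    rw [hφ, indexLayer, lrun_hadLayer injective_J]
  have hφ0 : ∀ x, ¬ Clean n N x → φ x = 0 := by
    intro x hx
    rw [hφx, Finset.sum_eq_zero, mul_zero]
    intro z _
    simp [walkState, clean_overwrite_J, hx]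
  have hP : ∀ x, Clean n N x → (P x ↔ x (.h 0) = 1 ∧ ∀ v : Fin N, x (.J v) = 0) := by
    intro x hx
    simp only [P]
    rw [exec_chainGates hx.1]
    simp only [le_refl, if_true, chainBit_eq]
    have : (∀ u < N, x (.J u) = 0) ↔ ∀ v : Fin N, x (.J v) = 0 :=
      ⟨fun h v => h v v.2, fun h u hu => h ⟨u, hu⟩⟩
    simp only [this]
    split_ifs with h <;> simp [h]
  rw [reflectGates, lrun_append, lrun_append, ← hφ, hmid, lrun_indexLayer_sub, hφ, indexLayer,
    lrun_hadLayer_hadLayer]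
  funext x
  rw [lrun_hadLayer injective_J]
  by_cases hx : Clean n N x
  · have hcl : ∀ z, Clean n N (overwrite (fun v : Fin N => Lab.J v) x z) := fun z =>
      (clean_overwrite_J x z).2 hx
    have hh : ∀ z, overwrite (fun v : Fin N => Lab.J v) x z (.h 0) = x (.h 0) :=
      fun z => hJ x z _ (by simp)
    have hJz : ∀ (z : Fin N → Fin 2) (v : Fin N),
        overwrite (fun v : Fin N => Lab.J v) x z (.J v) = z v :=
      fun z v => overwrite_apply injective_J x z v
    have hc : x (.h 0) = 0 ∨ x (.h 0) = 1 := by omega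
    rcases hc with hc | hc
    · rw [Finset.sum_eq_zero]
      · simp [walkState, hc]
      · intro z _
        have : ¬ P (overwrite (fun v : Fin N => Lab.J v) x z) := by
          rw [hP _ (hcl z), hh, hc]; simp
        simp [χ, this]
    -- The flipped component lives on J = 0, so a single term survives. Its amplitude is a sum over
    -- the whole index, and the two factors `hadNorm ^ N` combine to the weight 1/2^N of the
    -- average.
    · rw [Finset.sum_eq_single 0]
      · have : P (overwrite (fun v : Fin N => Lab.J v) x 0) := by
          rw [hP _ (hcl 0), hh]; exact ⟨hc, fun v => hJz 0 v⟩
        simp only [χ, this, if_true, hφx, hJz, Pi.zero_apply, mul_zero, zero_mul, bitSign_zero,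
          Finset.prod_const_one, one_mul, overwrite_overwrite]
        have e1 : ∀ z, bitsJ N (overwrite (fun v : Fin N => Lab.J v) x z) = z :=
          fun z => funext fun v => hJz z v
        have e2 : ∀ z, bitsA n (overwrite (fun v : Fin N => Lab.J v) x z) = bitsA n x :=
          fun z => funext fun v => hJ x z _ (by simp)
        have e3 : ∀ z, bitsOut n (overwrite (fun v : Fin N => Lab.J v) x z) = bitsOut n x :=
          fun z => funext fun v => hJ x z _ (by simp)
        simp only [walkState, hx, hcl, hh, hc, if_true, one_ne_zero, if_false, e1, e2, e3,
          ← Finset.mul_sum]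
        have e4 : average Ψ (bitsA n x) (bitsOut n x) =
            (1 / 2 ^ N) * ∑ z, Ψ z (bitsA n x) (bitsOut n x) := by
          simp [average, Matrix.sum_apply]
        have e5 : hadNorm ^ N * hadNorm ^ N = 1 / 2 ^ N := by
          rw [← mul_pow, hadNorm_sq, div_pow, one_pow]
        rw [Matrix.sub_apply, Matrix.smul_apply, e4, ← e5, smul_eq_mul]
        ring
      · intro z _ hz
        have : ¬ P (overwrite (fun v : Fin N => Lab.J v) x z) := by
          rw [hP _ (hcl z)]
          rintro ⟨_, h⟩
          exact hz (funext fun v => by rw [← hJz z v, h v]; rfl)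
        simp [χ, this]
      · simp
  · rw [Finset.sum_eq_zero]
    · simp [walkState, hx]
    · intro z _
      have := hφ0 (overwrite (fun v : Fin N => Lab.J v) x z)
        (fun h => hx ((clean_overwrite_J x z).1 h))
      simp [χ, this]

/-- The number of index qubits for the tree with `2 ^ s` leaves. -/
def indexSize (s : ℕ) : ℕ := 2 * 2 ^ s - 1

/-- One step of the walk. -/
def stepGates (s : ℕ) (e : Fin m → SignedPauli n) : List (LGate Lab) :=
  (treeGates (2 ^ s - 1) ++ selectGates (2 ^ s) e ++ (treeGates (2 ^ s - 1)).reverse) ++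
    reflectGates (indexSize s)

theorem lrun_stepGates (s : ℕ) (e : Fin m → SignedPauli n)
    (Ψ : (Fin (indexSize s) → Fin 2) → Matrix (Basis n) (Basis n) ℂ) :
    lrun (stepGates s e) (walkState n (indexSize s) Ψ) =
      walkState n (indexSize s) (walkStep (walkMat (2 ^ s) (indexSize s) e) Ψ) := by
  rw [stepGates, lrun_append, lrun_tree_select_tree, lrun_reflectGates]
  rfl

theorem lrun_replicate_stepGates (s k : ℕ) (e : Fin m → SignedPauli n) :
    lrun (List.replicate k (stepGates s e)).flatten
      (walkState n (indexSize s) (walk (walkMat (2 ^ s) (indexSize s) e) 0)) =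
      walkState n (indexSize s) (walk (walkMat (2 ^ s) (indexSize s) e) k) := by
  induction k with
  | zero => rfl
  | succ k ih =>
    rw [List.replicate_succ', List.flatten_append, lrun_append, ih, walk_succ]
    simp [lrun_stepGates]

/-! #### The first and the last gates of a register -/

/-- The preparation of the register. -/
def initGates (n N : ℕ) : List (LGate Lab) :=
  hadLayer ((Lab.h 0 :: List.ofFn fun v : Fin N => Lab.J v) ++
    ((List.ofFn fun k : Fin n => Lab.A k) ++ List.ofFn fun k : Fin n => Lab.r k)) ++
  (List.range n).flatMap fun k => [.cnot (.A k) (.out k)]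

/-- The end of the Hadamard test, and the replacement of the output by a random one if the test
fails. -/
def finalGates (n : ℕ) : List (LGate Lab) :=
  LGate.had (.h 0) :: (List.range n).flatMap fun k =>
    [.toffoli (.h 0) (.r k) (.out k), .toffoli (.h 0) (.out k) (.q k)]

open Classical in
/-- The state that vanishes unless all bits are zero. -/
def zeroState (x : Lab → Fin 2) : ℂ := if x = 0 then 1 else 0

theorem exec_copyGates (x : Lab → Fin 2) (t : ℕ) :
    exec ((List.range t).flatMap fun k => [.cnot (.A k) (.out k)]) x = fun p => match p with
      | .out k => if k < t then x (.out k) + x (.A k) else x (.out k)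
      | p => x p := by
  induction t with
  | zero => funext p; cases p <;> simp
  | succ t ih =>
    rw [List.range_succ, List.flatMap_append, exec_append, ih]
    funext p
    cases p with
    | out k =>
      by_cases hk : k = t
      · subst hk
        simp [LGate.flip]
      · have : k < t + 1 ↔ k < t := by omega
        simp only [this]
        simp [LGate.flip, hk]
    | _ => simp [LGate.flip]

theorem isClassical_copyGates (t : ℕ) :
    ∀ g ∈ (List.range t).flatMap fun k => [LGate.cnot (.A k) (Lab.out k)], g.IsClassical := by
  intro g hg
  simp only [List.mem_flatMap, List.mem_cons, List.not_mem_nil, or_false] at hg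
  obtain ⟨v, _, rfl⟩ := hg
  trivial

theorem fin_two_add_eq_zero_iff (a b : Fin 2) : a + b = 0 ↔ b = a := by
  revert a b; decide

/-- Copying the uniformly superposed `A` onto the output gives maximally entangled pairs, whose
amplitude matrix is the identity. The exponent of `hadNorm` in `walkState` counts the Hadamard gates
on `h 0`, `J`, `A` and `r`. -/
theorem lrun_initGates (n N : ℕ) :
    lrun (initGates n N) zeroState = walkState n N fun _ => 1 := by
  have h0 : zeroState = fun x : Lab → Fin 2 => 1 * uniformOn ∅ x := by
    funext x
    rw [zeroState, uniformOn, one_mul]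
    congr 1
    simp [funext_iff]
  have hnd : ((Lab.h 0 :: List.ofFn fun v : Fin N => Lab.J v) ++
      ((List.ofFn fun k : Fin n => Lab.A k) ++ List.ofFn fun k : Fin n => Lab.r k)).Nodup := by
    simp only [List.nodup_append, List.nodup_cons, List.nodup_ofFn, List.mem_ofFn,
      List.mem_cons]
    refine ⟨⟨by simp, injective_J⟩, ⟨injective_A, ?_, by simp⟩, ?_⟩
    · intro a b h; simpa [Fin.val_inj] using h
    · simp only [List.mem_append, List.mem_ofFn]
      rintro p (rfl | ⟨v, rfl⟩) q (⟨k, rfl⟩ | ⟨k, rfl⟩) <;> simp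
  rw [initGates, lrun_append, h0, lrun_hadLayer_uniformOn _ hnd ∅ (by simp)]
  funext x
  have hrev : exec ((List.range n).flatMap fun k => [.cnot (.A k) (.out k)]).reverse x =
      exec ((List.range n).flatMap fun k => [.cnot (.A k) (.out k)]) x := by
    have h := exec_reverse_exec ((List.range n).flatMap fun k => [.cnot (.A k) (.out k)])
      (exec ((List.range n).flatMap fun k => [.cnot (.A k) (.out k)]) x)
    rw [← h]
    congr 1
    rw [exec_copyGates, exec_copyGates]
    funext p
    cases p with
    | out k =>
      simp only
      split_ifs
      · rw [fin_two_add_add_self]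
      · rfl
    | _ => rfl
  rw [lrun_of_isClassical (isClassical_copyGates n), hrev, exec_copyGates]
  have hlen : ((Lab.h 0 :: List.ofFn fun v : Fin N => Lab.J v) ++
      ((List.ofFn fun k : Fin n => Lab.A k) ++ List.ofFn fun k : Fin n => Lab.r k)).length =
        1 + N + n + n := by
    simp; omega
  rw [hlen, one_mul, walkState, uniformOn]
  have hif : (if x (.h 0) = 0 then (1 : Matrix (Basis n) (Basis n) ℂ) else 1)
      (bitsA n x) (bitsOut n x) = if bitsA n x = bitsOut n x then 1 else 0 := by
    rw [ite_self, Matrix.one_apply]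
  rw [hif, mul_ite, mul_one, mul_zero, mul_ite, mul_one, mul_zero, ← ite_and]
  congr 1
  apply propext
  have hmemJ : ∀ v, (∃ i : Fin N, (i : ℕ) = v) ↔ v < N := fun v =>
    ⟨fun ⟨i, hi⟩ => hi ▸ i.2, fun h => ⟨⟨v, h⟩, rfl⟩⟩
  have hmemn : ∀ v, (∃ i : Fin n, (i : ℕ) = v) ↔ v < n := fun v =>
    ⟨fun ⟨i, hi⟩ => hi ▸ i.2, fun h => ⟨⟨v, h⟩, rfl⟩⟩
  constructor
  · intro h
    have h1 : ∀ v, x (.h (v + 1)) = 0 := fun v => h (.h (v + 1)) (by simp)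
    have h2 : ∀ k, x (.q k) = 0 := fun k => h (.q k) (by simp)
    have h3 : ∀ k, n ≤ k → x (.r k) = 0 := fun k hk =>
      h (.r k) (by simp [List.mem_ofFn, hmemn]; omega)
    have h4 : ∀ k, n ≤ k → x (.A k) = 0 := fun k hk =>
      h (.A k) (by simp [List.mem_ofFn, hmemn]; omega)
    have h5 : ∀ v, N ≤ v → x (.J v) = 0 := fun k hk =>
      h (.J k) (by simp [List.mem_ofFn, hmemJ]; omega)
    have h6 := fun k => h (.out k) (by simp)
    simp only at h6
    refine ⟨⟨h1, h2, fun k hk => ⟨?_, h4 k hk, h3 k hk⟩, h5⟩, ?_⟩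
    · have := h6 k
      rwa [if_neg (by omega)] at this
    · funext k
      have := h6 k
      rw [if_pos k.2] at this
      exact (fin_two_add_eq_zero_iff _ _).1 this
  · rintro ⟨⟨h1, h2, h3, h4⟩, h5⟩ p hp
    cases p with
    | out k =>
      simp only
      split_ifs with hk
      · exact (fin_two_add_eq_zero_iff _ _).2 (congrFun h5 ⟨k, hk⟩)
      · exact (h3 k (by omega)).1
    | A k =>
      simp [List.mem_ofFn, hmemn] at hp
      exact (h3 k hp).2.1
    | r k =>
      simp [List.mem_ofFn, hmemn] at hp
      exact (h3 k hp).2.2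
    | q k => exact h2 k
    | J v =>
      simp [List.mem_ofFn, hmemJ] at hp
      exact h4 v hp
    | h v =>
      cases v with
      | zero => simp at hp
      | succ v => exact h1 v

/-- The effect of the last gates on a bit string, backwards. -/
def unscramble (n : ℕ) (x : Lab → Fin 2) : Lab → Fin 2
  | .out k => if k < n then x (.out k) + x (.h 0) * x (.r k) else x (.out k)
  | .q k => if k < n then x (.q k) + x (.h 0) * x (.out k) else x (.q k)
  | p => x p

theorem exec_scrambleGates (x : Lab → Fin 2) (t : ℕ) :
    exec ((List.range t).flatMap fun k =>
      [.toffoli (.h 0) (.r k) (.out k), .toffoli (.h 0) (.out k) (.q k)]) x =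
    fun p => match p with
      | .out k => if k < t then x (.out k) + x (.h 0) * x (.r k) else x (.out k)
      | .q k => if k < t then x (.q k) + x (.h 0) * (x (.out k) + x (.h 0) * x (.r k))
          else x (.q k)
      | p => x p := by
  induction t with
  | zero => funext p; cases p <;> simp
  | succ t ih =>
    rw [List.range_succ, List.flatMap_append, exec_append, ih]
    funext p
    cases p with
    | out k =>
      by_cases hk : k = t
      · subst hk
        simp [LGate.flip]
      · have : k < t + 1 ↔ k < t := by omega
        simp only [this]
        simp [LGate.flip, hk]
    | q k =>
      by_cases hk : k = t
      · subst hk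
        simp [LGate.flip]
      · have : k < t + 1 ↔ k < t := by omega
        simp only [this]
        simp [LGate.flip, hk]
    | _ => simp [LGate.flip]

theorem lrun_finalGates {N : ℕ} (Ψ : (Fin N → Fin 2) → Matrix (Basis n) (Basis n) ℂ) :
    lrun (finalGates n) (walkState n N Ψ) = fun x =>
      hadNorm * (walkState n N Ψ (Function.update (unscramble n x) (.h 0) 0) +
        bitSign (x (.h 0)) * walkState n N Ψ (Function.update (unscramble n x) (.h 0) 1)) := by
  funext x
  set gs : List (LGate Lab) := (List.range n).flatMap fun k =>
    [.toffoli (.h 0) (.r k) (.out k), .toffoli (.h 0) (.out k) (.q k)] with hgs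
  have hcl : ∀ g ∈ gs, g.IsClassical := by
    intro g hg
    simp only [hgs, List.mem_flatMap, List.mem_cons, List.not_mem_nil, or_false] at hg
    obtain ⟨v, _, rfl | rfl⟩ := hg <;> trivial
  have hback : exec gs.reverse x = unscramble n x := by
    have h := exec_reverse_exec gs (unscramble n x)
    rw [← h]
    congr 1
    rw [hgs, exec_scrambleGates]
    funext p
    cases p with
    | out k =>
      simp only [unscramble]
      split_ifs
      · rw [fin_two_add_add_self]
      · rfl
    | q k =>
      simp only [unscramble]
      split_ifs
      · rw [fin_two_add_add_self, fin_two_add_add_self]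
      · rfl
    | _ => rfl
  rw [finalGates, lrun_cons, ← hgs, lrun_of_isClassical hcl, hback, LGate.apply_had,
    Fin.sum_univ_two]
  simp [unscramble]

/-- The circuit of a register. -/
def registerGates (s k : ℕ) (e : Fin m → SignedPauli n) : List (LGate Lab) :=
  initGates n (indexSize s) ++ (List.replicate k (stepGates s e)).flatten ++ finalGates n

theorem lrun_registerGates (s k : ℕ) (e : Fin m → SignedPauli n) :
    lrun (registerGates s k e) zeroState = lrun (finalGates n)
      (walkState n (indexSize s) (walk (walkMat (2 ^ s) (indexSize s) e) k)) := by
  rw [registerGates, lrun_append, lrun_append, lrun_initGates]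
  congr 1
  exact lrun_replicate_stepGates s k e

end Register

/-! #### The state of the output of a register -/

section Register

variable {n m N : ℕ}

/-- The values of the qubits `h 0`, `J`, `A`, `r`, `q` of a register. -/
abbrev Ancilla (n N : ℕ) : Type := Fin 2 × (Fin N → Fin 2) × Basis n × Basis n × Basis n

/-- The bit string with the given output and ancilla bits, and zeros elsewhere. -/
def labelBits (b : Basis n) (y : Ancilla n N) : Lab → Fin 2
  | .out k => extendBits b k
  | .A k => extendBits y.2.2.1 k
  | .r k => extendBits y.2.2.2.1 k
  | .q k => extendBits y.2.2.2.2 k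
  | .J v => extendBits y.2.1 v
  | .h 0 => y.1
  | .h (_ + 1) => 0

/-- The reduced state of the output. -/
def outputDensity (N : ℕ) (F : (Lab → Fin 2) → ℂ) : Matrix (Basis n) (Basis n) ℂ :=
  Matrix.of fun b b' => ∑ y : Ancilla n N,
    F (labelBits b y) * starRingEnd ℂ (F (labelBits b' y))

theorem outputDensity_posSemidef (F : (Lab → Fin 2) → ℂ) :
    (outputDensity N F : Matrix (Basis n) (Basis n) ℂ).PosSemidef := by
  have h : (outputDensity N F : Matrix (Basis n) (Basis n) ℂ) =
      (Matrix.of fun (b : Basis n) (y : Ancilla n N) => F (labelBits b y)) *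
        (Matrix.of fun (b : Basis n) (y : Ancilla n N) => F (labelBits b y)).conjTranspose := by
    ext b b'
    simp [outputDensity, Matrix.mul_apply]
  rw [h]
  exact Matrix.posSemidef_self_mul_conjTranspose _

theorem extendBits_of_lt {N : ℕ} (z : Fin N → Fin 2) {v : ℕ} (h : v < N) :
    extendBits z v = z ⟨v, h⟩ := dif_pos h

theorem extendBits_of_le {N : ℕ} (z : Fin N → Fin 2) {v : ℕ} (h : N ≤ v) :
    extendBits z v = 0 := dif_neg (by omega)

theorem extendBits_val {N : ℕ} (z : Fin N → Fin 2) (v : Fin N) : extendBits z v = z v :=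
  extendBits_of_lt z v.2

/-- The bits `q` hold a copy of the output when the test fails and vanish otherwise. Tracing them
out dephases the failure branch only. -/
theorem clean_unscramble_labelBits (b : Basis n) (y : Ancilla n N) (c : Fin 2) :
    Clean n N (Function.update (unscramble n (labelBits b y)) (.h 0) c) ↔
      y.2.2.2.2 = y.1 • b := by
  obtain ⟨d, z, a, r, q⟩ := y
  have hk : ∀ k, Function.update (unscramble n (labelBits b (d, z, a, r, q))) (.h 0) c (.q k) =
      if h : k < n then q ⟨k, h⟩ + d * b ⟨k, h⟩ else 0 := by
    intro k
    simp only [ne_eq, reduceCtorEq, not_false_eq_true, Function.update_of_ne, unscramble,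
      labelBits]
    split_ifs with h
    · rw [extendBits_of_lt _ h, extendBits_of_lt _ h]
    · exact extendBits_of_le _ (by omega)
  constructor
  · intro h
    funext k
    have := h.2.1 k
    rw [hk, dif_pos k.2] at this
    change q k = d * b k
    have h2 := fin_two_add_add_self (q k) (d * b k)
    change q k + d * b k = 0 at this
    rwa [this, zero_add, eq_comm] at h2
  · intro h
    refine ⟨?_, ?_, ?_, ?_⟩
    · intro v
      simp [unscramble, labelBits]
    · intro k
      rw [hk]
      split_ifs with hkn
      · have := congrFun h ⟨k, hkn⟩
        simp only at this
        have h2 := fin_two_add_add_self 0 (d * b ⟨k, hkn⟩)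
        rw [zero_add] at h2
        rw [this, Pi.smul_apply, smul_eq_mul, h2]
      · rfl
    · intro k hkn
      have : ¬ k < n := by omega
      simp [unscramble, labelBits, this, extendBits_of_le _ hkn]
    · intro v hv
      simp [unscramble, labelBits, extendBits_of_le _ hv]

theorem lrun_finalGates_labelBits (Ψ : (Fin N → Fin 2) → Matrix (Basis n) (Basis n) ℂ)
    (b : Basis n) (y : Ancilla n N) : lrun (finalGates n) (walkState n N Ψ) (labelBits b y) =
      if y.2.2.2.2 = y.1 • b then hadNorm ^ (2 + N + n + n) *
        (1 + bitSign y.1 • Ψ y.2.1) y.2.2.1 (b + y.1 • y.2.2.2.1) else 0 := by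
  rw [lrun_finalGates]
  simp only [walkState, clean_unscramble_labelBits]
  by_cases h : y.2.2.2.2 = y.1 • b
  · have e1 : ∀ c, bitsA n (Function.update (unscramble n (labelBits b y)) (.h 0) c) = y.2.2.1 := by
      intro c
      funext k
      simp [bitsA, unscramble, labelBits, extendBits_val]
    have e2 : ∀ c, bitsOut n (Function.update (unscramble n (labelBits b y)) (.h 0) c) =
        b + y.1 • y.2.2.2.1 := by
      intro c
      funext k
      simp [bitsOut, unscramble, labelBits, extendBits_val]
    have e3 : ∀ c, bitsJ N (Function.update (unscramble n (labelBits b y)) (.h 0) c) = y.2.1 := by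
      intro c
      funext k
      simp [bitsJ, unscramble, labelBits, extendBits_val]
    have e4 : labelBits b y (.h 0) = y.1 := rfl
    simp only [h, e1, e2, e3, e4, Function.update_self, if_true, one_ne_zero, if_false]
    simp only [Matrix.add_apply, Matrix.smul_apply, smul_eq_mul]
    ring
  · simp [h]

/-- Let C be the average of Ψ. The success branch contributes 2^{-n}(1 + Cᵀ)/2; the transpose
appears because the trace is taken over the rows of the amplitude matrix. In the failure branch, of
probability (1 − tr C/2^n)/2, the random shift by `r` together with the dephasing leaves the
maximally mixed state. -/
theorem outputDensity_lrun_finalGates {Ψ : (Fin N → Fin 2) → Matrix (Basis n) (Basis n) ℂ}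
    (hΨ : average (fun z => (Ψ z).conjTranspose * Ψ z) = 1) (hC : (average Ψ).IsHermitian) :
    outputDensity N (lrun (finalGates n) (walkState n N Ψ)) =
      (1 / 2 ^ n : ℂ) • ((1 - (average Ψ).trace / 2 ^ n / 2 : ℂ) • 1 +
        (1 / 2 : ℂ) • (average Ψ).transpose) := by
  set C := average Ψ with hCdef
  have hcard : (Fintype.card (Fin N → Fin 2) : ℂ) = 2 ^ N := by simp
  have hsum : ∀ Φ : (Fin N → Fin 2) → Matrix (Basis n) (Basis n) ℂ,
      ∑ z, Φ z = (2 ^ N : ℂ) • average Φ := by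
    intro Φ
    rw [average, hcard, smul_smul, mul_one_div_cancel (by positivity), one_smul]
  -- Hermiticity of the average makes the two cross terms equal.
  have hgram : ∀ c : Fin 2, average (fun z => (1 + bitSign c • Ψ z).conjTranspose *
      (1 + bitSign c • Ψ z)) = (2 : ℂ) • 1 + (2 * bitSign c) • C := by
    intro c
    have hs : star (bitSign c) = bitSign c := by fin_cases c <;> simp
    have h1 : (fun z => (1 + bitSign c • Ψ z).conjTranspose * (1 + bitSign c • Ψ z)) =
        fun z => (1 + (Ψ z).conjTranspose * Ψ z) +
          (bitSign c • Ψ z + bitSign c • (Ψ z).conjTranspose) := by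
      funext z
      simp only [Matrix.conjTranspose_add, Matrix.conjTranspose_one, Matrix.conjTranspose_smul, hs,
        add_mul, mul_add, one_mul, mul_one, Matrix.smul_mul, Matrix.mul_smul, smul_smul,
        bitSign_mul_self, one_smul]
      abel
    rw [h1, average_add, average_add, average_const, hΨ, average_add, average_smul, average_smul,
      average_conjTranspose, ← hCdef, hC.eq]
    module
  have hnorm : hadNorm ^ (2 + N + n + n) * hadNorm ^ (2 + N + n + n) =
      1 / 4 / 2 ^ N / 2 ^ n / 2 ^ n := by
    rw [← mul_pow, hadNorm_sq]
    simp only [pow_add, div_pow, one_pow]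
    field_simp
    norm_num
  have hterm : ∀ (c : Fin 2) (b b' : Basis n), ∑ z : Fin N → Fin 2, ∑ a : Basis n,
      (1 + bitSign c • Ψ z) a b * starRingEnd ℂ ((1 + bitSign c • Ψ z) a b') =
        2 ^ N * ((2 : ℂ) • 1 + (2 * bitSign c) • C) b' b := by
    intro c b b'
    have := congrFun (congrFun (hsum fun z => (1 + bitSign c • Ψ z).conjTranspose *
      (1 + bitSign c • Ψ z)) b') b
    rw [hgram, Matrix.smul_apply, smul_eq_mul, Matrix.sum_apply] at this
    rw [← this]
    refine Finset.sum_congr rfl fun z _ => ?_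
    rw [Matrix.mul_apply]
    refine Finset.sum_congr rfl fun a _ => ?_
    rw [Matrix.conjTranspose_apply, mul_comm]
    rfl
  ext b b'
  have hexp : outputDensity N (lrun (finalGates n) (walkState n N Ψ)) b b' =
      (1 / 4 / 2 ^ N / 2 ^ n / 2 ^ n) *
        (∑ r : Basis n, (∑ z : Fin N → Fin 2, ∑ a : Basis n,
            (1 + bitSign 0 • Ψ z) a b * starRingEnd ℂ ((1 + bitSign 0 • Ψ z) a b')) +
          if b = b' then ∑ r : Basis n, (∑ z : Fin N → Fin 2, ∑ a : Basis n,
            (1 + bitSign 1 • Ψ z) a (b + r) *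
              starRingEnd ℂ ((1 + bitSign 1 • Ψ z) a (b + r))) else 0) := by
    have hc : starRingEnd ℂ (hadNorm ^ (2 + N + n + n)) = hadNorm ^ (2 + N + n + n) := by
      rw [map_pow, conj_hadNorm]
    rw [outputDensity, Matrix.of_apply]
    simp only [lrun_finalGates_labelBits]
    have hq : ∀ (u u' : Basis n) (X Y : ℂ), ∑ q : Basis n, (if q = u then X else 0) *
        starRingEnd ℂ (if q = u' then Y else 0) = if u = u' then X * starRingEnd ℂ Y else 0 := by
      intro u u' X Y
      rw [Finset.sum_eq_single u]
      · by_cases h : u = u' <;> simp [h]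
      · intro q _ hq
        simp [hq]
      · simp
    simp only [Fintype.sum_prod_type, hq, Fin.sum_univ_two, zero_smul, one_smul, if_true, add_zero]
    rw [mul_add]
    congr 1
    · have : ∀ z : Fin N → Fin 2, ∑ a : Basis n, ∑ r : Basis n, hadNorm ^ (2 + N + n + n) *
          (1 + bitSign 0 • Ψ z) a b * starRingEnd ℂ (hadNorm ^ (2 + N + n + n) *
          (1 + bitSign 0 • Ψ z) a b') = ∑ r : Basis n, (1 / 4 / 2 ^ N / 2 ^ n / 2 ^ n) *
          ∑ a : Basis n, (1 + bitSign 0 • Ψ z) a b *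
            starRingEnd ℂ ((1 + bitSign 0 • Ψ z) a b') := by
        intro z
        rw [Finset.sum_comm]
        refine Finset.sum_congr rfl fun r _ => ?_
        rw [Finset.mul_sum]
        refine Finset.sum_congr rfl fun a _ => ?_
        rw [map_mul, hc, ← hnorm]
        ring
      rw [Finset.sum_congr rfl fun z _ => this z, Finset.sum_comm, Finset.mul_sum]
      simp only [← Finset.mul_sum]
    · by_cases h : b = b'
      · subst h
        simp only [if_true]
        have : ∀ z : Fin N → Fin 2, ∑ a : Basis n, ∑ r : Basis n, hadNorm ^ (2 + N + n + n) *
            (1 + bitSign 1 • Ψ z) a (b + r) * starRingEnd ℂ (hadNorm ^ (2 + N + n + n) *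
            (1 + bitSign 1 • Ψ z) a (b + r)) =
            (1 / 4 / 2 ^ N / 2 ^ n / 2 ^ n) * ∑ r : Basis n,
            ∑ a : Basis n, (1 + bitSign 1 • Ψ z) a (b + r) *
              starRingEnd ℂ ((1 + bitSign 1 • Ψ z) a (b + r)) := by
          intro z
          rw [Finset.sum_comm, Finset.mul_sum]
          refine Finset.sum_congr rfl fun r _ => ?_
          rw [Finset.mul_sum]
          refine Finset.sum_congr rfl fun a _ => ?_
          rw [map_mul, hc, ← hnorm]
          ring
        simp only [this, ← Finset.mul_sum]
        rw [Finset.sum_comm]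
      · simp [h]
  rw [hexp]
  simp only [hterm]
  -- Shifting the output by all `r` sums the whole diagonal, so only the trace of C remains in the
  -- failure branch.
  have htr : ∑ r : Basis n, (2 ^ N * ((2 : ℂ) • 1 + (2 * bitSign 1) • C) (b + r) (b + r) : ℂ) =
      2 ^ N * (2 * 2 ^ n - 2 * C.trace) := by
    have hshift := Equiv.sum_comp (Equiv.addLeft b) fun r =>
      (2 ^ N * ((2 : ℂ) • 1 + (2 * bitSign 1) • C) r r : ℂ)
    simp only [Equiv.coe_addLeft] at hshift
    rw [hshift, ← Finset.mul_sum]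
    congr 1
    have : ∑ r : Basis n, ((2 : ℂ) • 1 + (2 * bitSign 1) • C) r r =
        ((2 : ℂ) • 1 + (2 * bitSign 1) • C).trace := rfl
    rw [this, Matrix.trace_add, Matrix.trace_smul, Matrix.trace_smul, Matrix.trace_one]
    simp
    ring
  rw [htr]
  have h2N : (2 : ℂ) ^ N ≠ 0 := by positivity
  have h2n : (2 : ℂ) ^ n ≠ 0 := by positivity
  simp only [Finset.sum_const, Finset.card_univ, nsmul_eq_mul, Fintype.card_fun, Fintype.card_fin,
    Matrix.add_apply, Matrix.smul_apply, Matrix.one_apply, smul_eq_mul, bitSign_zero,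
    Matrix.transpose_apply, eq_comm (a := b') (b := b)]
  push_cast
  by_cases h : b = b'
  · simp only [h, if_true]
    field_simp
    ring
  · simp only [h, if_false]
    field_simp
    ring

theorem isDensityMatrix_outputDensity {Ψ : (Fin N → Fin 2) → Matrix (Basis n) (Basis n) ℂ}
    (hΨ : average (fun z => (Ψ z).conjTranspose * Ψ z) = 1) (hC : (average Ψ).IsHermitian) :
    IsDensityMatrix (outputDensity N (lrun (finalGates n) (walkState n N Ψ)) :
      Matrix (Basis n) (Basis n) ℂ) := by
  refine ⟨outputDensity_posSemidef _, ?_⟩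
  rw [outputDensity_lrun_finalGates hΨ hC, Matrix.trace_smul, Matrix.trace_add, Matrix.trace_smul,
    Matrix.trace_smul, Matrix.trace_one, Matrix.trace_transpose]
  simp
  field_simp
  ring

/-- The state produced for a row of the table. -/
def rowDensity (s k : ℕ) (e : Fin m → SignedPauli n) : Matrix (Basis n) (Basis n) ℂ :=
  outputDensity (indexSize s) (lrun (registerGates s k e) zeroState)

theorem transpose_aeval {α : Type*} [Fintype α] [DecidableEq α] (A : Matrix α α ℂ)
    (p : Polynomial ℝ) :
    (Polynomial.aeval A p).transpose = Polynomial.aeval A.transpose p := by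
  simp only [Polynomial.aeval_eq_sum_range, Matrix.transpose_sum, Matrix.transpose_smul,
    Matrix.transpose_pow]

theorem isHermitian_aeval {α : Type*} [Fintype α] [DecidableEq α] {A : Matrix α α ℂ}
    (hA : A.IsHermitian) (p : Polynomial ℝ) : (Polynomial.aeval A p).IsHermitian := by
  simp only [Matrix.IsHermitian, Polynomial.aeval_eq_sum_range, Matrix.conjTranspose_sum,
    Matrix.conjTranspose_smul, Matrix.conjTranspose_pow, hA.eq, star_trivial]

theorem average_walk_walkMat (s k : ℕ) (e : Fin m → SignedPauli n) (hm : m ≤ 2 ^ s) :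
    average (walk (walkMat (2 ^ s) (indexSize s) e) k) =
      (Polynomial.aeval ((1 / (2 ^ s : ℕ) : ℝ) • rowSum e)
        (Polynomial.Chebyshev.T ℝ k)).transpose := by
  rw [(average_walk (walkMat_mul_self s (indexSize s) e) k).1, neg_average_walkMat s e hm (N := indexSize s) le_rfl,
    transpose_aeval]

theorem isHermitian_average_walk (s k : ℕ) (e : Fin m → SignedPauli n) (hm : m ≤ 2 ^ s) :
    (average (walk (walkMat (2 ^ s) (indexSize s) e) k)).IsHermitian := by
  rw [average_walk_walkMat s k e hm]
  refine (isHermitian_aeval ?_ _).transpose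
  rw [Matrix.IsHermitian, Matrix.conjTranspose_smul, (rowSum_isHermitian e).eq, star_trivial]

theorem isDensityMatrix_rowDensity (s k : ℕ) (e : Fin m → SignedPauli n) (hm : m ≤ 2 ^ s) :
    IsDensityMatrix (rowDensity s k e) := by
  rw [rowDensity, lrun_registerGates]
  exact isDensityMatrix_outputDensity (average_conjTranspose_mul_walk (walkMat_mul_self _ _ _)
    (walkMat_isHermitian _ _ _) k) (isHermitian_average_walk s k e hm)

/-- The value of `c` is immaterial, since it multiplies the vanishing traces of the entries of a
good row. -/
theorem exists_rowDensity_eq (s k : ℕ) (e : Fin m → SignedPauli n) (hm : m ≤ 2 ^ s) : ∃ c : ℂ,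
    rowDensity s k e = (1 / 2 ^ n : ℂ) • (c • 1 + (1 / 2 : ℂ) •
      Polynomial.aeval ((1 / (2 ^ s : ℕ) : ℝ) • rowSum e) (Polynomial.Chebyshev.T ℝ k)) := by
  refine ⟨1 - (average (walk (walkMat (2 ^ s) (indexSize s) e) k)).trace / 2 ^ n / 2, ?_⟩
  rw [rowDensity, lrun_registerGates, outputDensity_lrun_finalGates
    (average_conjTranspose_mul_walk (walkMat_mul_self _ _ _) (walkMat_isHermitian _ _ _) k)
    (isHermitian_average_walk s k e hm), average_walk_walkMat s k e hm, Matrix.transpose_transpose]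

theorem GoodRow.le_rowMean_rowDensity {e : Fin m → SignedPauli n} (he : GoodRow e) (hm : 0 < m)
    {t : ℕ} (hmt : m ≤ (2 ^ t) ^ 2) (ht : (2 ^ t) ^ 2 < 4 * m) :
    1 / (16 * Real.sqrt m) ≤ rowMean (rowDensity (2 * t) (4 * (2 ^ t / 8) + 1) e) e := by
  have hpow : 2 ^ (2 * t) = (2 ^ t) ^ 2 := by rw [mul_comm, pow_mul]
  obtain ⟨c, hc⟩ := exists_rowDensity_eq (2 * t) (4 * (2 ^ t / 8) + 1) e (hpow ▸ hmt)
  -- A power of two is at most 4 or a multiple of 8; these are the two cases of `walk_bound`.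
  have hq : 2 ^ t ≤ 4 ∧ 2 ^ t / 8 = 0 ∨ 2 ^ t = 8 * (2 ^ t / 8) := by
    by_cases h : t < 3
    · left
      interval_cases t <;> simp
    · right
      obtain ⟨u, rfl⟩ := Nat.exists_eq_add_of_le (not_lt.1 h)
      rw [pow_add]
      norm_num
  have := he.le_rowMean hm (Nat.one_le_two_pow (n := t)) hmt ht hq c
  rw [hc, hpow]
  exact_mod_cast this

end Register

/-! ### Several registers -/

/-- Gates act on labels of the machine as on labels of the register. -/
theorem LGate.apply_toGate {α : Type*} [DecidableEq α] {V : α → Prop} {π : α → ℕ}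
    (hπ : ∀ p q, V p → V q → π p = π q → p = q) {R : (ℕ → Fin 2) → α → Fin 2}
    (hR : ∀ X p, V p → R X p = X (π p))
    (hupd : ∀ X p b, V p → R (Function.update X (π p) b) = Function.update (R X) p b)
    {χ : (ℕ → Fin 2) → ℂ} (hχ : ∀ X p b, V p → χ (Function.update X (π p) b) = χ X)
    (φ : (α → Fin 2) → ℂ) {g : LGate α} (hg : ∀ p ∈ g.labels, V p) :
    (g.toGate π).apply (fun X => φ (R X) * χ X) = fun X => g.apply φ (R X) * χ X := by
  cases g with
  | had q =>
    have hq := hg q (by simp [LGate.labels])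
    funext X
    simp only [LGate.toGate, Gate.apply, LGate.apply, applyOne, lapplyOne, Finset.sum_mul,
      hupd _ _ _ hq, hχ _ _ _ hq, hR _ _ hq, mul_assoc]
  | tee q =>
    have hq := hg q (by simp [LGate.labels])
    funext X
    simp only [LGate.toGate, Gate.apply, LGate.apply, applyOne, lapplyOne, Finset.sum_mul,
      hupd _ _ _ hq, hχ _ _ _ hq, hR _ _ hq, mul_assoc]
  | cnot c t =>
    have hc := hg c (by simp [LGate.labels])
    have ht := hg t (by simp [LGate.labels])
    have h : π c = π t ↔ c = t := ⟨hπ _ _ hc ht, congrArg π⟩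
    funext X
    simp only [LGate.toGate, Gate.apply, LGate.apply, h]
    split_ifs
    · rfl
    · simp only [hupd _ _ _ ht, hχ _ _ _ ht, hR _ _ ht, hR _ _ hc]
  | toffoli a b t =>
    have ha := hg a (by simp [LGate.labels])
    have hb := hg b (by simp [LGate.labels])
    have ht := hg t (by simp [LGate.labels])
    have h : (π a = π t ∨ π b = π t) ↔ (a = t ∨ b = t) :=
      or_congr ⟨hπ _ _ ha ht, congrArg π⟩ ⟨hπ _ _ hb ht, congrArg π⟩
    funext X
    simp only [LGate.toGate, Gate.apply, LGate.apply, h]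
    split_ifs
    · rfl
    · simp only [hupd _ _ _ ht, hχ _ _ _ ht, hR _ _ ht, hR _ _ ha, hR _ _ hb]

section Layout

/-- The labels of a register with `n` qubits and an index of `N` qubits. -/
def Valid (n N : ℕ) : Lab → Prop
  | .out k => k < n
  | .A k => k < n
  | .r k => k < n
  | .q k => k < n
  | .J v => v < N
  | .h v => v ≤ N

/-- The number of ancillas of a register. -/
def blockSize (n N : ℕ) : ℕ := 2 * N + 1 + 3 * n

/-- The place of an ancilla in its block. -/
def blockOffset (n N : ℕ) : Lab → ℕ
  | .out k => k
  | .J v => v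
  | .h v => N + v
  | .A k => 2 * N + 1 + k
  | .r k => 2 * N + 1 + n + k
  | .q k => 2 * N + 1 + 2 * n + k

/-- The ancilla at a place of a block. -/
def blockLabel (n N o : ℕ) : Lab :=
  if o < N then .J o else if o < 2 * N + 1 then .h (o - N)
  else if o < 2 * N + 1 + n then .A (o - (2 * N + 1))
  else if o < 2 * N + 1 + 2 * n then .r (o - (2 * N + 1 + n)) else .q (o - (2 * N + 1 + 2 * n))

/-- The qubit with the given label in register `i` of `l`. -/
def address (n l N i : ℕ) : Lab → ℕ
  | .out k => i * n + k
  | p => l * n + i * blockSize n N + blockOffset n N p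

/-- The ancilla labels. -/
def IsAncilla : Lab → Prop
  | .out _ => False
  | _ => True

variable {n l N : ℕ}

theorem address_of_isAncilla (i : ℕ) {p : Lab} (hp : IsAncilla p) :
    address n l N i p = l * n + i * blockSize n N + blockOffset n N p := by
  cases p <;> first | exact hp.elim | rfl

theorem blockOffset_lt {p : Lab} (hV : Valid n N p) (hp : IsAncilla p) :
    blockOffset n N p < blockSize n N := by
  unfold blockSize
  cases p <;> simp only [Valid, IsAncilla, blockOffset] at * <;> omega

theorem blockLabel_blockOffset {p : Lab} (hV : Valid n N p) (hp : IsAncilla p) :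
    blockLabel n N (blockOffset n N p) = p := by
  cases p with
  | out k => exact hp.elim
  | J v => exact if_pos hV
  | h v =>
    have hv : v ≤ N := hV
    rw [blockOffset, blockLabel, if_neg (by omega), if_pos (by omega)]
    congr 1
    omega
  | A k =>
    have hk : k < n := hV
    rw [blockOffset, blockLabel, if_neg (by omega), if_neg (by omega), if_pos (by omega)]
    congr 1
    omega
  | r k =>
    have hk : k < n := hV
    rw [blockOffset, blockLabel, if_neg (by omega), if_neg (by omega), if_neg (by omega),
      if_pos (by omega)]
    congr 1
    omega
  | q k =>
    have hk : k < n := hV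
    rw [blockOffset, blockLabel, if_neg (by omega), if_neg (by omega), if_neg (by omega),
      if_neg (by omega)]
    congr 1
    omega

theorem blockLabel_spec {o : ℕ} (ho : o < blockSize n N) : Valid n N (blockLabel n N o) ∧
    IsAncilla (blockLabel n N o) ∧ blockOffset n N (blockLabel n N o) = o := by
  unfold blockLabel
  unfold blockSize at ho
  split_ifs <;> refine ⟨?_, trivial, ?_⟩ <;> simp only [Valid, blockOffset] <;> omega

theorem address_inj {i i' : ℕ} (hi : i < l) (hi' : i' < l) {p p' : Lab} (hp : Valid n N p)
    (hp' : Valid n N p') (h : address n l N i p = address n l N i' p') : i = i' ∧ p = p' := by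
  have hlt : ∀ {i k : ℕ}, i < l → k < n → i * n + k < l * n := fun {i k} hi hk =>
    calc i * n + k < i * n + n := by omega
      _ = (i + 1) * n := by ring
      _ ≤ l * n := Nat.mul_le_mul_right _ hi
  have key : ∀ {w a b c d : ℕ}, c < w → d < w → a * w + c = b * w + d → a = b ∧ c = d := by
    intro w a b c d hc hd h
    have h1 : a = b := by
      have : (a * w + c) / w = (b * w + d) / w := by rw [h]
      rwa [mul_comm a, mul_comm b, Nat.mul_add_div (by omega), Nat.mul_add_div (by omega),
        Nat.div_eq_of_lt hc, Nat.div_eq_of_lt hd] at this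
    subst h1
    exact ⟨rfl, by omega⟩
  by_cases ha : IsAncilla p <;> by_cases ha' : IsAncilla p'
  · rw [address_of_isAncilla _ ha, address_of_isAncilla _ ha'] at h
    obtain ⟨h1, h2⟩ := key (blockOffset_lt hp ha) (blockOffset_lt hp' ha')
      (by omega : i * blockSize n N + _ = i' * blockSize n N + _)
    exact ⟨h1, by rw [← blockLabel_blockOffset hp ha, h2, blockLabel_blockOffset hp' ha']⟩
  · rw [address_of_isAncilla _ ha] at h
    cases p' <;> first | exact (ha' trivial).elim | skip
    have := hlt hi' hp'
    simp only [address] at h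
    omega
  · rw [address_of_isAncilla _ ha'] at h
    cases p <;> first | exact (ha trivial).elim | skip
    have := hlt hi hp
    simp only [address] at h
    omega
  · cases p <;> first | exact (ha trivial).elim | skip
    cases p' <;> first | exact (ha' trivial).elim | skip
    obtain ⟨h1, h2⟩ := key hp hp' h
    exact ⟨h1, by rw [h2]⟩

theorem address_lt {i : ℕ} (hi : i < l) {p : Lab} (hp : Valid n N p) :
    address n l N i p < l * n + l * blockSize n N := by
  have hlt : ∀ {w o : ℕ}, o < w → i * w + o < l * w := fun {w o} ho =>
    calc i * w + o < i * w + w := by omega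
      _ = (i + 1) * w := by ring
      _ ≤ l * w := Nat.mul_le_mul_right _ hi
  by_cases ha : IsAncilla p
  · rw [address_of_isAncilla _ ha]
    have := hlt (blockOffset_lt hp ha)
    omega
  · cases p <;> first | exact (ha trivial).elim | skip
    have := hlt (w := n) hp
    simp only [address]
    omega

theorem exists_address_eq (q : ℕ) (hq : q < l * n + l * blockSize n N) :
    ∃ i < l, ∃ p, Valid n N p ∧ address n l N i p = q := by
  have hdm : ∀ w q : ℕ, q / w * w + q % w = q := fun w q => Nat.div_add_mod' q w
  by_cases h : q < l * n
  · have hn : 0 < n := Nat.pos_of_ne_zero (by rintro rfl; simp at h)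
    exact ⟨q / n, Nat.div_lt_of_lt_mul (by rwa [mul_comm]), .out (q % n), Nat.mod_lt _ hn, hdm n q⟩
  · have hw : 0 < blockSize n N := by unfold blockSize; omega
    have hspec := blockLabel_spec (Nat.mod_lt (q - l * n) hw)
    refine ⟨(q - l * n) / blockSize n N, Nat.div_lt_of_lt_mul (by
      have := mul_comm l (blockSize n N)
      omega),
      blockLabel n N ((q - l * n) % blockSize n N), hspec.1, ?_⟩
    rw [address_of_isAncilla _ hspec.2.1, hspec.2.2]
    have := hdm (blockSize n N) (q - l * n)
    omega

open Classical in
/-- The bits of register `i`. -/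
def readBits (n l N i : ℕ) (X : ℕ → Fin 2) (p : Lab) : Fin 2 :=
  if Valid n N p then X (address n l N i p) else 0

theorem readBits_update_self {i : ℕ} (hi : i < l) (X : ℕ → Fin 2) {p : Lab} (hp : Valid n N p)
    (b : Fin 2) : readBits n l N i (Function.update X (address n l N i p) b) =
      Function.update (readBits n l N i X) p b := by
  funext p'
  by_cases h : p' = p
  · subst h
    simp [readBits, hp]
  · rw [Function.update_of_ne h]
    unfold readBits
    split_ifs with hp'
    · rw [Function.update_of_ne]
      exact fun h' => h (address_inj hi hi hp' hp h').2
    · rfl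

theorem readBits_update_of_ne {i i' : ℕ} (hi : i < l) (hi' : i' < l) (hne : i' ≠ i)
    (X : ℕ → Fin 2) {p : Lab} (hp : Valid n N p) (b : Fin 2) :
    readBits n l N i' (Function.update X (address n l N i p) b) = readBits n l N i' X := by
  funext p'
  unfold readBits
  split_ifs with hp'
  · rw [Function.update_of_ne]
    exact fun h' => hne (address_inj hi' hi hp' hp h').1
  · rfl

open Classical in
/-- A product state of the registers. -/
def productState (n l N : ℕ) (φ : Fin l → (Lab → Fin 2) → ℂ) : Amplitudes := fun X =>
  (∏ i, φ i (readBits n l N i X)) * if ∀ q, l * n + l * blockSize n N ≤ q → X q = 0 then 1 else 0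

/-- A gate of register i changes only its own factor. The other registers and the unused qubits form
the spectator factor χ of `LGate.apply_toGate`. -/
theorem foldl_toGate_productState (φ : Fin l → (Lab → Fin 2) → ℂ) (i : Fin l)
    (gs : List (LGate Lab)) (hgs : ∀ g ∈ gs, ∀ p ∈ g.labels, Valid n N p) :
    (gs.map (LGate.toGate (address n l N i))).foldl (fun ψ g => g.apply ψ)
      (productState n l N φ) = productState n l N (Function.update φ i (lrun gs (φ i))) := by
  classical
  have hsplit : ∀ (φ : Fin l → (Lab → Fin 2) → ℂ) (f : (Lab → Fin 2) → ℂ),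
      productState n l N (Function.update φ i f) = fun X => f (readBits n l N i X) *
        ((∏ j ∈ Finset.univ.erase i, φ j (readBits n l N j X)) *
          if ∀ q, l * n + l * blockSize n N ≤ q → X q = 0 then 1 else 0) := by
    intro φ f
    funext X
    rw [productState, ← Finset.mul_prod_erase _ _ (Finset.mem_univ i), Function.update_self,
      mul_assoc]
    congr 2
    refine Finset.prod_congr rfl fun j hj => ?_
    rw [Function.update_of_ne (Finset.ne_of_mem_erase hj)]
  induction gs generalizing φ with
  | nil => simp
  | cons g gs ih =>
    have h1 : productState n l N φ = productState n l N (Function.update φ i (φ i)) := by simp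
    rw [List.map_cons, List.foldl_cons, h1, hsplit, LGate.apply_toGate (V := Valid n N)
      (R := readBits n l N i)
      (fun p q hp hq h => (address_inj i.2 i.2 hp hq h).2)
      (fun X p hp => if_pos hp) (fun X p b hp => readBits_update_self i.2 X hp b) ?_ _
      (hgs g List.mem_cons_self), ← hsplit, ih _ fun g hg => hgs g (List.mem_cons_of_mem _ hg)]
    · simp
    · intro X p b hp
      congr 1
      · refine Finset.prod_congr rfl fun j hj => ?_
        rw [readBits_update_of_ne i.2 j.2
          (fun h => Finset.ne_of_mem_erase hj (Fin.ext h)) X hp]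
      · refine if_congr (forall_congr' fun q => forall_congr' fun hq => ?_) rfl rfl
        rw [Function.update_of_ne]
        have := address_lt i.2 hp
        omega

theorem foldl_flatMap_productState (φ : Fin l → (Lab → Fin 2) → ℂ)
    (G : Fin l → List (LGate Lab)) (hG : ∀ i, ∀ g ∈ G i, ∀ p ∈ g.labels, Valid n N p)
    (L : List (Fin l)) (hL : L.Nodup) :
    (L.flatMap fun i => (G i).map (LGate.toGate (address n l N i))).foldl
      (fun ψ g => g.apply ψ) (productState n l N φ) =
        productState n l N fun i => if i ∈ L then lrun (G i) (φ i) else φ i := by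
  induction L generalizing φ with
  | nil => simp
  | cons i L ih =>
    obtain ⟨hi, hL⟩ := List.nodup_cons.1 hL
    rw [List.flatMap_cons, List.foldl_append, foldl_toGate_productState _ _ _ (hG i), ih _ hL]
    congr 1
    funext j
    by_cases hj : j = i
    · subst hj
      simp [hi]
    · simp [hj]

/-- The circuit of all registers. -/
def moneyGates (n l N : ℕ) (G : Fin l → List (LGate Lab)) : List Gate :=
  (List.finRange l).flatMap fun i => (G i).map (LGate.toGate (address n l N i))

open Classical in
theorem runCircuit_moneyGates (G : Fin l → List (LGate Lab))
    (hG : ∀ i, ∀ g ∈ G i, ∀ p ∈ g.labels, Valid n N p) :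
    runCircuit (moneyGates n l N G) = productState n l N fun i => lrun (G i) zeroState := by
  have h0 : (fun X : ℕ → Fin 2 => if X = 0 then (1 : ℂ) else 0) =
      productState n l N fun _ => zeroState := by
    funext X
    simp only [productState, zeroState]
    by_cases hX : X = 0
    · subst hX
      have : ∀ i : Fin l, readBits n l N i 0 = 0 := by
        intro i
        funext p
        simp [readBits]
      simp [this]
    · rw [if_neg hX, eq_comm, mul_eq_zero]
      by_contra hcon
      rw [not_or] at hcon
      obtain ⟨h1, h2⟩ := hcon
      apply hX
      have h2' : ∀ q, l * n + l * blockSize n N ≤ q → X q = 0 := by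
        by_contra h
        exact h2 (if_neg h)
      funext q
      by_cases hq : q < l * n + l * blockSize n N
      · obtain ⟨i, hi, p, hp, rfl⟩ := exists_address_eq q hq
        replace h1 := Finset.prod_ne_zero_iff.1 h1
        have h3 : readBits n l N i X = 0 := by
          by_contra h
          exact h1 ⟨i, hi⟩ (Finset.mem_univ _) (if_neg h)
        have := congrFun h3 p
        rwa [readBits, if_pos hp] at this
      · exact h2' q (by omega)
  have := foldl_flatMap_productState (fun _ => zeroState) G hG _ (List.nodup_finRange l)
  simp only [List.mem_finRange, if_true] at this
  rw [← this, ← h0]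
  unfold runCircuit moneyGates
  congr!

theorem width_le_circuitWidth {gs : List Gate} {g : Gate} (hg : g ∈ gs) :
    g.width ≤ circuitWidth gs := by
  unfold circuitWidth
  induction gs with
  | nil => simp at hg
  | cons g' gs ih =>
    rw [List.map_cons, List.foldr_cons]
    rcases List.mem_cons.1 hg with rfl | h
    · exact le_max_left _ _
    · exact (ih h).trans (le_max_right _ _)

/-! #### The partial trace over the ancillas -/

/-- The ancilla bits of a bit string. -/
def ancillaBits (n N : ℕ) (x : Lab → Fin 2) : Ancilla n N :=
  (x (.h 0), fun v => x (.J v), fun k => x (.A k), fun k => x (.r k), fun k => x (.q k))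

theorem ancillaBits_labelBits (b : Basis n) (y : Ancilla n N) :
    ancillaBits n N (labelBits b y) = y := by
  simp [ancillaBits, labelBits, extendBits_val]

theorem labelBits_ancillaBits (b : Basis n) {x : Lab → Fin 2} (hx : ∀ v, x (.h (v + 1)) = 0)
    {p : Lab} (hV : Valid n N p) (hp : IsAncilla p) : labelBits b (ancillaBits n N x) p = x p := by
  cases p with
  | out k => exact hp.elim
  | h v =>
    cases v with
    | zero => rfl
    | succ v => exact (hx v).symm
  | _ => exact extendBits_of_lt _ hV

theorem labelBits_congr (b b' : Basis n) (y : Ancilla n N) {p : Lab} (hp : IsAncilla p) :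
    labelBits b y p = labelBits b' y p := by
  cases p with
  | out k => exact hp.elim
  | h v => cases v <;> rfl
  | _ => rfl

/-- The ancilla qubits of all registers. -/
def joinAncillas (n l N w : ℕ) (Y : Fin l → Ancilla n N) : Basis w := fun q =>
  if h : (q : ℕ) / blockSize n N < l then
    labelBits 0 (Y ⟨(q : ℕ) / blockSize n N, h⟩) (blockLabel n N (q % blockSize n N)) else 0

theorem assemble_address_of_isAncilla {w : ℕ} (hw : l * blockSize n N ≤ w) (x : MoneyBasis n l)
    (z : Basis w) {i : ℕ} (hi : i < l) {p : Lab} (hp : Valid n N p) (ha : IsAncilla p) :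
    ∃ h : i * blockSize n N + blockOffset n N p < w, assemble x z (address n l N i p) =
      z ⟨i * blockSize n N + blockOffset n N p, h⟩ := by
  have h1 := address_lt hi hp
  rw [address_of_isAncilla i ha] at h1 ⊢
  have h2 : i * blockSize n N + blockOffset n N p < w := by omega
  refine ⟨h2, ?_⟩
  have h3 : l * n + i * blockSize n N + blockOffset n N p - l * n =
      i * blockSize n N + blockOffset n N p := by omega
  rw [assemble, dif_neg (by omega), dif_pos (by rw [h3]; exact h2)]
  congr 2

theorem readBits_assemble_joinAncillas {w : ℕ} (hw : l * blockSize n N ≤ w) (x : MoneyBasis n l)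
    (Y : Fin l → Ancilla n N) (i : Fin l) :
    readBits n l N i (assemble x (joinAncillas n l N w Y)) = labelBits (x i) (Y i) := by
  funext p
  by_cases hp : Valid n N p
  · rw [readBits, if_pos hp]
    by_cases ha : IsAncilla p
    · obtain ⟨h, h'⟩ := assemble_address_of_isAncilla hw x (joinAncillas n l N w Y) i.2 hp ha
      have ho := blockOffset_lt hp ha
      have hdiv : ((i : ℕ) * blockSize n N + blockOffset n N p) / blockSize n N = i := by
        rw [mul_comm, Nat.mul_add_div (by omega), Nat.div_eq_of_lt ho, add_zero]
      have hmod : ((i : ℕ) * blockSize n N + blockOffset n N p) % blockSize n N =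
          blockOffset n N p := by
        rw [Nat.mul_add_mod_self_right, Nat.mod_eq_of_lt ho]
      rw [h', joinAncillas]
      simp only [hdiv, hmod, i.2, dif_pos, blockLabel_blockOffset hp ha]
      exact labelBits_congr _ _ _ ha
    · cases p <;> first | exact (ha trivial).elim | skip
      rename_i k
      have hk : k < n := hp
      have hlt : (i : ℕ) * n + k < l * n := by
        have := Nat.mul_le_mul_right n (Nat.succ_le_of_lt i.2)
        rw [Nat.succ_mul] at this
        omega
      have he : finProdFinEquiv.symm ⟨(i : ℕ) * n + k, hlt⟩ = (i, ⟨k, hk⟩) := by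
        rw [Equiv.symm_apply_eq]
        ext
        simp [finProdFinEquiv]
        ring
      change assemble x _ ((i : ℕ) * n + k) = extendBits (x i) k
      rw [assemble, dif_pos hlt, he, extendBits_of_lt _ hk]
  · rw [readBits, if_neg hp]
    cases p with
    | h v =>
      cases v with
      | zero => exact (hp (Nat.zero_le _)).elim
      | succ v => rfl
    | _ => exact (extendBits_of_le _ (not_lt.1 hp)).symm

theorem injective_joinAncillas {w : ℕ} (hw : l * blockSize n N ≤ w) :
    Function.Injective (joinAncillas n l N w) := by
  intro Y Y' h
  funext i
  have h1 := readBits_assemble_joinAncillas hw 0 Y i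
  rw [h, readBits_assemble_joinAncillas hw 0 Y' i] at h1
  rw [← ancillaBits_labelBits ((0 : MoneyBasis n l) i) (Y i), ← h1, ancillaBits_labelBits]

/-- The partial trace runs over `circuitWidth gs` qubits, and in the blocks the nodes above `h 0`
are not part of `Ancilla`. Strings outside the range of `joinAncillas` have amplitude zero, and the
sum over the others factorizes. -/
theorem outputState_eq_tensor {gs : List Gate} {F : Fin l → (Lab → Fin 2) → ℂ}
    (hgs : runCircuit gs = productState n l N F) (hw : l * blockSize n N ≤ circuitWidth gs)
    (hF : ∀ i x, F i x ≠ 0 → ∀ v, x (.h (v + 1)) = 0) :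
    outputState n l gs = tensor fun i => outputDensity N (F i) := by
  have hjoin : ∀ (x : MoneyBasis n l) (Y : Fin l → Ancilla n N),
      productState n l N F (assemble x (joinAncillas n l N (circuitWidth gs) Y)) =
        ∏ i, F i (labelBits (x i) (Y i)) := by
    intro x Y
    rw [productState, if_pos, mul_one]
    · refine Finset.prod_congr rfl fun i _ => ?_
      rw [readBits_assemble_joinAncillas hw]
    · intro q hq
      rw [assemble, dif_neg (by omega)]
      split_ifs with h
      · have h1 : ¬ (q - l * n) / blockSize n N < l := by
          rw [not_lt, Nat.le_div_iff_mul_le (by unfold blockSize; omega)]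
          omega
        rw [joinAncillas]
        simp only [h1, dif_neg, not_false_eq_true]
      · rfl
  have hrange : ∀ (x : MoneyBasis n l) (z : Basis (circuitWidth gs)),
      z ∉ Set.range (joinAncillas n l N (circuitWidth gs)) →
        productState n l N F (assemble x z) = 0 := by
    intro x z hz
    by_contra hne
    obtain ⟨h1, h2⟩ := mul_ne_zero_iff.1 hne
    rw [Finset.prod_ne_zero_iff] at h1
    have h2' : ∀ q, l * n + l * blockSize n N ≤ q → assemble x z q = 0 := by
      by_contra h
      exact h2 (if_neg h)
    refine hz ⟨fun i => ancillaBits n N (readBits n l N i (assemble x z)), ?_⟩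
    funext q
    rw [joinAncillas]
    split_ifs with hq
    · have hspec := blockLabel_spec
        (Nat.mod_lt (q : ℕ) (by unfold blockSize; omega : 0 < blockSize n N))
      rw [labelBits_ancillaBits _ (hF _ _ (h1 ⟨_, hq⟩ (Finset.mem_univ _))) hspec.1 hspec.2.1,
        readBits, if_pos hspec.1]
      obtain ⟨h, h'⟩ := assemble_address_of_isAncilla hw x z hq hspec.1 hspec.2.1
      rw [h']
      congr 1
      ext
      simp only [hspec.2.2, Nat.div_add_mod']
    · rw [not_lt, Nat.le_div_iff_mul_le (by unfold blockSize; omega)] at hq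
      have := h2' (l * n + q) (by omega)
      rw [assemble, dif_neg (by omega), dif_pos (by simp)] at this
      rw [← this]
      congr 1
      ext
      simp
  ext x y
  rw [outputState, Matrix.of_apply, hgs, tensor, Matrix.of_apply]
  rw [← Fintype.sum_of_injective _ (injective_joinAncillas hw)
    (fun Y => ∏ i, (F i (labelBits (x i) (Y i)) * starRingEnd ℂ (F i (labelBits (y i) (Y i))))) _
    (fun z hz => by rw [hrange x z hz, zero_mul])
    (fun Y => by rw [hjoin, hjoin, map_prod, Finset.prod_mul_distrib])]
  simp only [outputDensity, Matrix.of_apply]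
  rw [Finset.prod_univ_sum, Fintype.piFinset_univ]

/-! #### The circuit of the forger -/

variable {m : ℕ}

theorem valid_flatMap {ι : Type*} {L : List ι} {f : ι → List (LGate Lab)}
    (h : ∀ a ∈ L, ∀ g ∈ f a, ∀ p ∈ g.labels, Valid n N p) :
    ∀ g ∈ L.flatMap f, ∀ p ∈ g.labels, Valid n N p := by
  intro g hg
  obtain ⟨a, ha, hg⟩ := List.mem_flatMap.1 hg
  exact h a ha g hg

theorem valid_treeGates {t : ℕ} (ht : 2 * t ≤ N) :
    ∀ g ∈ treeGates t, ∀ p ∈ g.labels, Valid n N p := by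
  refine valid_flatMap fun v hv => ?_
  rw [List.mem_range] at hv
  simp only [List.forall_mem_cons, LGate.labels, Valid, List.not_mem_nil, false_imp_iff,
    implies_true, and_true]
  omega

theorem valid_chainGates : ∀ g ∈ chainGates N, ∀ p ∈ g.labels, Valid n N p := by
  refine valid_flatMap fun v hv => ?_
  rw [List.mem_range] at hv
  simp only [List.forall_mem_cons, LGate.labels, Valid, List.not_mem_nil, false_imp_iff,
    implies_true, and_true]
  omega

theorem valid_zGate {p : Lab} (hp : Valid n N p) :
    ∀ g ∈ zGate p, ∀ p ∈ g.labels, Valid n N p := by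
  simp [zGate, LGate.labels, hp]

theorem valid_czGate {c t : Lab} (hc : Valid n N c) (ht : Valid n N t) :
    ∀ g ∈ czGate c t, ∀ p ∈ g.labels, Valid n N p := by
  simp [czGate, LGate.labels, hc, ht]

theorem valid_ctrlPauli {c t : Lab} (hc : Valid n N c) (ht : Valid n N t) (P : Pauli) :
    ∀ g ∈ ctrlPauli c t P, ∀ p ∈ g.labels, Valid n N p := by
  cases P <;> simp [ctrlPauli, czGate, sGate, LGate.labels, hc, ht]

theorem valid_leafGates (M : ℕ) (hM : 2 * M ≤ N + 1) (e : Fin m → SignedPauli n) {j : ℕ}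
    (hj : j < M) : ∀ g ∈ leafGates M e j, ∀ p ∈ g.labels, Valid n N p := by
  have hh : Valid n N (.h (M - 1 + j)) := by simp only [Valid]; omega
  have hJ : Valid n N (.J (M - 1 + j)) := by simp only [Valid]; omega
  unfold leafGates
  split_ifs with hjm
  · intro g hg
    rcases List.mem_append.1 hg with hg | hg
    · split_ifs at hg
      · exact valid_zGate hh g hg
      · simp at hg
    · obtain ⟨gs, hgs, hg⟩ := List.mem_flatten.1 hg
      obtain ⟨k, rfl⟩ := (List.mem_ofFn' _ _).1 hgs
      have hA : Valid n N (.A k) := k.2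
      exact valid_ctrlPauli hh hA _ g hg
  · exact valid_czGate hh hJ

theorem valid_hadLayer {qs : List Lab} (h : ∀ q ∈ qs, Valid n N q) :
    ∀ g ∈ hadLayer qs, ∀ p ∈ g.labels, Valid n N p := by
  intro g hg
  obtain ⟨q, hq, rfl⟩ := List.mem_map.1 hg
  simpa [LGate.labels] using h q hq

theorem valid_registerGates (s k : ℕ) (e : Fin m → SignedPauli n) :
    ∀ g ∈ registerGates s k e, ∀ p ∈ g.labels, Valid n (indexSize s) p := by
  have hs : 0 < 2 ^ s := by positivity
  have hJ : ∀ q ∈ List.ofFn fun v : Fin (indexSize s) => Lab.J v, Valid n (indexSize s) q := by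
    intro q hq
    obtain ⟨v, rfl⟩ := (List.mem_ofFn' _ _).1 hq
    exact v.2
  have hrev : ∀ {gs : List (LGate Lab)}, (∀ g ∈ gs, ∀ p ∈ g.labels, Valid n (indexSize s) p) →
      ∀ g ∈ gs.reverse, ∀ p ∈ g.labels, Valid n (indexSize s) p :=
    fun h g hg => h g (List.mem_reverse.1 hg)
  have happ : ∀ {gs hs : List (LGate Lab)}, (∀ g ∈ gs, ∀ p ∈ g.labels, Valid n (indexSize s) p) →
      (∀ g ∈ hs, ∀ p ∈ g.labels, Valid n (indexSize s) p) →
      ∀ g ∈ gs ++ hs, ∀ p ∈ g.labels, Valid n (indexSize s) p :=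
    fun h h' g hg => (List.mem_append.1 hg).elim (h g) (h' g)
  have htree := valid_treeGates (n := n) (N := indexSize s) (t := 2 ^ s - 1)
    (by unfold indexSize; omega)
  refine happ (happ (happ (valid_hadLayer ?_) (valid_flatMap fun k hk => ?_)) ?_) ?_
  · intro q hq
    simp only [List.mem_append, List.mem_cons] at hq
    rcases hq with (rfl | hq) | hq | hq
    · exact Nat.zero_le _
    · exact hJ q hq
    · obtain ⟨v, rfl⟩ := (List.mem_ofFn' _ _).1 hq
      exact v.2
    · obtain ⟨v, rfl⟩ := (List.mem_ofFn' _ _).1 hq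
      exact v.2
  · rw [List.mem_range] at hk
    simp [LGate.labels, Valid, hk]
  · intro g hg
    obtain ⟨gs, hgs, hg⟩ := List.mem_flatten.1 hg
    obtain rfl := List.eq_of_mem_replicate hgs
    refine happ (happ (happ htree ?_) (hrev htree)) (happ (happ (valid_hadLayer hJ)
      (happ (happ valid_chainGates (valid_zGate (p := .h (indexSize s)) (le_refl _)))
        (hrev valid_chainGates))) (valid_hadLayer hJ)) g hg
    refine valid_flatMap fun j hj => ?_
    exact valid_leafGates _ (by unfold indexSize; omega) e (List.mem_range.1 hj)
  · intro g hg
    rcases List.mem_cons.1 hg with rfl | hg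
    · simp [LGate.labels, Valid]
    · refine valid_flatMap (fun k hk => ?_) g hg
      rw [List.mem_range] at hk
      simp [LGate.labels, Valid, hk]

/-- The partial trace must cover all ancillas. The last dephasing qubit of the last register has the
highest address and is the target of a gate, which exists because n > 0. -/
theorem blockSize_le_circuitWidth (s k : ℕ) (E : Table n m l) (hn : 0 < n) :
    l * blockSize n (indexSize s) ≤ circuitWidth (moneyGates n l (indexSize s) fun i =>
      registerGates s k (E i)) := by
  rcases Nat.eq_zero_or_pos l with rfl | hl
  · simp
  have hmem : (LGate.toffoli (.h 0) (.out (n - 1)) (.q (n - 1))).toGate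
      (address n l (indexSize s) (l - 1)) ∈ moneyGates n l (indexSize s) fun i =>
        registerGates s k (E i) := by
    refine List.mem_flatMap.2 ⟨⟨l - 1, by omega⟩, List.mem_finRange _, List.mem_map_of_mem ?_⟩
    refine List.mem_append_right _ (List.mem_cons_of_mem _ (List.mem_flatMap.2 ⟨n - 1, ?_, ?_⟩))
    · rw [List.mem_range]; omega
    · simp
  refine le_trans ?_ (width_le_circuitWidth hmem)
  obtain ⟨l, rfl⟩ := Nat.exists_eq_add_of_lt hl
  have h1 : (0 + l + 1) * blockSize n (indexSize s) =
    l * blockSize n (indexSize s) + blockSize n (indexSize s) := by ring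
  rw [h1]
  simp only [LGate.toGate, Gate.width]
  refine le_trans ?_ (Nat.succ_le_succ (le_max_right _ _))
  simp only [address, blockOffset, zero_add, Nat.add_sub_cancel]
  unfold blockSize
  omega

theorem outputState_moneyGates (s k : ℕ) (E : Table n m l) (hn : 0 < n) :
    outputState n l (moneyGates n l (indexSize s) fun i => registerGates s k (E i)) =
      tensor fun i => rowDensity s k (E i) := by
  rw [outputState_eq_tensor (runCircuit_moneyGates _ fun i => valid_registerGates s k (E i))
    (blockSize_le_circuitWidth s k E hn)]
  · rfl
  · intro i x hx v
    rw [lrun_registerGates, lrun_finalGates] at hx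
    by_contra hv
    have h : ∀ c, ¬ Clean n (indexSize s) (Function.update (unscramble n x) (.h 0) c) := by
      intro c hc
      have := hc.1 v
      rw [Function.update_of_ne (by simp)] at this
      exact hv this
    simp [walkState, h] at hx

end Layout

/-! ### Programs -/

section Programs

/-- The contents of the memory. -/
abbrev Memory : Type := ℕ → ℕ

/-- Started in `s`, the program `P` prints `gs` within `T` steps and leaves a memory with the
property `Q`. -/
def Spec (inp : List ℕ) (P : Prog) (s : Memory) (gs : List Gate) (T : ℕ)
    (Q : Memory → Prop) : Prop :=
  ∃ t s', Exec inp P s gs t s' ∧ t ≤ T ∧ Q s'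

/-- The programs of a list, run one after the other. -/
def block : List Prog → Prog
  | [] => .const 0 0
  | P :: L => .seq P (block L)

/-- The memory after an instruction. -/
def Prog.next (inp : List ℕ) : Prog → Memory → Memory
  | .const d k, s => Function.update s d k
  | .add d a b, s => Function.update s d (s a + s b)
  | .sub d a b, s => Function.update s d (s a - s b)
  | .read d a, s => Function.update s d (inp.getD (s a) 0)
  | _, s => s

/-- The output of an instruction. -/
def Prog.print : Prog → Memory → List Gate
  | .had a, s => [.had (s a)]
  | .tee a, s => [.tee (s a)]
  | .cnot a b, s => [.cnot (s a) (s b)]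
  | .toffoli a b c, s => [.toffoli (s a) (s b) (s c)]
  | _, _ => []

/-- Instructions that write only to cells below `b`. -/
def Prog.writesBelow (b : ℕ) : Prog → Bool
  | .const d _ => d < b
  | .add d _ _ => d < b
  | .sub d _ _ => d < b
  | .read d _ => d < b
  | .had _ => true
  | .tee _ => true
  | .cnot _ _ => true
  | .toffoli _ _ _ => true
  | _ => false

/-- The memory after a list of instructions. -/
def nexts (inp : List ℕ) (L : List Prog) (s : Memory) : Memory :=
  L.foldl (fun s P => P.next inp s) s

/-- The output of a list of instructions. -/
def prints (inp : List ℕ) : List Prog → Memory → List Gate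
  | [], _ => []
  | P :: L, s => P.print s ++ prints inp L (P.next inp s)

variable {inp : List ℕ} {P : Prog} {s : Memory} {gs : List Gate} {T b : ℕ} {Q : Memory → Prop}

theorem Spec.mono {T' : ℕ} {Q' : Memory → Prop} (h : Spec inp P s gs T Q) (hT : T ≤ T')
    (hQ : ∀ s', Q s' → Q' s') : Spec inp P s gs T' Q' :=
  let ⟨t, s', he, ht, hs⟩ := h
  ⟨t, s', he, ht.trans hT, hQ s' hs⟩

theorem Prog.exec_of_writesBelow (h : P.writesBelow b = true) :
    Exec inp P s (P.print s) 1 (P.next inp s) := by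
  cases P <;> first | (simp [Prog.writesBelow] at h; done) | constructor

theorem Prog.next_of_le (h : P.writesBelow b = true) {x : ℕ} (hx : b ≤ x) :
    P.next inp s x = s x := by
  cases P <;> simp only [Prog.writesBelow, decide_eq_true_eq] at h <;>
    simp only [Prog.next] <;> first | rfl | (rw [Function.update_of_ne]; omega)

theorem nexts_of_le {L : List Prog} (h : L.all (Prog.writesBelow b) = true) {x : ℕ} (hx : b ≤ x) :
    nexts inp L s x = s x := by
  induction L generalizing s with
  | nil => rfl
  | cons P L ih =>
    simp only [List.all_cons, Bool.and_eq_true] at h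
    exact (ih h.2).trans (Prog.next_of_le h.1 hx)

theorem Spec.nil (h : Q (Function.update s 0 0)) : Spec inp (block []) s [] 1 Q :=
  ⟨1, _, .const 0 0 s, le_rfl, h⟩

theorem Spec.cons {L : List Prog} {g₁ g₂ : List Gate} {T₁ T₂ : ℕ} {Q₁ : Memory → Prop}
    (h₁ : Spec inp P s g₁ T₁ Q₁) (h₂ : ∀ s₁, Q₁ s₁ → Spec inp (block L) s₁ g₂ T₂ Q) :
    Spec inp (block (P :: L)) s (g₁ ++ g₂) (T₁ + T₂) Q := by
  obtain ⟨t₁, s₁, e₁, l₁, q₁⟩ := h₁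
  obtain ⟨t₂, s₂, e₂, l₂, q₂⟩ := h₂ s₁ q₁
  exact ⟨t₁ + t₂, s₂, .seq e₁ e₂, add_le_add l₁ l₂, q₂⟩

theorem Spec.append (L : List Prog) {R : List Prog} {g : List Gate}
    (hL : L.all (Prog.writesBelow b) = true)
    (h : Spec inp (block R) (nexts inp L s) g T Q) :
    Spec inp (block (L ++ R)) s (prints inp L s ++ g) (L.length + T) Q := by
  induction L generalizing s with
  | nil => simpa [nexts, prints] using h
  | cons P L ih =>
    simp only [List.all_cons, Bool.and_eq_true] at hL
    obtain ⟨t, s', e, l, q⟩ := ih hL.2 h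
    refine ⟨1 + t, s', ?_, by simp only [List.length_cons]; omega, q⟩
    rw [prints, List.append_assoc]
    exact .seq (Prog.exec_of_writesBelow hL.1) e

theorem Spec.straight (L : List Prog) (hL : L.all (Prog.writesBelow b) = true)
    (hQ : Q (Function.update (nexts inp L s) 0 0)) (hgs : prints inp L s = gs) :
    Spec inp (block L) s gs (L.length + 1) Q := by
  have := Spec.append (inp := inp) (s := s) L hL (Spec.nil hQ)
  rwa [List.append_nil, List.append_nil, hgs] at this

theorem Spec.cond {a : ℕ} {R : Prog} (h₁ : s a ≠ 0 → Spec inp P s gs T Q)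
    (h₀ : s a = 0 → Spec inp R s gs T Q) : Spec inp (.cond a P R) s gs (T + 1) Q := by
  by_cases h : s a = 0
  · obtain ⟨t, s', e, l, q⟩ := h₀ h
    exact ⟨t + 1, s', .cond_false h e, by omega, q⟩
  · obtain ⟨t, s', e, l, q⟩ := h₁ h
    exact ⟨t + 1, s', .cond_true h e, by omega, q⟩

theorem Spec.loop_done {a : ℕ} (h : s a = 0) (hQ : Q s) : Spec inp (.loop a P) s [] 1 Q :=
  ⟨1, s, .loop_done h, le_rfl, hQ⟩

theorem Spec.loop_step {a : ℕ} {g₁ g₂ : List Gate} {T₁ T₂ : ℕ} {Q₁ : Memory → Prop}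
    (h : s a ≠ 0) (h₁ : Spec inp P s g₁ T₁ Q₁)
    (h₂ : ∀ s₁, Q₁ s₁ → Spec inp (.loop a P) s₁ g₂ T₂ Q) :
    Spec inp (.loop a P) s (g₁ ++ g₂) (T₁ + T₂ + 1) Q := by
  obtain ⟨t₁, s₁, e₁, l₁, q₁⟩ := h₁
  obtain ⟨t₂, s₂, e₂, l₂, q₂⟩ := h₂ s₁ q₁
  exact ⟨t₁ + t₂ + 1, s₂, .loop_step h e₁ e₂, by omega, q₂⟩

/-- The cell that holds the number `1`. -/
abbrev Cell.one : ℕ := 30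

/-- Run `P` for the values `0, 1, …` of the cell `v` up to the value of the cell `lim`, with the
cell `t` for the test. -/
def forLoop (v t lim : ℕ) (P : Prog) : Prog :=
  block [.const v 0, .sub t lim v, .loop t (block [P, .add v v Cell.one, .sub t lim v])]

/-- The invariant must ignore the cells below `b`, because the loop writes to `v`, `t` and cell 0,
which the end of every `block` clears. The overhead of 4 per round is the two updates, this clearing
and the test. -/
theorem Spec.forLoop {v t lim k B : ℕ} {g : ℕ → List Gate} (I : ℕ → Memory → Prop)
    (hv : 0 < v) (ht : 0 < t) (hvt : v ≠ t) (hvb : v < b) (htb : t < b) (hlim : b ≤ lim)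
    (hkB : k ≤ B)
    (hI : ∀ i s s', I i s → (∀ x, b ≤ x → s' x = s x) → I i s')
    (hk : ∀ i s, I i s → s lim = k ∧ s Cell.one = 1) (h0 : I 0 s)
    (hP : ∀ i < k, ∀ s, I i s → s v = i →
      Spec inp P s (g i) T fun s' => s' v = i ∧ I (i + 1) s') :
    Spec inp (StabilizerMoney.forLoop v t lim P) s ((List.range k).flatMap g) (B * (T + 4) + 4)
      (I k) := by
  -- The test cell holds the number r of remaining rounds, so the induction runs on r.
  have key : ∀ r i s, i + r = k → I i s → s v = i → s t = r →
      Spec inp (.loop t (block [P, .add v v Cell.one, .sub t lim v])) s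
        ((List.range' i r).flatMap g) (r * (T + 4) + 1) (I k) := by
    intro r
    induction r with
    | zero =>
      intro i s hi hs _ htz
      rw [add_zero] at hi
      subst hi
      rw [zero_mul, zero_add]
      exact Spec.loop_done htz hs
    | succ r ih =>
      intro i s hi hs hvi htr
      rw [List.range'_succ, List.flatMap_cons]
      have htime : (r + 1) * (T + 4) + 1 = (T + 3) + (r * (T + 4) + 1) + 1 := by ring
      rw [htime]
      refine Spec.loop_step (Q₁ := fun s' => I (i + 1) s' ∧ s' v = i + 1 ∧ s' t = r)
        (by omega) ?_ fun s₁ hs₁ => ih (i + 1) s₁ (by omega) hs₁.1 hs₁.2.1 hs₁.2.2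
      rw [← List.append_nil (g i)]
      refine Spec.cons (hP i (by omega) s hs hvi) fun s₁ ⟨hv₁, hI₁⟩ => ?_
      have hc := hk _ _ hI₁
      refine Spec.straight (b := b) [.add v v Cell.one, .sub t lim v] ?_ ⟨?_, ?_, ?_⟩ ?_
      · simp [Prog.writesBelow, hvb, htb]
      · refine hI _ _ _ hI₁ fun x hx => ?_
        rw [Function.update_of_ne (by omega),
          nexts_of_le (b := b) (by simp [Prog.writesBelow, hvb, htb]) hx]
      · simp [nexts, Prog.next, hv.ne', hvt, hv₁, hc.2]
      · have : lim ≠ v := by omega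
        simp only [nexts, Prog.next, List.foldl_cons, List.foldl_nil]
        rw [Function.update_of_ne ht.ne', Function.update_self, Function.update_self,
          Function.update_of_ne this, hc.1, hv₁, hc.2]
        omega
      · simp [prints, Prog.print]
  have hc := hk _ _ h0
  have hlen : B * (T + 4) + 4 = [Prog.const v 0, .sub t lim v].length + (B * (T + 4) + 2) := by
    simp; omega
  rw [hlen]
  have hall : [Prog.const v 0, .sub t lim v].all (Prog.writesBelow b) = true := by
    simp [Prog.writesBelow, hvb, htb]
  have hpr : prints inp [Prog.const v 0, .sub t lim v] s = [] := by simp [prints, Prog.print]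
  rw [← List.nil_append ((List.range k).flatMap g), ← hpr]
  refine Spec.append [.const v 0, .sub t lim v] hall ?_
  rw [← List.append_nil ((List.range k).flatMap g), List.range_eq_range']
  refine ((key k 0 _ (by omega) (hI _ _ _ h0 fun x hx => nexts_of_le hall hx) ?_ ?_).cons
    (Q := I k) (T₂ := 1) fun s₁ hs₁ => Spec.nil ?_).mono ?_ fun _ => id
  · simp [nexts, Prog.next, hvt]
  · have : lim ≠ v := by omega
    simp [nexts, Prog.next, this, hc.1]
  · exact hI _ _ _ hs₁ fun x hx => Function.update_of_ne (by omega) _ _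
  · have := Nat.mul_le_mul_right (T + 4) hkB
    omega

end Programs

/-! ### Memory layout, and programs that print trees, chains, Hadamard layers and controlled Paulis.
-/

section Programs

/-- The cells with numbers from `b` on have not changed. -/
def Keeps (b : ℕ) (s s' : Memory) : Prop := ∀ x, b ≤ x → s' x = s x

theorem Keeps.trans {b : ℕ} {s s' s'' : Memory} (h : Keeps b s s') (h' : Keeps b s' s'') :
    Keeps b s s'' := fun x hx => (h' x hx).trans (h x hx)

theorem Keeps.mono {b b' : ℕ} {s s' : Memory} (h : Keeps b s s') (hb : b ≤ b') : Keeps b' s s' :=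
  fun x hx => h x (hb.trans hx)

theorem Keeps.refl (b : ℕ) (s : Memory) : Keeps b s s := fun _ _ => rfl

theorem Spec.straight_keeps {inp : List ℕ} {s : Memory} {gs : List Gate} {b : ℕ} (L : List Prog)
    (hL : L.all (Prog.writesBelow b) = true) (hb : 0 < b) (hgs : prints inp L s = gs) :
    Spec inp (block L) s gs (L.length + 1) (Keeps b s) :=
  Spec.straight L hL
    (fun x hx => by rw [Function.update_of_ne (by omega), nexts_of_le hL hx]) hgs

/-! The cells `1` to `9` are for temporary use, and the cells `10` to `19` for counters. -/

/-- The place of the input that is read next. -/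
abbrev Cell.input : ℕ := 20
/-- The number of qubits of a register. -/
abbrev Cell.n : ℕ := 31
/-- The number of entries of a row. -/
abbrev Cell.m : ℕ := 32
/-- The number of registers. -/
abbrev Cell.l : ℕ := 33
/-- The number of leaves of the tree. -/
abbrev Cell.leaves : ℕ := 34
/-- The number of inner nodes of the tree. -/
abbrev Cell.inner : ℕ := 35
/-- The size of the index. -/
abbrev Cell.index : ℕ := 36
/-- The number of steps of the walk. -/
abbrev Cell.rounds : ℕ := 37
/-- The square root of the number of leaves. -/
abbrev Cell.root : ℕ := 38
/-- The number of leaves without an entry. -/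
abbrev Cell.pad : ℕ := 39
/-- The first output qubit of the register. -/
abbrev Cell.out : ℕ := 40
/-- The first index qubit of the register. -/
abbrev Cell.J : ℕ := 41
/-- The first node of the register. -/
abbrev Cell.h : ℕ := 42
/-- The first qubit of the register that the walk acts on. -/
abbrev Cell.A : ℕ := 43
/-- The first random bit of the register. -/
abbrev Cell.r : ℕ := 44
/-- The first dephasing qubit of the register. -/
abbrev Cell.q : ℕ := 45
/-- The place of the input where the row of the register begins. -/
abbrev Cell.row : ℕ := 46
/-- The number of ancillas of a register. -/
abbrev Cell.size : ℕ := 47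
/-- The last node of the register. -/
abbrev Cell.top : ℕ := 48
/-- The number `0`. -/
abbrev Cell.zero : ℕ := 49

/-- The memory while the circuit of register `i` is printed. -/
structure Layout (n m l M k i : ℕ) (s : Memory) : Prop where
  one_eq : s Cell.one = 1
  n_eq : s Cell.n = n
  m_eq : s Cell.m = m
  l_eq : s Cell.l = l
  inner_eq : s Cell.inner = M - 1
  index_eq : s Cell.index = 2 * M - 1
  rounds_eq : s Cell.rounds = k
  pad_eq : s Cell.pad = M - m
  out_eq : s Cell.out = i * n
  J_eq : s Cell.J = l * n + i * blockSize n (2 * M - 1)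
  h_eq : s Cell.h = l * n + i * blockSize n (2 * M - 1) + (2 * M - 1)
  A_eq : s Cell.A = l * n + i * blockSize n (2 * M - 1) + (2 * (2 * M - 1) + 1)
  r_eq : s Cell.r = l * n + i * blockSize n (2 * M - 1) + (2 * (2 * M - 1) + 1 + n)
  q_eq : s Cell.q = l * n + i * blockSize n (2 * M - 1) + (2 * (2 * M - 1) + 1 + 2 * n)
  row_eq : s Cell.row = 3 + i * (m * (n + 1))
  size_eq : s Cell.size = blockSize n (2 * M - 1)
  top_eq : s Cell.top = l * n + i * blockSize n (2 * M - 1) + (2 * M - 1 + (2 * M - 1))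
  zero_eq : s Cell.zero = 0

variable {n m l M k i B : ℕ} {inp : List ℕ} {s s' : Memory}

theorem Layout.of_keeps (h : Layout n m l M k i s) {b : ℕ} (hk : Keeps b s s') (hb : b ≤ 30) :
    Layout n m l M k i s' := by
  obtain ⟨h1, h2, h3, h4, h5, h6, h7, h8, h9, h10, h11, h12, h13, h14, h15, h16, h17, h18⟩ := h
  constructor <;> rw [hk _ (hb.trans (by decide))] <;> assumption

theorem Layout.forLoop {lim c T : ℕ} {P : Prog} {g : ℕ → List Gate} (h : Layout n m l M k i s)
    (hlim : 30 ≤ lim) (hc : s lim = c) (hB : c ≤ B)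
    (hP : ∀ v < c, ∀ s, Layout n m l M k i s → s 10 = v → Spec inp P s (g v) T (Keeps 10 s)) :
    Spec inp (forLoop 10 11 lim P) s ((List.range c).flatMap g) (B * (T + 4) + 4)
      (Keeps 12 s) := by
  refine Spec.forLoop (b := 12) (fun _ => Keeps 12 s) (by norm_num) (by norm_num) (by norm_num)
    (by norm_num) (by norm_num) (by omega) hB (fun i s₁ s₂ h₁ h₂ => h₁.trans h₂) ?_
    (Keeps.refl _ _) ?_
  · intro i s₁ h₁
    exact ⟨(h₁ _ (by omega)).trans hc, (h₁ _ (by norm_num)).trans h.one_eq⟩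
  · intro v hv s₁ h₁ hs₁
    refine (hP v hv s₁ (h.of_keeps h₁ (by norm_num)) hs₁).mono le_rfl fun s₂ h₂ => ?_
    exact ⟨(h₂ _ le_rfl).trans hs₁, h₁.trans (h₂.mono (by norm_num))⟩

/-- Print the circuit that computes the inner nodes of the tree. -/
def treeProg : Prog := forLoop 10 11 Cell.inner <| block
  [.add 1 Cell.h 10, .add 2 Cell.J 10, .add 3 1 10, .add 4 3 Cell.one, .add 5 4 Cell.one,
    .toffoli 1 2 5, .cnot 1 4, .cnot 5 4]

theorem spec_treeProg (h : Layout n m l M k i s) (hB : M - 1 ≤ B) :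
    Spec inp treeProg s ((treeGates (M - 1)).map (LGate.toGate (address n l (2 * M - 1) i)))
      (B * 13 + 4) (Keeps 12 s) := by
  rw [treeGates, List.map_flatMap]
  refine h.forLoop (by norm_num) h.inner_eq hB fun v _ s h hs => ?_
  refine Spec.straight_keeps _ rfl (by norm_num) ?_
  simp [prints, Prog.print, Prog.next, h.one_eq, h.h_eq, h.J_eq, hs, LGate.toGate, address,
    blockOffset]
  omega

theorem Spec.last {P : Prog} {gs : List Gate} {T b : ℕ} {s₀ : Memory}
    (h : Spec inp P s gs T (Keeps b s₀)) (hb : 0 < b) :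
    Spec inp (block [P]) s gs (T + 1) (Keeps b s₀) := by
  rw [← List.append_nil gs]
  exact h.cons fun s₁ h₁ => Spec.nil fun x hx => by rw [Function.update_of_ne (by omega), h₁ x hx]

theorem Spec.append_keeps (L : List Prog) {R : List Prog} {gs g : List Gate} {T b : ℕ}
    (hL : L.all (Prog.writesBelow b) = true) (hgs : prints inp L s = gs)
    (h : Spec inp (block R) (nexts inp L s) g T (Keeps b (nexts inp L s))) :
    Spec inp (block (L ++ R)) s (gs ++ g) (L.length + T) (Keeps b s) := by
  rw [← hgs]
  exact Spec.append L hL (h.mono le_rfl fun s' hs' x hx => (hs' x hx).trans (nexts_of_le hL hx))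

theorem Spec.cond_true {P R : Prog} {gs : List Gate} {T a : ℕ} {Q : Memory → Prop} (h : s a ≠ 0)
    (h₁ : Spec inp P s gs T Q) : Spec inp (.cond a P R) s gs (T + 1) Q :=
  Spec.cond (fun _ => h₁) fun h' => absurd h' h

theorem Spec.cond_false {P R : Prog} {gs : List Gate} {T a : ℕ} {Q : Memory → Prop} (h : s a = 0)
    (h₁ : Spec inp R s gs T Q) : Spec inp (.cond a P R) s gs (T + 1) Q :=
  Spec.cond (fun h' => absurd h h') fun _ => h₁

theorem Spec.cast {P : Prog} {gs gs' : List Gate} {T T' : ℕ} {Q : Memory → Prop}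
    (h : Spec inp P s gs T Q) (hgs : gs = gs') (hT : T ≤ T') : Spec inp P s gs' T' Q :=
  hgs ▸ h.mono hT fun _ => id

/-- The loops of the machine count upwards, so uncomputation uses the index k − 1 − v. -/
theorem reverse_flatMap_range {α : Type*} (g : ℕ → List α) (k : ℕ) :
    ((List.range k).flatMap g).reverse =
      (List.range k).flatMap fun v => (g (k - 1 - v)).reverse := by
  induction k with
  | zero => rfl
  | succ k ih =>
    rw [List.range_succ, List.flatMap_append, List.reverse_append, ih, ← List.range_succ,
      List.range_succ_eq_map]
    simp only [List.flatMap_cons, List.flatMap_nil, List.append_nil, List.flatMap_map]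
    congr 1
    refine List.flatMap_congr fun v hv => ?_
    congr 2
    omega

/-- Undo `treeProg`. -/
def treeBackProg : Prog := forLoop 10 11 Cell.inner <| block
  [.sub 6 Cell.inner 10, .sub 6 6 Cell.one, .add 1 Cell.h 6, .add 2 Cell.J 6, .add 3 1 6,
    .add 4 3 Cell.one, .add 5 4 Cell.one, .cnot 5 4, .cnot 1 4, .toffoli 1 2 5]

theorem spec_treeBackProg (h : Layout n m l M k i s) (hB : M - 1 ≤ B) :
    Spec inp treeBackProg s
      ((treeGates (M - 1)).reverse.map (LGate.toGate (address n l (2 * M - 1) i)))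
      (B * 15 + 4) (Keeps 12 s) := by
  rw [treeGates, reverse_flatMap_range, List.map_flatMap]
  refine h.forLoop (by norm_num) h.inner_eq hB fun v _ s h hs => ?_
  refine Spec.straight_keeps _ rfl (by norm_num) ?_
  simp [prints, Prog.print, Prog.next, h.one_eq, h.h_eq, h.J_eq, h.inner_eq, hs, LGate.toGate,
    address, blockOffset]
  omega

/-- Print the circuit that computes the links of the chain. -/
def chainProg : Prog := forLoop 10 11 Cell.index <| block
  [.add 1 Cell.h 10, .add 2 Cell.J 10, .add 3 1 Cell.one, .toffoli 1 2 3, .cnot 1 3]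

theorem spec_chainProg (h : Layout n m l M k i s) (hB : 2 * M - 1 ≤ B) :
    Spec inp chainProg s
      ((chainGates (2 * M - 1)).map (LGate.toGate (address n l (2 * M - 1) i)))
      (B * 10 + 4) (Keeps 12 s) := by
  rw [chainGates, List.map_flatMap]
  refine h.forLoop (by norm_num) h.index_eq hB fun v _ s h hs => ?_
  refine Spec.straight_keeps _ rfl (by norm_num) ?_
  simp [prints, Prog.print, Prog.next, h.one_eq, h.h_eq, h.J_eq, hs, LGate.toGate,
    address, blockOffset]
  omega

/-- Undo `chainProg`. -/
def chainBackProg : Prog := forLoop 10 11 Cell.index <| block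
  [.sub 6 Cell.index 10, .sub 6 6 Cell.one, .add 1 Cell.h 6, .add 2 Cell.J 6, .add 3 1 Cell.one,
    .cnot 1 3, .toffoli 1 2 3]

theorem spec_chainBackProg (h : Layout n m l M k i s) (hB : 2 * M - 1 ≤ B) :
    Spec inp chainBackProg s
      ((chainGates (2 * M - 1)).reverse.map (LGate.toGate (address n l (2 * M - 1) i)))
      (B * 12 + 4) (Keeps 12 s) := by
  rw [chainGates, reverse_flatMap_range, List.map_flatMap]
  refine h.forLoop (by norm_num) h.index_eq hB fun v _ s h hs => ?_
  refine Spec.straight_keeps _ rfl (by norm_num) ?_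
  simp [prints, Prog.print, Prog.next, h.one_eq, h.h_eq, h.J_eq, h.index_eq, hs, LGate.toGate,
    address, blockOffset]
  omega

/-- Print Hadamard gates on consecutive qubits. -/
def hadProg (base lim : ℕ) : Prog := forLoop 10 11 lim (block [.add 1 base 10, .had 1])

theorem spec_hadProg {base lim c : ℕ} (h : Layout n m l M k i s) (hlim : 30 ≤ lim) (hc : s lim = c)
    (hB : c ≤ B) (hbase : 30 ≤ base) (f : ℕ → Lab) (hf : ∀ v,
      address n l (2 * M - 1) i (f v) = s base + v) :
    Spec inp (hadProg base lim) s ((hadLayer (List.ofFn fun v : Fin c => f v)).map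
      (LGate.toGate (address n l (2 * M - 1) i))) (B * 7 + 4) (Keeps 12 s) := by
  have hl : (hadLayer (List.ofFn fun v : Fin c => f v)).map
      (LGate.toGate (address n l (2 * M - 1) i)) =
        (List.range c).flatMap fun v => [Gate.had (s base + v)] := by
    rw [← List.map_eq_flatMap, hadLayer, List.map_map, List.map_ofFn, List.ofFn_eq_map,
      ← List.map_coe_finRange_eq_range, List.map_map]
    refine List.map_congr_left fun v _ => ?_
    simp [LGate.toGate, hf]
  rw [hl]
  refine Spec.forLoop (b := 12) (fun _ => Keeps 12 s) (by norm_num) (by norm_num) (by norm_num)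
    (by norm_num) (by norm_num) (by omega) hB (fun i s₁ s₂ h₁ h₂ => h₁.trans h₂) ?_
    (Keeps.refl _ _) ?_
  · intro i s₁ h₁
    exact ⟨(h₁ _ (by omega)).trans hc, (h₁ _ (by norm_num)).trans h.one_eq⟩
  · intro v hv s₁ h₁ hs₁
    refine (Spec.straight_keeps (b := 10) [.add 1 base 10, .had 1] rfl (by norm_num)
      ?_).mono le_rfl fun s₂ h₂ => ⟨(h₂ _ le_rfl).trans hs₁, h₁.trans (h₂.mono (by norm_num))⟩
    have h1 : s₁ base = s base := h₁ _ (by omega)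
    simp [prints, Prog.print, Prog.next, h1, hs₁]

/-- Print a controlled Pauli operator, from its code in cell `1`, with the control in cell `12` and
the target in cell `2`. -/
def pauliProg : Prog :=
  .cond 1
    (block ([.sub 1 1 Cell.one] ++ [.cond 1
      (block ([.sub 1 1 Cell.one] ++ [.cond 1
        (block [.had 2, .cnot 12 2, .had 2])
        (block [.cnot 12 2, .had 2, .cnot 12 2, .had 2, .tee 12, .tee 12])]))
      (block [.cnot 12 2])]))
    (block [])

/-- The only test is for zero, so the code is decremented between nested conditionals. The bound 14
is attained by Y, which has the longest circuit. -/
theorem spec_pauliProg {α : Type*} {π : α → ℕ} {c t : α} {P : Pauli} (hone : s Cell.one = 1)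
    (h1 : s 1 = P.code) (hc : s 12 = π c) (ht : s 2 = π t) :
    Spec inp pauliProg s ((ctrlPauli c t P).map (LGate.toGate π)) 14 (Keeps 10 s) := by
  cases P
  · refine (Spec.cond_false h1 (Spec.straight_keeps (b := 10) [] rfl (by norm_num) rfl)).cast rfl ?_
    simp
  · refine (Spec.cond_true (by simp [h1, Pauli.code]) (Spec.append_keeps (b := 10)
      [.sub 1 1 Cell.one] rfl rfl (Spec.last (Spec.cond_false ?_ (Spec.straight_keeps (b := 10)
        [.cnot 12 2] rfl (by norm_num) rfl)) (by norm_num)))).cast ?_ ?_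
    · simp [nexts, Prog.next, h1, hone, Pauli.code]
    · simp [prints, nexts, Prog.print, Prog.next, ctrlPauli, LGate.toGate, hc, ht]
    · simp
  · refine (Spec.cond_true (by simp [h1, Pauli.code]) (Spec.append_keeps (b := 10)
      [.sub 1 1 Cell.one] rfl rfl (Spec.last (Spec.cond_true ?_ (Spec.append_keeps (b := 10)
      [.sub 1 1 Cell.one] rfl rfl (Spec.last (Spec.cond_false ?_ (Spec.straight_keeps (b := 10)
        [.cnot 12 2, .had 2, .cnot 12 2, .had 2, .tee 12, .tee 12] rfl (by norm_num) rfl))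
        (by norm_num)))) (by norm_num)))).cast ?_ ?_
    · simp [nexts, Prog.next, h1, hone, Pauli.code]
    · simp [nexts, Prog.next, h1, hone, Pauli.code]
    · simp [prints, nexts, Prog.print, Prog.next, ctrlPauli, czGate, sGate, LGate.toGate, hc, ht]
    · simp
  · refine (Spec.cond_true (by simp [h1, Pauli.code]) (Spec.append_keeps (b := 10)
      [.sub 1 1 Cell.one] rfl rfl (Spec.last (Spec.cond_true ?_ (Spec.append_keeps (b := 10)
      [.sub 1 1 Cell.one] rfl rfl (Spec.last (Spec.cond_true ?_ (Spec.straight_keeps (b := 10)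
        [.had 2, .cnot 12 2, .had 2] rfl (by norm_num) rfl))
        (by norm_num)))) (by norm_num)))).cast ?_ ?_
    · simp [nexts, Prog.next, h1, hone, Pauli.code]
    · simp [nexts, Prog.next, h1, hone, Pauli.code]
    · simp [prints, nexts, Prog.print, Prog.next, ctrlPauli, czGate, LGate.toGate, hc, ht]
    · simp

end Programs

/-! ### Reading a row of the table and printing one step of the walk. -/

section Programs

variable {n m l M k i B : ℕ} {inp : List ℕ} {s s' : Memory}

/-- The row `e` is written in the input from the place `p` on. -/
def RowAt (inp : List ℕ) (p : ℕ) (e : Fin m → SignedPauli n) : Prop :=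
  ∀ j : Fin m, inp.getD (p + j * (n + 1)) 0 = (e j).1 ∧
    ∀ k : Fin n, inp.getD (p + j * (n + 1) + 1 + k) 0 = ((e j).2 k).code

theorem Keeps.update_iff {b c w : ℕ} (hc : b ≤ c) :
    Keeps b (Function.update s c w) s' ↔ s' c = w ∧ ∀ x, b ≤ x → x ≠ c → s' x = s x := by
  constructor
  · intro h
    refine ⟨by rw [h c hc, Function.update_self], fun x hx hxc => ?_⟩
    rw [h x hx, Function.update_of_ne hxc]
  · rintro ⟨h1, h2⟩ x hx
    by_cases hxc : x = c
    · rw [hxc, h1, Function.update_self]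
    · rw [h2 x hx hxc, Function.update_of_ne hxc]

theorem Keeps.update_trans {b c w w' : ℕ} {s'' : Memory} (h : Keeps b (Function.update s c w) s')
    (h' : Keeps b (Function.update s' c w') s'') : Keeps b (Function.update s c w') s'' := by
  intro x hx
  rw [h' x hx]
  by_cases hxc : x = c
  · rw [hxc, Function.update_self, Function.update_self]
  · rw [Function.update_of_ne hxc, Function.update_of_ne hxc, h x hx, Function.update_of_ne hxc]

theorem Layout.of_keeps_update (h : Layout n m l M k i s) {b w : ℕ}
    (hk : Keeps b (Function.update s Cell.input w) s') (hb : b ≤ 30) : Layout n m l M k i s' := by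
  have h1 : Keeps 30 s (Function.update s Cell.input w) := fun x hx =>
    Function.update_of_ne (by simp only [Cell.input]; omega) _ _
  exact (h.of_keeps h1 le_rfl).of_keeps hk hb

theorem Spec.append_silent (L : List Prog) {R : List Prog} {g : List Gate} {T b : ℕ}
    {Q : Memory → Prop} (hL : L.all (Prog.writesBelow b) = true) (hgs : prints inp L s = [])
    (h : Spec inp (block R) (nexts inp L s) g T Q) :
    Spec inp (block (L ++ R)) s g (L.length + T) Q := by
  have := Spec.append L hL h
  rwa [hgs] at this

/-- Print the controlled Pauli operators of an entry of the table. -/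
def stringProg : Prog := forLoop 10 11 Cell.n <| block
  ([.add 2 Cell.A 10, .read 1 Cell.input, .add Cell.input Cell.input Cell.one] ++ [pauliProg])

theorem spec_stringProg (h : Layout n m l M k i s) (hB : n ≤ B) {v : Fin n → Pauli}
    (hin : ∀ k : Fin n, inp.getD (s Cell.input + k) 0 = (v k).code) {c : Lab}
    (hc : s 12 = address n l (2 * M - 1) i c) :
    Spec inp stringProg s ((List.ofFn fun k => ctrlPauli c (Lab.A k) (v k)).flatten.map
      (LGate.toGate (address n l (2 * M - 1) i))) (B * 22 + 4)
      (Keeps 12 (Function.update s Cell.input (s Cell.input + n))) := by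
  set π := address n l (2 * M - 1) i with hπ
  have hg : (List.ofFn fun k => ctrlPauli c (Lab.A k) (v k)).flatten.map (LGate.toGate π) =
      (List.range n).flatMap fun k => if hk : k < n then
        (ctrlPauli c (Lab.A k) (v ⟨k, hk⟩)).map (LGate.toGate π) else [] := by
    rw [← List.map_coe_finRange_eq_range, List.flatMap_map, List.map_flatten, List.ofFn_eq_map,
      List.map_map, ← List.flatMap_def]
    refine List.flatMap_congr fun k _ => ?_
    simp
  rw [hg]
  refine Spec.forLoop (b := 12)
    (fun j => Keeps 12 (Function.update s Cell.input (s Cell.input + j))) (by norm_num)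
    (by norm_num) (by norm_num) (by norm_num) (by norm_num) (by norm_num) hB
    (fun i s₁ s₂ h₁ h₂ => h₁.trans h₂) ?_ (by simp [Keeps]) ?_
  · intro j s₁ h₁
    have := h.of_keeps_update h₁ (by norm_num)
    exact ⟨this.n_eq, this.one_eq⟩
  · intro j hj s₁ h₁ hs₁
    have h₂ := h.of_keeps_update h₁ (by norm_num)
    have hp : s₁ Cell.input = s Cell.input + j := ((Keeps.update_iff (by norm_num)).1 h₁).1
    have hc₁ : s₁ 12 = π c := by
      rw [((Keeps.update_iff (by norm_num)).1 h₁).2 12 le_rfl (by norm_num), hc]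
    rw [dif_pos hj]
    refine (Spec.append_silent (b := 21) (T := 15) [.add 2 Cell.A 10, .read 1 Cell.input,
      .add Cell.input Cell.input Cell.one] rfl rfl (Spec.last (Spec.mono (spec_pauliProg (π := π)
        ?_ ?_ ?_ ?_) le_rfl fun _ => id) (by norm_num))).mono (by simp) ?_
    · simp [nexts, Prog.next, h₂.one_eq]
    · simpa [nexts, Prog.next, hp] using hin ⟨j, hj⟩
    · simp [nexts, Prog.next, hc₁]
    · simp [nexts, Prog.next, hs₁, h₂.A_eq, hπ, address, blockOffset]
      omega
    · intro s₂ hs₂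
      refine ⟨?_, ?_⟩
      · rw [hs₂ 10 le_rfl]
        simp [nexts, Prog.next, hs₁]
      · refine h₁.update_trans ?_
        intro x hx
        rw [hs₂ x (by omega)]
        have e1 : x ≠ 1 := by omega
        have e2 : x ≠ 2 := by omega
        simp only [nexts, Prog.next, List.foldl_cons, List.foldl_nil]
        by_cases hx20 : x = Cell.input
        · rw [hx20]
          simp [hp, h₂.one_eq, add_assoc]
        · rw [Function.update_of_ne hx20, Function.update_of_ne e1, Function.update_of_ne e2,
            Function.update_of_ne hx20]

/-- Print the operations of the leaves that have an entry. -/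
def selectProg : Prog := forLoop 14 15 Cell.m <| block
  ([.add 1 Cell.h Cell.inner, .add 12 1 14, .read 1 Cell.input] ++
    [.cond 1 (block []) (block [.tee 12, .tee 12, .tee 12, .tee 12]),
      .add Cell.input Cell.input Cell.one, stringProg])

/-- An entry occupies n + 1 places of the input, one for the sign and n for the codes. The invariant
follows the reading position, which `Keeps` leaves free to change in this cell only. -/
theorem spec_selectProg (h : Layout n m l M k i s) (hB : n ≤ B) (hmB : m ≤ B)
    {e : Fin m → SignedPauli n} (hin : RowAt inp (s Cell.input) e) :
    Spec inp selectProg s (((List.range m).flatMap (leafGates M e)).map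
      (LGate.toGate (address n l (2 * M - 1) i))) (B * (B * 22 + 24) + 4)
      (Keeps 16 (Function.update s Cell.input (s Cell.input + m * (n + 1)))) := by
  set π := address n l (2 * M - 1) i with hπ
  rw [List.map_flatMap]
  have hT : B * 22 + 24 = (B * 22 + 20) + 4 := rfl
  rw [hT]
  refine Spec.forLoop (b := 16)
    (fun j => Keeps 16 (Function.update s Cell.input (s Cell.input + j * (n + 1)))) (by norm_num)
    (by norm_num) (by norm_num) (by norm_num) (by norm_num) (by norm_num) hmB
    (fun i s₁ s₂ h₁ h₂ => h₁.trans h₂) ?_ (by simp [Keeps]) ?_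
  · intro j s₁ h₁
    have := h.of_keeps_update h₁ (by norm_num)
    exact ⟨this.m_eq, this.one_eq⟩
  · intro j hj s₁ h₁ hs₁
    have h₂ := h.of_keeps_update h₁ (by norm_num)
    have hp : s₁ Cell.input = s Cell.input + j * (n + 1) :=
      ((Keeps.update_iff (by norm_num)).1 h₁).1
    obtain ⟨hsign, hcode⟩ := hin ⟨j, hj⟩
    simp only at hsign hcode
    rw [leafGates, dif_pos hj, ctrlEntry, List.map_append]
    set s₂ := nexts inp [.add 1 Cell.h Cell.inner, .add 12 1 14, .read 1 Cell.input] s₁ with hs₂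
    have hk₂ : Keeps 13 s₁ s₂ := fun x hx => nexts_of_le (b := 13) rfl hx
    have hsc : s₂ 12 = π (.h (M - 1 + j)) := by
      simp [hs₂, nexts, Prog.next, hs₁, h₂.h_eq, h₂.inner_eq, hπ, address, blockOffset]
      omega
    have hs1 : s₂ 1 = (e ⟨j, hj⟩).1 := by
      simpa [hs₂, nexts, Prog.next, hp] using hsign
    have hcond : Spec inp (.cond 1 (block []) (block [.tee 12, .tee 12, .tee 12, .tee 12])) s₂
        ((if (e ⟨j, hj⟩).1 = 0 then zGate (Lab.h (M - 1 + j)) else []).map (LGate.toGate π)) 6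
        (Keeps 10 s₂) := by
      have hb : (e ⟨j, hj⟩).1 = 0 ∨ (e ⟨j, hj⟩).1 = 1 := by omega
      rcases hb with hb | hb
      · refine (Spec.cond_false (by simp [hs1, hb]) (Spec.straight_keeps (b := 10) _ rfl
          (by norm_num) rfl)).cast ?_ le_rfl
        simp [hb, prints, Prog.print, Prog.next, zGate, LGate.toGate, hsc]
      · refine (Spec.cond_true (by simp [hs1, hb]) (Spec.straight_keeps (b := 10) [] rfl
          (by norm_num) rfl)).cast ?_ (by simp)
        simp [hb, prints]
    refine (Spec.append_silent (b := 13) _ rfl rfl (hcond.cons fun s₃ h₃ => ?_)).mono (T := 3 + (6 +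
      (1 + ((B * 22 + 4) + 1)))) (by omega) fun _ => id
    rw [← List.nil_append (List.map _ _)]
    refine Spec.cons (Q₁ := fun s₄ => s₄ = Function.update s₃ Cell.input (s₃ Cell.input + 1))
      ⟨1, _, .add _ _ _ _, le_rfl, ?_⟩ ?_
    · rw [h₃ Cell.one (by norm_num), hk₂ Cell.one (by norm_num), h₂.one_eq]
    · rintro s₄ rfl
      have hl₃ : Layout n m l M k i s₃ := (h₂.of_keeps hk₂ (by norm_num)).of_keeps h₃ (by norm_num)
      have hp₃ : s₃ Cell.input = s Cell.input + j * (n + 1) := by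
        rw [h₃ _ (by norm_num), hk₂ _ (by norm_num), hp]
      have hl₄ : Layout n m l M k i (Function.update s₃ Cell.input (s₃ Cell.input + 1)) :=
        hl₃.of_keeps_update (Keeps.refl 30 _) le_rfl
      refine (Spec.last (spec_stringProg hl₄ hB (v := (e ⟨j, hj⟩).2) ?_ ?_)
        (by norm_num)).mono le_rfl fun s₅ h₅ => ?_
      · intro k
        rw [Function.update_self, hp₃, ← hcode k]
      · rw [Function.update_of_ne (by norm_num), h₃ _ (by norm_num), hsc]
      · rw [Function.update_idem, Function.update_self, Keeps.update_iff (by norm_num)] at h₅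
        refine ⟨?_, h₁.update_trans ((Keeps.update_iff (by norm_num)).2 ⟨?_, ?_⟩)⟩
        · rw [h₅.2 14 (by norm_num) (by norm_num), h₃ _ (by norm_num), hk₂ _ (by norm_num), hs₁]
        · rw [h₅.1, hp₃]
          ring
        · intro x hx hxc
          rw [h₅.2 x (by omega) hxc, h₃ _ (by omega), hk₂ _ (by omega)]

/-- Print the operations of the other leaves. -/
def padProg : Prog := forLoop 10 11 Cell.pad <| block
  [.add 1 Cell.inner Cell.m, .add 1 1 10, .add 2 Cell.J 1, .add 1 Cell.h 1,
    .had 2, .cnot 1 2, .had 2]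

theorem spec_padProg (h : Layout n m l M k i s) (hB : M ≤ B) (e : Fin m → SignedPauli n) :
    Spec inp padProg s (((List.range (M - m)).flatMap fun j => leafGates M e (m + j)).map
      (LGate.toGate (address n l (2 * M - 1) i))) (B * 12 + 4) (Keeps 12 s) := by
  rw [List.map_flatMap]
  refine h.forLoop (by norm_num) h.pad_eq (by omega) fun v _ s h hs => ?_
  refine Spec.straight_keeps _ rfl (by norm_num) ?_
  simp [prints, Prog.print, Prog.next, h.m_eq, h.h_eq, h.J_eq, h.inner_eq, hs, LGate.toGate,
    address, blockOffset, leafGates, czGate]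
  omega

/-- Print a step of the walk. -/
def stepProg : Prog := block
  [.add Cell.input Cell.row Cell.zero, treeProg, selectProg, padProg, treeBackProg,
    hadProg Cell.J Cell.index, chainProg,
    block [.tee Cell.top, .tee Cell.top, .tee Cell.top, .tee Cell.top], chainBackProg,
    hadProg Cell.J Cell.index]

theorem spec_stepProg {t : ℕ} (hM : M = 2 ^ t) (h : Layout n m l M k i s) (hnB : n ≤ B)
    (hMB : 2 * M ≤ B) (hmM : m ≤ M) {e : Fin m → SignedPauli n}
    (hin : RowAt inp (3 + i * (m * (n + 1))) e) :
    Spec inp stepProg s ((stepGates t e).map (LGate.toGate (address n l (2 * M - 1) i)))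
      (B * (B * 22 + 100) + 50)
      (Keeps 16 (Function.update s Cell.input (3 + i * (m * (n + 1)) + m * (n + 1)))) := by
  set π := address n l (2 * M - 1) i with hπ
  have hp : 0 < M := hM ▸ by positivity
  -- The M leaves split into m that read the input and M − m that need no input, printed by separate
  -- loops.
  have hsel : selectGates M e = (List.range m).flatMap (leafGates M e) ++
      (List.range (M - m)).flatMap fun j => leafGates M e (m + j) := by
    rw [selectGates, ← Nat.add_sub_of_le hmM, List.range_add, List.flatMap_append,
      Nat.add_sub_of_le hmM, List.flatMap_map]
  have hgs : (stepGates t e).map (LGate.toGate π) =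
      [] ++ ((treeGates (M - 1)).map (LGate.toGate π) ++
      (((List.range m).flatMap (leafGates M e)).map (LGate.toGate π) ++
      (((List.range (M - m)).flatMap fun j => leafGates M e (m + j)).map (LGate.toGate π) ++
      ((treeGates (M - 1)).reverse.map (LGate.toGate π) ++
      ((hadLayer (List.ofFn fun v : Fin (2 * M - 1) => Lab.J v)).map (LGate.toGate π) ++
      ((chainGates (2 * M - 1)).map (LGate.toGate π) ++
      ((zGate (Lab.h (2 * M - 1))).map (LGate.toGate π) ++
      ((chainGates (2 * M - 1)).reverse.map (LGate.toGate π) ++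
      ((hadLayer (List.ofFn fun v : Fin (2 * M - 1) => Lab.J v)).map (LGate.toGate π) ++
        []))))))))) := by
    rw [stepGates, reflectGates, indexLayer, indexSize, ← hM, hsel]
    simp only [List.map_append, List.append_assoc, List.nil_append, List.append_nil]
  rw [hgs]
  have hJ : ∀ {s₁}, Layout n m l M k i s₁ → ∀ v, π (Lab.J v) = s₁ Cell.J + v := fun h₁ v => by
    rw [h₁.J_eq]; rfl
  set p := 3 + i * (m * (n + 1)) with hpdef
  refine Spec.mono (T := 1 + ((B * 13 + 4) + ((B * (B * 22 + 24) + 4) + ((B * 12 + 4) +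
    ((B * 15 + 4) + ((B * 7 + 4) + ((B * 10 + 4) + (5 + ((B * 12 + 4) +
      ((B * 7 + 4) + 1)))))))))) ?_ (by ring_nf; omega) fun _ => id
  refine Spec.cons (Q₁ := fun s₁ => s₁ = Function.update s Cell.input p)
    ⟨1, _, .add _ _ _ _, le_rfl, by rw [h.row_eq, h.zero_eq, add_zero]⟩ fun s₁ e₁ => ?_
  have h₁ : Layout n m l M k i s₁ := e₁ ▸ h.of_keeps_update (Keeps.refl 30 _) le_rfl
  refine (spec_treeProg h₁ (by omega)).cons fun s₂ k₂ => ?_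
  have h₂ := h₁.of_keeps k₂ (by norm_num)
  have i₂ : s₂ Cell.input = p := by rw [k₂ _ (by norm_num), e₁, Function.update_self]
  refine (spec_selectProg h₂ hnB (by omega) (e := e) (by rwa [i₂])).cons fun s₃ k₃ => ?_
  have h₃ := h₂.of_keeps_update k₃ (by norm_num)
  refine (spec_padProg h₃ (by omega) e).cons fun s₄ k₄ => ?_
  have h₄ := h₃.of_keeps k₄ (by norm_num)
  refine (spec_treeBackProg h₄ (by omega)).cons fun s₅ k₅ => ?_
  have h₅ := h₄.of_keeps k₅ (by norm_num)
  refine (spec_hadProg h₅ (by norm_num) h₅.index_eq (by omega) (by norm_num) Lab.J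
    (hJ h₅)).cons fun s₆ k₆ => ?_
  have h₆ := h₅.of_keeps k₆ (by norm_num)
  refine (spec_chainProg h₆ (by omega)).cons fun s₇ k₇ => ?_
  have h₇ := h₆.of_keeps k₇ (by norm_num)
  refine (Spec.straight_keeps (b := 12) (gs := (zGate (Lab.h (2 * M - 1))).map (LGate.toGate π))
    [.tee Cell.top, .tee Cell.top, .tee Cell.top, .tee Cell.top] rfl (by norm_num)
    (by simp [prints, Prog.print, Prog.next, zGate, LGate.toGate, h₇.top_eq, hπ, address,
      blockOffset])).cons fun s₈ k₈ => ?_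
  have h₈ := h₇.of_keeps k₈ (by norm_num)
  refine (spec_chainBackProg h₈ (by omega)).cons fun s₉ k₉ => ?_
  have h₉ := h₈.of_keeps k₉ (by norm_num)
  refine (spec_hadProg h₉ (by norm_num) h₉.index_eq (by omega) (by norm_num) Lab.J
    (hJ h₉)).cons fun s₁₀ k₁₀ => Spec.nil ?_
  have kall : Keeps 12 s₃ s₁₀ :=
    (((((k₄.trans k₅).trans k₆).trans k₇).trans k₈).trans k₉).trans k₁₀
  intro x hx
  rw [Function.update_of_ne (by omega), kall x (by omega), k₃ x hx, i₂]
  by_cases hxc : x = Cell.input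
  · rw [hxc, Function.update_self, Function.update_self]
  · rw [Function.update_of_ne hxc, Function.update_of_ne hxc, k₂ x (by omega), e₁,
      Function.update_of_ne hxc]

end Programs

/-! ### Programs for the preparation, the walk and the end of a register. -/

section Programs

variable {n m l M k i B : ℕ} {inp : List ℕ} {s s' : Memory}

/-- Print the preparation of a register. -/
def initProg : Prog := block
  [block [.had Cell.h], hadProg Cell.J Cell.index, hadProg Cell.A Cell.n, hadProg Cell.r Cell.n,
    forLoop 10 11 Cell.n (block [.add 1 Cell.A 10, .add 2 Cell.out 10, .cnot 1 2])]

theorem spec_initProg (h : Layout n m l M k i s) (hnB : n ≤ B) (hMB : 2 * M ≤ B) :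
    Spec inp initProg s ((initGates n (2 * M - 1)).map (LGate.toGate (address n l (2 * M - 1) i)))
      (B * 29 + 19) (Keeps 12 s) := by
  set π := address n l (2 * M - 1) i with hπ
  have hgs : (initGates n (2 * M - 1)).map (LGate.toGate π) =
      [Gate.had (π (.h 0))] ++
      ((hadLayer (List.ofFn fun v : Fin (2 * M - 1) => Lab.J v)).map (LGate.toGate π) ++
      ((hadLayer (List.ofFn fun v : Fin n => Lab.A v)).map (LGate.toGate π) ++
      ((hadLayer (List.ofFn fun v : Fin n => Lab.r v)).map (LGate.toGate π) ++
      (((List.range n).flatMap fun k => [Gate.cnot (π (.A k)) (π (.out k))]) ++ [])))) := by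
    simp only [initGates, hadLayer, List.map_append, List.map_cons, List.append_assoc,
      List.map_flatMap, List.map_nil, LGate.toGate, List.append_nil, List.cons_append,
      List.nil_append]
  rw [hgs]
  refine Spec.mono (T := 2 + ((B * 7 + 4) + ((B * 7 + 4) + ((B * 7 + 4) + ((B * 8 + 4) + 1)))))
    ?_ (by omega) fun _ => id
  refine (Spec.straight_keeps (b := 12) [.had Cell.h] rfl (by norm_num)
    (by simp [prints, Prog.print, h.h_eq, hπ, address, blockOffset])).cons fun s₁ k₁ => ?_
  have h₁ := h.of_keeps k₁ (by norm_num)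
  refine (spec_hadProg h₁ (by norm_num) h₁.index_eq (by omega) (by norm_num) Lab.J
    fun v => by rw [h₁.J_eq]; rfl).cons fun s₂ k₂ => ?_
  have h₂ := h₁.of_keeps k₂ (by norm_num)
  refine (spec_hadProg h₂ (by norm_num) h₂.n_eq hnB (by norm_num) Lab.A
    fun v => by rw [h₂.A_eq, add_assoc]; rfl).cons fun s₃ k₃ => ?_
  have h₃ := h₂.of_keeps k₃ (by norm_num)
  refine (spec_hadProg h₃ (by norm_num) h₃.n_eq hnB (by norm_num) Lab.r
    fun v => by rw [h₃.r_eq, add_assoc]; rfl).cons fun s₄ k₄ => ?_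
  have h₄ := h₃.of_keeps k₄ (by norm_num)
  refine (h₄.forLoop (by norm_num) h₄.n_eq hnB fun v _ s h hs => ?_ : Spec inp _ s₄ _
    (B * (4 + 4) + 4) _).cons fun s₅ k₅ => Spec.nil fun x hx => ?_
  · refine Spec.straight_keeps _ rfl (by norm_num) ?_
    simp [prints, Prog.print, Prog.next, h.A_eq, h.out_eq, hs, hπ, address, blockOffset]
    omega
  · rw [Function.update_of_ne (by omega)]
    exact ((((k₁.trans k₂).trans k₃).trans k₄).trans k₅) x hx

/-- Print the end of the circuit of a register. -/
def finalProg : Prog := block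
  [block [.had Cell.h], forLoop 10 11 Cell.n (block [.add 1 Cell.r 10, .add 2 Cell.out 10,
    .add 3 Cell.q 10, .toffoli Cell.h 1 2, .toffoli Cell.h 2 3])]

theorem spec_finalProg (h : Layout n m l M k i s) (hnB : n ≤ B) :
    Spec inp finalProg s ((finalGates n).map (LGate.toGate (address n l (2 * M - 1) i)))
      (B * 10 + 7) (Keeps 12 s) := by
  set π := address n l (2 * M - 1) i with hπ
  have hgs : (finalGates n).map (LGate.toGate π) =
      [Gate.had (π (.h 0))] ++ (((List.range n).flatMap fun k =>
        [Gate.toffoli (π (.h 0)) (π (.r k)) (π (.out k)),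
          Gate.toffoli (π (.h 0)) (π (.out k)) (π (.q k))]) ++ []) := by
    simp only [finalGates, List.map_cons, List.map_flatMap, List.map_nil, LGate.toGate,
      List.append_nil, List.cons_append, List.nil_append]
  rw [hgs]
  refine Spec.mono (T := 2 + ((B * 10 + 4) + 1)) ?_ (by omega) fun _ => id
  refine (Spec.straight_keeps (b := 12) [.had Cell.h] rfl (by norm_num)
    (by simp [prints, Prog.print, h.h_eq, hπ, address, blockOffset])).cons fun s₁ k₁ => ?_
  have h₁ := h.of_keeps k₁ (by norm_num)
  refine (h₁.forLoop (by norm_num) h₁.n_eq hnB fun v _ s h hs => ?_ : Spec inp _ s₁ _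
    (B * (6 + 4) + 4) _).cons fun s₂ k₂ => Spec.nil fun x hx => ?_
  · refine Spec.straight_keeps _ rfl (by norm_num) ?_
    simp [prints, Prog.print, Prog.next, h.r_eq, h.q_eq, h.h_eq, h.out_eq, hs, hπ, address,
      blockOffset]
    omega
  · rw [Function.update_of_ne (by omega)]
    exact (k₁.trans k₂) x hx

/-- Print the walk. -/
def walkProg : Prog := forLoop 16 17 Cell.rounds stepProg

theorem spec_walkProg {t : ℕ} (hM : M = 2 ^ t) (h : Layout n m l M k i s) (hnB : n ≤ B)
    (hMB : 2 * M ≤ B) (hmM : m ≤ M) (hkB : k ≤ B) (hk : 0 < k) {e : Fin m → SignedPauli n}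
    (hin : RowAt inp (3 + i * (m * (n + 1))) e) :
    Spec inp walkProg s ((List.replicate k (stepGates t e)).flatten.map
      (LGate.toGate (address n l (2 * M - 1) i))) (B * (B * (B * 22 + 100) + 54) + 4)
      (Keeps 18 (Function.update s Cell.input (3 + i * (m * (n + 1)) + m * (n + 1)))) := by
  have hgs : (List.replicate k (stepGates t e)).flatten.map
      (LGate.toGate (address n l (2 * M - 1) i)) = (List.range k).flatMap fun _ =>
        (stepGates t e).map (LGate.toGate (address n l (2 * M - 1) i)) := by
    rw [List.map_flatten, List.map_replicate, List.flatMap_def, List.map_const',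
      List.length_range]
  rw [hgs]
  have hT : B * (B * 22 + 100) + 54 = (B * (B * 22 + 100) + 50) + 4 := rfl
  rw [hT]
  -- Every step of the walk reads the row again from its beginning. The position w is arbitrary
  -- before the first step; as k > 0 it ends just behind the row, where the next register starts
  -- reading.
  refine (Spec.forLoop (b := 18) (fun j s' => ∃ w, Keeps 18 (Function.update s Cell.input w) s' ∧
    (0 < j → w = 3 + i * (m * (n + 1)) + m * (n + 1))) (by norm_num)
    (by norm_num) (by norm_num) (by norm_num) (by norm_num) (by norm_num) hkB
    ?_ ?_ ⟨s Cell.input, by simp [Keeps], by simp⟩ ?_).mono le_rfl ?_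
  · rintro j s₁ s₂ ⟨w, h₁, hw⟩ h₂
    exact ⟨w, h₁.trans h₂, hw⟩
  · rintro j s₁ ⟨w, h₁, hw⟩
    have := h.of_keeps_update h₁ (by norm_num)
    exact ⟨this.rounds_eq, this.one_eq⟩
  · rintro j _ s₁ ⟨w, h₁, hw⟩ hs₁
    have h₂ := h.of_keeps_update h₁ (by norm_num)
    refine (spec_stepProg hM h₂ hnB hMB hmM hin).mono le_rfl fun s₂ k₂ => ?_
    refine ⟨?_, _, h₁.update_trans (k₂.mono (by norm_num)), fun _ => rfl⟩
    rw [k₂ 16 le_rfl, Function.update_of_ne (by norm_num), hs₁]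
  · rintro s₁ ⟨w, h₁, hw⟩
    rwa [hw hk] at h₁

/-- Print the circuit of a register, and prepare for the next register. -/
def registerProg : Prog := block
  [initProg, walkProg, finalProg, block [.add Cell.row Cell.input Cell.zero,
    .add Cell.out Cell.out Cell.n, .add Cell.J Cell.J Cell.size, .add Cell.h Cell.h Cell.size,
    .add Cell.A Cell.A Cell.size, .add Cell.r Cell.r Cell.size, .add Cell.q Cell.q Cell.size,
    .add Cell.top Cell.top Cell.size]]

theorem spec_registerProg {t : ℕ} (hM : M = 2 ^ t) (h : Layout n m l M k i s) (hnB : n ≤ B)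
    (hMB : 2 * M ≤ B) (hmM : m ≤ M) (hkB : k ≤ B) (hk : 0 < k) {e : Fin m → SignedPauli n}
    (hin : RowAt inp (3 + i * (m * (n + 1))) e) :
    Spec inp registerProg s ((registerGates t k e).map
      (LGate.toGate (address n l (2 * M - 1) i))) (B * (B * (B * 22 + 100) + 100) + 50)
      (fun s' => s' 18 = s 18 ∧ Layout n m l M k (i + 1) s') := by
  set π := address n l (2 * M - 1) i with hπ
  have hgs : (registerGates t k e).map (LGate.toGate π) =
      (initGates n (2 * M - 1)).map (LGate.toGate π) ++
      ((List.replicate k (stepGates t e)).flatten.map (LGate.toGate π) ++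
      ((finalGates n).map (LGate.toGate π) ++ ([] ++ []))) := by
    rw [registerGates, indexSize, ← hM]
    simp only [List.map_append, List.append_assoc, List.append_nil]
  rw [hgs]
  refine Spec.mono (T := (B * 29 + 19) + ((B * (B * (B * 22 + 100) + 54) + 4) +
    ((B * 10 + 7) + (9 + 1)))) ?_ (by ring_nf; omega) fun _ => id
  refine (spec_initProg h hnB hMB).cons fun s₁ k₁ => ?_
  have h₁ := h.of_keeps k₁ (by norm_num)
  refine (spec_walkProg hM h₁ hnB hMB hmM hkB hk hin).cons fun s₂ k₂ => ?_
  have h₂ := h₁.of_keeps_update k₂ (by norm_num)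
  refine (spec_finalProg h₂ hnB).cons fun s₃ k₃ => ?_
  have h₃ := h₂.of_keeps k₃ (by norm_num)
  have i₃ : s₃ Cell.input = 3 + i * (m * (n + 1)) + m * (n + 1) := by
    rw [k₃ _ (by norm_num), k₂ _ (by norm_num), Function.update_self]
  have v₃ : s₃ 18 = s 18 := by
    rw [k₃ _ (by norm_num), k₂ _ (by norm_num), Function.update_of_ne (by norm_num),
      k₁ _ (by norm_num)]
  -- Passing to register i + 1 moves each address by one block; the addresses are updated by
  -- addition, as the machine cannot multiply.
  have hmul : ∀ a, (i + 1) * a = i * a + a := fun a => by ring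
  refine Spec.cons (Q₁ := fun s' => s' 18 = s 18 ∧ Layout n m l M k (i + 1) s')
    (Spec.straight (b := 50) [.add Cell.row Cell.input Cell.zero,
    .add Cell.out Cell.out Cell.n, .add Cell.J Cell.J Cell.size, .add Cell.h Cell.h Cell.size,
    .add Cell.A Cell.A Cell.size, .add Cell.r Cell.r Cell.size, .add Cell.q Cell.q Cell.size,
    .add Cell.top Cell.top Cell.size] rfl ⟨?_, ?_⟩ rfl) fun s₄ h₄ => Spec.nil
      ⟨by rw [Function.update_of_ne (by norm_num), h₄.1],
        h₄.2.of_keeps (b := 30) (fun x hx => Function.update_of_ne (by omega) _ _) le_rfl⟩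
  · simp [nexts, Prog.next, v₃]
  · obtain ⟨e1, e2, e3, e4, e5, e6, e7, e8, e9, e10, e11, e12, e13, e14, e15, e16, e17, e18⟩ := h₃
    constructor <;> simp [nexts, Prog.next, *] <;> ring

end Programs

/-! #### The input -/

theorem getD_flatten_ofFn {k w : ℕ} (f : Fin k → List ℕ) (hf : ∀ i, (f i).length = w) (i : Fin k)
    {j : ℕ} (hj : j < w) : (List.ofFn f).flatten.getD (i * w + j) 0 = (f i).getD j 0 := by
  induction k with
  | zero => exact i.elim0
  | succ k ih =>
    rw [List.ofFn_succ, List.flatten_cons]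
    refine Fin.cases ?_ (fun i => ?_) i
    · rw [List.getD_append _ _ _ _ (by rw [hf]; simpa using hj)]
      simp
    · have h := ih (fun v => f v.succ) (fun v => hf _) i
      rw [List.getD_append_right _ _ _ _ (by rw [hf, Fin.val_succ]; nlinarith), ← h, hf]
      congr 1
      rw [Fin.val_succ, add_mul, one_mul]
      omega

theorem rowAt_encodeTable {n m l : ℕ} (E : Table n m l) (i : Fin l) :
    RowAt (encodeTable E) (3 + i * (m * (n + 1))) (E i) := by
  have hlen₁ : ∀ (i : Fin l) (j : Fin m),
      (((E i j).1 : ℕ) :: List.ofFn fun k : Fin n => ((E i j).2 k).code).length = n + 1 := by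
    intro i j
    simp
  have hlen₂ : ∀ i : Fin l, ((List.ofFn fun j : Fin m =>
      ((E i j).1 : ℕ) :: List.ofFn fun k : Fin n => ((E i j).2 k).code).flatten).length =
        m * (n + 1) := by
    intro i
    rw [List.length_flatten, List.map_ofFn]
    simp [Function.comp_def, List.ofFn_const]
  have key : ∀ (j : Fin m) (a : ℕ), a < n + 1 →
      (encodeTable E).getD (3 + i * (m * (n + 1)) + j * (n + 1) + a) 0 =
        (((E i j).1 : ℕ) :: List.ofFn fun k : Fin n => ((E i j).2 k).code).getD a 0 := by
    intro j a ha
    have hlt : (j : ℕ) * (n + 1) + a < m * (n + 1) := by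
      have := Nat.mul_le_mul_right (n + 1) (Nat.succ_le_of_lt j.2)
      rw [Nat.succ_mul] at this
      omega
    have hidx : 3 + i * (m * (n + 1)) + j * (n + 1) + a =
        (i * (m * (n + 1)) + (j * (n + 1) + a)) + 1 + 1 + 1 := by ring
    rw [encodeTable, hidx]
    simp only [List.cons_append, List.nil_append, List.getD_cons_succ]
    rw [getD_flatten_ofFn _ hlen₂ i hlt, getD_flatten_ofFn _ (hlen₁ i) j ha]
  intro j
  refine ⟨?_, fun k => ?_⟩
  · have := key j 0 (by omega)
    simpa using this
  · have := key j (k + 1) (by omega)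
    rw [add_assoc _ 1, add_comm 1, this, List.getD_cons_succ, List.getD_eq_getElem _ _ (by simp)]
    simp

/-! ### Computing the parameters without multiplication, and the complete program. -/

section Programs

variable {n m l M k i B : ℕ} {inp : List ℕ} {s s' : Memory}

/-- Find the smallest power of `4` that is at least the number of entries of a row. -/
def powerProg : Prog := .loop 1 (block
  [.add Cell.leaves Cell.leaves Cell.leaves, .add Cell.leaves Cell.leaves Cell.leaves,
    .add Cell.root Cell.root Cell.root, .sub 1 Cell.m Cell.leaves])

/-- Cell 1 holds the truncated difference of m and 4^j, which vanishes exactly when m ≤ 4^j. The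
minimality of t keeps the loop from stopping early. -/
theorem spec_powerProg {t : ℕ} (ht : m ≤ 4 ^ t) (ht' : ∀ j < t, 4 ^ j < m) (r j : ℕ)
    (hj : j + r = t) (hm : s Cell.m = m) (hM : s Cell.leaves = 4 ^ j) (hK : s Cell.root = 2 ^ j)
    (h1 : s 1 = m - 4 ^ j) : Spec inp powerProg s [] (r * 6 + 1) (fun s' =>
      s' Cell.leaves = 4 ^ t ∧ s' Cell.root = 2 ^ t ∧
        ∀ x, 2 ≤ x → x ≠ Cell.leaves → x ≠ Cell.root → s' x = s x) := by
  induction r generalizing j s with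
  | zero =>
    rw [add_zero] at hj
    subst hj
    exact Spec.loop_done (by omega) ⟨hM, hK, fun _ _ _ _ => rfl⟩
  | succ r ih =>
    have hlt := ht' j (by omega)
    have h4 : 4 ^ (j + 1) = 4 ^ j + 4 ^ j + (4 ^ j + 4 ^ j) := by ring
    have h2 : 2 ^ (j + 1) = 2 ^ j + 2 ^ j := by ring
    rw [← List.nil_append []]
    refine (Spec.loop_step (T₁ := 5) (T₂ := r * 6 + 1) (Q₁ := fun s₁ => s₁ Cell.m = m ∧
      s₁ Cell.leaves = 4 ^ (j + 1) ∧ s₁ Cell.root = 2 ^ (j + 1) ∧ s₁ 1 = m - 4 ^ (j + 1) ∧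
        ∀ x, 2 ≤ x → x ≠ Cell.leaves → x ≠ Cell.root → s₁ x = s x) (by omega)
      (Spec.straight (b := 50) _ rfl ⟨?_, ?_, ?_, ?_, ?_⟩ rfl) ?_).mono (by omega) fun _ => id
    · rintro s₁ ⟨q1, q2, q3, q4, q5⟩
      refine (ih (j + 1) (by omega) q1 q2 q3 q4).mono le_rfl fun s₂ ⟨p1, p2, p3⟩ => ?_
      exact ⟨p1, p2, fun x hx hx1 hx2 => (p3 x hx hx1 hx2).trans (q5 x hx hx1 hx2)⟩
    · simp [nexts, Prog.next, hm]
    · simp [nexts, Prog.next, hM, h4]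
    · simp [nexts, Prog.next, hK, h2]
    · simp [nexts, Prog.next, hm, hM, h4]
    · intro x hx hx1 hx2
      have e0 : x ≠ 0 := by omega
      have e1 : x ≠ 1 := by omega
      simp only [nexts, Prog.next, List.foldl_cons, List.foldl_nil, Function.update_of_ne e0,
        Function.update_of_ne e1, Function.update_of_ne hx1, Function.update_of_ne hx2]

/-- Divide by `8` to find the number of steps of the walk. -/
def divideProg : Prog := .loop 1 (block [.add Cell.rounds Cell.rounds 3, .sub 1 1 2])

/-- Repeated truncated subtraction computes ⌈a/8⌉. It is used with a = 2^t − 7, truncated at 0, for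
which this equals 2^t / 8 rounded down. -/
theorem spec_divideProg (a : ℕ) (h1 : s 1 = a) (h2 : s 2 = 8) (h3 : s 3 = 4) :
    Spec inp divideProg s [] (a * 4 + 1) (fun s' =>
      s' Cell.rounds = s Cell.rounds + 4 * ((a + 7) / 8) ∧
        ∀ x, 2 ≤ x → x ≠ Cell.rounds → s' x = s x) := by
  induction a using Nat.strong_induction_on generalizing s with
  | _ a ih =>
    rcases Nat.eq_zero_or_pos a with rfl | ha
    · exact Spec.loop_done h1 ⟨by simp, fun _ _ _ => rfl⟩
    · rw [← List.nil_append []]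
      refine (Spec.loop_step (T₁ := 3) (T₂ := (a - 8) * 4 + 1) (Q₁ := fun s₁ => s₁ 1 = a - 8 ∧
        s₁ Cell.rounds = s Cell.rounds + 4 ∧ ∀ x, 2 ≤ x → x ≠ Cell.rounds → s₁ x = s x) (by omega)
        (Spec.straight (b := 50) _ rfl ⟨?_, ?_, ?_⟩ rfl) ?_).mono (by omega) fun _ => id
      · rintro s₁ ⟨q1, q2, q3⟩
        refine (ih (a - 8) (by omega) q1 (by rw [q3 2 le_rfl (by norm_num), h2])
          (by rw [q3 3 (by norm_num) (by norm_num), h3])).mono le_rfl fun s₂ ⟨p1, p2⟩ => ?_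
        refine ⟨?_, fun x hx hx1 => (p2 x hx hx1).trans (q3 x hx hx1)⟩
        rw [p1, q2]
        omega
      · simp [nexts, Prog.next, h1, h2]
      · simp [nexts, Prog.next, h3]
      · intro x hx hx1
        have e0 : x ≠ 0 := by omega
        have e1 : x ≠ 1 := by omega
        simp only [nexts, Prog.next, List.foldl_cons, List.foldl_nil, Function.update_of_ne e0,
          Function.update_of_ne e1, Function.update_of_ne hx1]

/-- The program of the forger. -/
def forgeProg : Prog := block
  [block [.const Cell.one 1, .read Cell.n 0, .read Cell.m Cell.one, .const 1 2, .read Cell.l 1,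
      .const Cell.leaves 1, .const Cell.root 1, .sub 1 Cell.m Cell.leaves],
    powerProg,
    block [.const Cell.rounds 1, .const 1 7, .sub 1 Cell.root 1, .const 2 8, .const 3 4],
    divideProg,
    block [.const Cell.zero 0, .const Cell.out 0, .const Cell.row 3, .const Cell.J 0,
      .sub Cell.inner Cell.leaves Cell.one, .add Cell.index Cell.leaves Cell.inner,
      .sub Cell.pad Cell.leaves Cell.m, .add Cell.size Cell.index Cell.index,
      .add Cell.size Cell.size Cell.one, .add Cell.size Cell.size Cell.n,
      .add Cell.size Cell.size Cell.n, .add Cell.size Cell.size Cell.n],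
    forLoop 10 11 Cell.l (block [.add Cell.J Cell.J Cell.n]),
    block [.add Cell.h Cell.J Cell.index, .add Cell.A Cell.h Cell.index,
      .add Cell.A Cell.A Cell.one, .add Cell.r Cell.A Cell.n, .add Cell.q Cell.r Cell.n,
      .add Cell.top Cell.h Cell.index],
    forLoop 18 19 Cell.l registerProg]

/-- The degree four of the time bound comes from four nested loops: registers, steps of the walk,
entries of the row, qubits. -/
theorem spec_forgeProg {t : ℕ} (E : Table n m l) (ht : m ≤ 4 ^ t) (ht' : ∀ j < t, 4 ^ j < m)
    (hnB : n ≤ B) (hMB : 2 * 4 ^ t ≤ B) (hlB : l ≤ B) :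
    Spec (encodeTable E) forgeProg (fun _ => 0) (moneyGates n l (indexSize (2 * t)) fun i =>
      registerGates (2 * t) (4 * (2 ^ t / 8) + 1) (E i))
      (B * (B * (B * (B * 22 + 100) + 100) + 100) + 100) fun _ => True := by
  have hM : 4 ^ t = 2 ^ (2 * t) := by rw [pow_mul]; norm_num
  set M := 4 ^ t with hMdef
  set k := 4 * (2 ^ t / 8) + 1 with hk
  have hMpos : 0 < M := by positivity
  have h2t : 2 ^ t ≤ M := Nat.pow_le_pow_left (by norm_num) t
  have htB : t < M := Nat.lt_pow_self (by norm_num)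
  set inp := encodeTable E with hinp
  have hi0 : inp.getD 0 0 = n := rfl
  have hi1 : inp.getD 1 0 = m := rfl
  have hi2 : inp.getD 2 0 = l := rfl
  have hgs : moneyGates n l (indexSize (2 * t)) (fun i => registerGates (2 * t) k (E i)) =
      [] ++ ([] ++ ([] ++ ([] ++ ([] ++ (((List.range l).flatMap fun _ => []) ++ ([] ++
        (((List.range l).flatMap fun i => if hi : i < l then
          (registerGates (2 * t) k (E ⟨i, hi⟩)).map (LGate.toGate (address n l (2 * M - 1) i))
            else []) ++ []))))))) := by
    have : (List.range l).flatMap (fun _ => ([] : List Gate)) = [] := by simp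
    rw [this]
    simp only [List.nil_append, List.append_nil]
    rw [moneyGates, indexSize, ← hM, ← List.map_coe_finRange_eq_range, List.flatMap_map]
    refine List.flatMap_congr fun i _ => ?_
    simp
  rw [hgs]
  refine Spec.mono (T := 9 + ((t * 6 + 1) + (6 + (((2 ^ t - 7) * 4 + 1) + (13 +
    ((B * 6 + 4) + (7 + ((B * (B * (B * (B * 22 + 100) + 100) + 54) + 4) + 1)))))))) ?_
    (by ring_nf; omega) fun _ => id
  refine Spec.cons (Q₁ := fun s => s Cell.one = 1 ∧ s Cell.n = n ∧ s Cell.m = m ∧ s Cell.l = l ∧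
    s Cell.leaves = 4 ^ 0 ∧ s Cell.root = 2 ^ 0 ∧ s 1 = m - 4 ^ 0)
    (Spec.straight (b := 50) _ rfl ?_ rfl) ?_
  -- Memory starts with zeros, so the first `read`, addressed by cell 0, finds n.
  · simp only [List.getD_eq_getElem?_getD] at hi0 hi1 hi2
    simp [nexts, Prog.next, hi0, hi1, hi2]
  rintro s₁ ⟨a1, a2, a3, a4, a5, a6, a7⟩
  refine (spec_powerProg ht ht' t 0 (zero_add t) a3 a5 a6 a7).cons fun s₂ ⟨b1, b2, b3⟩ => ?_
  refine Spec.cons (Q₁ := fun s => s Cell.one = 1 ∧ s Cell.n = n ∧ s Cell.m = m ∧ s Cell.l = l ∧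
    s Cell.leaves = M ∧ s Cell.rounds = 1 ∧ s 1 = 2 ^ t - 7 ∧ s 2 = 8 ∧ s 3 = 4)
    (Spec.straight (b := 50) _ rfl ?_ rfl) ?_
  · have c1 := b3 Cell.one (by norm_num) (by norm_num) (by norm_num)
    have c2 := b3 Cell.n (by norm_num) (by norm_num) (by norm_num)
    have c3 := b3 Cell.m (by norm_num) (by norm_num) (by norm_num)
    have c4 := b3 Cell.l (by norm_num) (by norm_num) (by norm_num)
    simp [nexts, Prog.next, c1, c2, c3, c4, a1, a2, a3, a4, b1, b2, hMdef]
  rintro s₃ ⟨c1, c2, c3, c4, c5, c6, c7, c8, c9⟩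
  refine (spec_divideProg _ c7 c8 c9).cons fun s₄ ⟨d1, d2⟩ => ?_
  refine Spec.cons (Q₁ := fun s => s Cell.one = 1 ∧ s Cell.n = n ∧ s Cell.m = m ∧ s Cell.l = l ∧
    s Cell.inner = M - 1 ∧ s Cell.index = 2 * M - 1 ∧ s Cell.rounds = k ∧ s Cell.pad = M - m ∧
    s Cell.out = 0 ∧ s Cell.J = 0 ∧ s Cell.row = 3 ∧ s Cell.size = blockSize n (2 * M - 1) ∧
    s Cell.zero = 0) (Spec.straight (b := 50) _ rfl ?_ rfl) ?_
  · have e1 := d2 Cell.one (by norm_num) (by norm_num)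
    have e2 := d2 Cell.n (by norm_num) (by norm_num)
    have e3 := d2 Cell.m (by norm_num) (by norm_num)
    have e4 := d2 Cell.l (by norm_num) (by norm_num)
    have e5 := d2 Cell.leaves (by norm_num) (by norm_num)
    simp only [nexts, Prog.next, List.foldl_cons, List.foldl_nil]
    simp [e1, e2, e3, e4, e5, d1, c1, c2, c3, c4, c5, c6, blockSize]
    omega
  rintro s₅ ⟨e1, e2, e3, e4, e5, e6, e7, e8, e9, e10, e11, e12, e13⟩
  have h₅ : Function.update s₅ Cell.J (0 * n) = s₅ := by
    rw [zero_mul, Function.update_eq_self_iff, e10]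
  -- The offset l·n of the ancillas is accumulated by repeated addition.
  refine (Spec.forLoop (T := 2) (b := 12) (fun j => Keeps 12 (Function.update s₅ Cell.J (j * n)))
    (by norm_num) (by norm_num) (by norm_num) (by norm_num) (by norm_num) (by norm_num) hlB
    (fun i s₁ s₂ h₁ h₂ => h₁.trans h₂) ?_ (by rw [h₅]; exact Keeps.refl _ _) ?_).cons ?_
  · intro j s h
    rw [Keeps.update_iff (by norm_num)] at h
    exact ⟨(h.2 _ (by norm_num) (by norm_num)).trans e4,
      (h.2 _ (by norm_num) (by norm_num)).trans e1⟩
  · intro j _ s h hs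
    rw [Keeps.update_iff (by norm_num)] at h
    have hn := (h.2 Cell.n (by norm_num) (by norm_num)).trans e2
    refine Spec.straight (b := 50) _ rfl ⟨by simp [nexts, Prog.next, hs], ?_⟩ rfl
    rw [Keeps.update_iff (by norm_num)]
    refine ⟨by simp [nexts, Prog.next, h.1, hn, add_mul], fun x hx hxJ => ?_⟩
    rw [Function.update_of_ne (by omega)]
    simp only [nexts, Prog.next, List.foldl_cons, List.foldl_nil, Function.update_of_ne hxJ]
    exact h.2 x hx hxJ
  intro s₆ h₆
  rw [Keeps.update_iff (by norm_num)] at h₆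
  refine Spec.cons (Q₁ := Layout n m l M k 0) (Spec.straight (b := 50) _ rfl ?_ rfl) ?_
  · have f : ∀ x, 30 ≤ x → x ≠ Cell.J → s₆ x = s₅ x := fun x hx => h₆.2 x (by omega)
    have f1 := (f Cell.one (by norm_num) (by norm_num)).trans e1
    have f2 := (f Cell.n (by norm_num) (by norm_num)).trans e2
    have f3 := (f Cell.m (by norm_num) (by norm_num)).trans e3
    have f4 := (f Cell.l (by norm_num) (by norm_num)).trans e4
    have f5 := (f Cell.inner (by norm_num) (by norm_num)).trans e5
    have f6 := (f Cell.index (by norm_num) (by norm_num)).trans e6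
    have f7 := (f Cell.rounds (by norm_num) (by norm_num)).trans e7
    have f8 := (f Cell.pad (by norm_num) (by norm_num)).trans e8
    have f9 := (f Cell.out (by norm_num) (by norm_num)).trans e9
    have f10 := h₆.1
    have f11 := (f Cell.row (by norm_num) (by norm_num)).trans e11
    have f12 := (f Cell.size (by norm_num) (by norm_num)).trans e12
    have f13 := (f Cell.zero (by norm_num) (by norm_num)).trans e13
    constructor <;> simp [nexts, Prog.next, f1, f2, f3, f4, f5, f6, f7, f8, f9, f10, f11, f12,
      f13] <;> omega
  intro s₇ h₇
  refine (Spec.forLoop (b := 20) (T := B * (B * (B * 22 + 100) + 100) + 50)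
    (fun j s => Layout n m l M k j s) (by norm_num) (by norm_num) (by norm_num) (by norm_num)
    (by norm_num) (by norm_num) hlB (fun i s₁ s₂ h₁ h₂ => h₁.of_keeps h₂ (by norm_num))
    (fun j s h => ⟨h.l_eq, h.one_eq⟩) h₇ fun j hj s h hs => ?_).cons fun _ _ => Spec.nil trivial
  rw [dif_pos hj]
  refine (spec_registerProg hM h hnB hMB ht (by omega) (by omega)
    (rowAt_encodeTable E ⟨j, hj⟩)).mono le_rfl fun s₁ ⟨p1, p2⟩ => ⟨p1.trans hs, p2⟩

/-- Minimality of t gives both the upper bound on 4^t and the condition under which the search loop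
of the program continues. -/
theorem exists_power (hm : 0 < m) : ∃ t, m ≤ 4 ^ t ∧ 4 ^ t < 4 * m ∧ ∀ j < t, 4 ^ j < m := by
  have hex : ∃ t, m ≤ 4 ^ t := ⟨m, (Nat.lt_pow_self (by norm_num)).le⟩
  classical
  refine ⟨Nat.find hex, Nat.find_spec hex, ?_, fun j hj => not_le.1 (Nat.find_min hex hj)⟩
  rcases Nat.eq_zero_or_pos (Nat.find hex) with h | h
  · rw [h]
    omega
  · have := Nat.find_min hex (Nat.sub_one_lt h.ne')
    rw [← Nat.sub_one_add_one h.ne', pow_succ]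
    omega

open Polynomial in
theorem exists_generates : ∃ p : Polynomial ℕ, ∀ n m l : ℕ, 0 < n → 0 < m → ∃ t : ℕ,
    m ≤ (2 ^ t) ^ 2 ∧ (2 ^ t) ^ 2 < 4 * m ∧ ∀ E : Table n m l,
      Generates forgeProg E (tensor fun i => rowDensity (2 * t) (4 * (2 ^ t / 8) + 1) (E i))
        (p.eval (n + m + l)) := by
  -- The common bound B = 8(n + m + l) dominates 2·4^t because 4^t < 4m. The exponent t is fixed
  -- before the table, since it depends on m only.
  refine ⟨(8 * X) * ((8 * X) * ((8 * X) * ((8 * X) * 22 + 100) + 100) + 100) + 100,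
    fun n m l hn hm => ?_⟩
  obtain ⟨t, h1, h2, h3⟩ := exists_power hm
  have h4 : (2 ^ t) ^ 2 = 4 ^ t := by rw [← pow_mul, mul_comm, pow_mul]; norm_num
  refine ⟨t, h4 ▸ h1, h4 ▸ h2, fun E => ?_⟩
  obtain ⟨T, s, he, hT, -⟩ := spec_forgeProg (B := 8 * (n + m + l)) E h1 h3 (by omega) (by omega)
    (by omega)
  refine ⟨_, T, s, he, ?_, outputState_moneyGates _ _ E hn⟩
  simpa using hT

end Programs

/-! ### The forger succeeds -/

section Forger

variable {n m l : ℕ}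

/-- If few rows are bad, states that do well on the good rows are accepted. -/
theorem one_sub_exp_le_acceptProb_of_badRow_le (hm : 0 < m) (hl : 0 < l) {ε : ℝ}
    (hε : ε ≤ 1 / (16 * Real.sqrt m)) {E : Table n m l}
    {ρ : Fin l → Matrix (Basis n) (Basis n) ℂ} (hρ : ∀ i, IsDensityMatrix (ρ i))
    (hgood : ∀ i, GoodRow (E i) → 1 / (16 * Real.sqrt m) ≤ rowMean (ρ i) (E i))
    (hbad : ∑ i, badRow (E i) ≤ l * (1 / (128 * Real.sqrt m))) :
    1 - Real.exp (-(1 / 16384) * (l / m)) ≤ acceptProb ε E (tensor ρ) := by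
  have hm1 : (1 : ℝ) ≤ m := by exact_mod_cast hm
  set x := Real.sqrt m with hx
  have hxx : x * x = m := Real.mul_self_sqrt (by positivity)
  have hx1 : 1 ≤ x := Real.one_le_sqrt.2 hm1
  have hx0 : 0 < x := by linarith
  have hl0 : (0 : ℝ) < l := by exact_mod_cast hl
  have hle : 1 / (16 * x) ≤ 1 := by
    rw [div_le_one (by positivity)]
    linarith
  -- A bad row has mean at least −1 and 1/(16x) ≤ 1, so it loses at most 2 against a good one.
  have hrow : ∀ i, 1 / (16 * x) - 2 * badRow (E i) ≤ rowMean (ρ i) (E i) := by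
    intro i
    by_cases h : GoodRow (E i)
    · rw [badRow, if_pos h]
      linarith [hgood i h]
    · rw [badRow, if_neg h]
      linarith [neg_le_of_abs_le (abs_rowMean_le_one (hρ i) (E i))]
  have hsum : l * (1 / (16 * x)) - 2 * (l * (1 / (128 * x))) ≤ ∑ i, rowMean (ρ i) (E i) := by
    have h := Finset.sum_le_sum fun i (_ : i ∈ Finset.univ) => hrow i
    rw [Finset.sum_sub_distrib, ← Finset.mul_sum, Finset.sum_const, Finset.card_univ,
      Fintype.card_fin, nsmul_eq_mul] at h
    linarith
  have ht : 1 / (128 * x) ≤ 1 := by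
    rw [div_le_one (by positivity)]
    linarith
  -- The choice t = 1/(128x) minimizes −t/(64x) + t², and the minimum is −1/(16384 m).
  refine le_trans ?_ (one_sub_exp_le_acceptProb hm hl ε E ρ hρ (t := 1 / (128 * x))
    (by positivity) ht)
  refine sub_le_sub_left (Real.exp_le_exp.2 ?_) _
  -- Per register, the bad rows lower the guaranteed mean from 4/(64x) to 3/(64x), while ε/2 is at
  -- most 2/(64x); the margin is 1/(64x).
  have hdiff : l * (ε / 2) - ∑ i, rowMean (ρ i) (E i) ≤ -(l * (1 / (64 * x))) := by
    have h1 : l * (ε / 2) ≤ l * (1 / (16 * x) / 2) := by gcongr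
    have h2 : l * (1 / (16 * x) / 2) - (l * (1 / (16 * x)) - 2 * (l * (1 / (128 * x)))) =
        -(l * (1 / (64 * x))) := by
      field_simp
      norm_num
    linarith
  have h3 := mul_le_mul_of_nonneg_left hdiff (by positivity : 0 ≤ 1 / (128 * x))
  have h4 : 1 / (128 * x) * -(l * (1 / (64 * x))) + l * (1 / (128 * x)) ^ 2 =
      -(1 / 16384) * (l / m) := by
    rw [← hxx]
    field_simp
    norm_num
  linarith

/-- One term of the exponential series bounds the whole from below. -/
theorem pow_mul_exp_neg_le (k : ℕ) {α x : ℝ} (hα : 0 < α) (hx : 0 ≤ x) :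
    x ^ k * Real.exp (-α * x) ≤ (k.factorial : ℝ) / α ^ k := by
  have h := Real.pow_div_factorial_le_exp (α * x) (by positivity) k
  rw [div_le_iff₀ (by positivity), mul_pow] at h
  rw [le_div_iff₀ (by positivity), neg_mul, Real.exp_neg]
  have he := Real.exp_pos (α * x)
  rw [← div_eq_mul_inv, div_mul_eq_mul_div, div_le_iff₀ he]
  linarith

/-- The probability of many bad rows is exponentially small. -/
theorem exists_le_mul_exp (d : ℕ) : ∃ C : ℝ, ∀ n m : ℕ, 0 < n → 0 < m → m ≤ n ^ d + d →
    ((m : ℝ) + m ^ 4) * (2 / 2 ^ n) / (1 / (128 * Real.sqrt m)) ≤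
      C * Real.exp (-(Real.log 2 / 2) * n) := by
  set α := Real.log 2 / 2 with hα
  have hα0 : 0 < α := by have := Real.log_pos (by norm_num : (1 : ℝ) < 2); positivity
  -- Here 2^{-n} = e^{−2αn}. One factor e^{−αn} absorbs n^{5d}, which comes from m⁴·√m ≤ m⁵ and m ≤
  -- (1 + d)n^d; the other factor remains. The number 512 is 2·2·128.
  refine ⟨512 * (1 + d) ^ 5 * ((5 * d).factorial / α ^ (5 * d)), fun n m hn hm hmd => ?_⟩
  have hn1 : (1 : ℝ) ≤ n := by exact_mod_cast hn
  have hm1 : (1 : ℝ) ≤ m := by exact_mod_cast hm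
  have hmd' : (m : ℝ) ≤ (1 + d) * n ^ d := by
    have h1 : (m : ℝ) ≤ n ^ d + d := by exact_mod_cast hmd
    have h2 : (1 : ℝ) ≤ n ^ d := one_le_pow₀ hn1
    have h3 : (d : ℝ) * 1 ≤ d * n ^ d := by gcongr
    linarith
  have hsq : Real.sqrt m ≤ m := by
    rw [Real.sqrt_le_left (by positivity)]
    nlinarith
  have h2n : (2 : ℝ) ^ n = Real.exp (α * n) * Real.exp (α * n) := by
    rw [← Real.exp_add, ← add_mul, hα, add_halves, mul_comm, Real.exp_nat_mul,
      Real.exp_log (by norm_num)]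
  have hinv : 2 / 2 ^ n = 2 * (Real.exp (-α * n) * Real.exp (-α * n)) := by
    rw [h2n, neg_mul, Real.exp_neg]
    field_simp
  have hm4 : (m : ℝ) ≤ m ^ 4 := le_self_pow₀ hm1 (by norm_num)
  have he := (Real.exp_pos (-α * n)).le
  calc ((m : ℝ) + m ^ 4) * (2 / 2 ^ n) / (1 / (128 * Real.sqrt m))
      = (m + m ^ 4) * (256 * Real.sqrt m) * (Real.exp (-α * n) * Real.exp (-α * n)) := by
        rw [hinv, one_div, div_inv_eq_mul]
        ring
    _ ≤ (m ^ 4 + m ^ 4) * (256 * m) * (Real.exp (-α * n) * Real.exp (-α * n)) := by gcongr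
    _ = 512 * m ^ 5 * (Real.exp (-α * n) * Real.exp (-α * n)) := by ring
    _ ≤ 512 * ((1 + d) * n ^ d) ^ 5 * (Real.exp (-α * n) * Real.exp (-α * n)) := by gcongr
    _ = 512 * (1 + d) ^ 5 * ((n : ℝ) ^ (5 * d) * Real.exp (-α * n)) * Real.exp (-α * n) := by
        rw [mul_comm 5 d, pow_mul]
        ring
    _ ≤ 512 * (1 + d) ^ 5 * ((5 * d).factorial / α ^ (5 * d)) * Real.exp (-α * n) := by
        have := pow_mul_exp_neg_le (5 * d) hα0 (by positivity : (0 : ℝ) ≤ n)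
        gcongr

end Forger

end StabilizerMoney

end

theorem mainTheorem4 :
    ∃ (P : StabilizerMoney.Prog) (p : Polynomial ℕ) (c : ℝ), 0 < c ∧
      ∀ d : ℕ, ∃ C α : ℝ, 0 < α ∧
        ∀ (n m l : ℕ) (ε : ℝ), 0 < n → 0 < m → 0 < l → m ≤ n ^ d + d →
          0 ≤ ε → ε ≤ 1 / (16 * Real.sqrt m) →
          ∃ ρ : StabilizerMoney.Table n m l → Fin l →
              Matrix (StabilizerMoney.Basis n) (StabilizerMoney.Basis n) ℂ,
            (∀ E i, StabilizerMoney.IsDensityMatrix (ρ E i)) ∧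
            (∀ E, StabilizerMoney.Generates P E (StabilizerMoney.tensor (ρ E))
              (p.eval (n + m + l))) ∧
            1 - C * Real.exp (-α * n) ≤
              StabilizerMoney.bankProb ε {E : StabilizerMoney.Table n m l |
                1 - Real.exp (-c * (l / m)) ≤
                  StabilizerMoney.acceptProb ε E (StabilizerMoney.tensor (ρ E))} := by
  obtain ⟨p, hp⟩ := StabilizerMoney.exists_generates
  refine ⟨StabilizerMoney.forgeProg, p, 1 / 16384, by norm_num, fun d => ?_⟩
  obtain ⟨C, hC⟩ := StabilizerMoney.exists_le_mul_exp d
  refine ⟨C, Real.log 2 / 2, by have := Real.log_pos (by norm_num : (1 : ℝ) < 2); positivity,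
    fun n m l ε hn hm hl hmd hε0 hε => ?_⟩
  obtain ⟨t, ht1, ht2, hgen⟩ := hp n m l hn hm
  have hm1 : (1 : ℝ) ≤ m := by exact_mod_cast hm
  have hx1 : 1 ≤ Real.sqrt m := Real.one_le_sqrt.2 hm1
  have hε1 : ε ≤ 1 := hε.trans (by rw [div_le_one (by positivity)]; linarith)
  have hdens : ∀ (E : StabilizerMoney.Table n m l) i, StabilizerMoney.IsDensityMatrix
      (StabilizerMoney.rowDensity (2 * t) (4 * (2 ^ t / 8) + 1) (E i)) := fun E i =>
    StabilizerMoney.isDensityMatrix_rowDensity _ _ _ (by rwa [mul_comm 2 t, pow_mul])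
  refine ⟨fun E i => StabilizerMoney.rowDensity (2 * t) (4 * (2 ^ t / 8) + 1) (E i), hdens,
    hgen, ?_⟩
  -- The tolerated fraction of bad rows is η = 1/(128√m), as fixed by the hypothesis `hbad` of the
  -- acceptance bound.
  refine le_trans (sub_le_sub_left (hC n m hn hm hmd) 1)
    (StabilizerMoney.one_sub_le_bankProb hε0 hε1 hl (by positivity) fun E hE => ?_)
  exact StabilizerMoney.one_sub_exp_le_acceptProb_of_badRow_le hm hl hε (hdens E)
    (fun i hi => hi.le_rowMean_rowDensity hm ht1 ht2) hE
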